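/- Let $\mathbf{Const}$ be an infinite, densely linearly ordered set of constants, whose elements are written as distinct words over $\{0,1\}$ (so $\mathbf{Const}$ is countable); names of relations, atomic concepts, atomic roles and variables are also words over $\{0,1\}$. A schema $\mathbf S$ consists of finitely many relation names, each with an arity, and a set of first-order sentences over these relations, the constants and the order $<$ (the integrity constraints). An $\mathbf S$-instance is a finite set of facts over $\mathbf S$ that satisfies the constraints. A DL-Lite$_{\mathcal R}$ TBox $\mathcal T$ is a finite set of axioms $B\sqsubseteq C$ and $R\sqsubseteq E$, where $R ::= P\mid P^-$, $B::=A\mid\exists R$, $C::=B\mid\neg B$ and $E::=R\mid\neg R$, with $A$ an atomic concept and $P$ an atomic role. Interpretations $\mathcal I$ assign to each atomic concept a unary, and to each atomic role a binary, relation over $\mathbf{Const}$, and are extended to all expressions as usual. We write $\mathcal T\models C_1\sqsubseteq C_2$ if $\mathcal I(C_1)\subseteq\mathcal I(C_2)$ for every interpretation $\mathcal I$ that satisfies $\mathcal T$. A GAV mapping assertion is a sentence $\forall \vec x\,(\phi_1\wedge\dots\wedge\phi_n\to\psi)$, where each $\phi_i$ is an atom over $\mathbf S$ whose arguments are variables or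 constants, and $\psi$ is $A(x)$ or $P(x,y)$ with variables that occur in the $\phi_i$. An OBDA specification is a triple $\mathcal B=(\mathcal T,\mathbf S,\mathcal M)$ with a DL-Lite$_{\mathcal R}$ TBox $\mathcal T$, a schema $\mathbf S$ and a finite set $\mathcal M$ of GAV mapping assertions. A solution for an $\mathbf S$-instance $I$ is an interpretation $\mathcal I$ that satisfies $\mathcal T$ and, together with $I$, all assertions in $\mathcal M$. The induced $\mathbf S$-ontology $\mathcal O_{\mathcal B}=(\mathcal C,\sqsubseteq,ext)$ consists of the set $\mathcal C$ of the basic concept expressions $B$ that occur in $\mathcal T$, the pre-order $C_1\sqsubseteq C_2\iff\mathcal T\models C_1\sqsubseteq C_2$ on $\mathcal C$, and $ext(C,I)=\bigcap\{\mathcal I(C)\mid \mathcal I\text{ is a solution for }I\text{ w.r.t. }\mathcal B\}$ (which is $\mathbf{Const}$ if there is no solution). It is represented by a list of the elements of $\mathcal C$, a list of the pairs in $\sqsubseteq$, and a Turing machine $M$ for which there is a polynomial $p$ such that, for all $C\in\mathcal C$, all $\mathbf S$-instances $I$ (given as a list of facts) and all $c\in\mathbf{Const}$, $M$ decides on input $(C,I,c)$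 of length $n$ within $p(n)$ steps whether $c\in ext(C,I)$. **Theorem.** There is a polynomial-time Turing machine that, given an OBDA specification $\mathcal B=(\mathcal T,\mathbf S,\mathcal M)$, where $\mathcal T$ is a DL-Lite$_{\mathcal R}$ TBox and $\mathcal M$ is a set of GAV mapping assertions, outputs such a representation of the induced $\mathbf S$-ontology $\mathcal O_{\mathcal B}$. (The polynomial $p$ for the output machine may depend on $\mathcal B$. The integrity constraints of $\mathbf S$ are not needed as part of the input.) -/

import Mathlib

namespace OBDA

/-! ## Names, schemas, instances -/

/-- Names of relations, atomic concepts, atomic roles and variables are finite words. -/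
abbrev Name : Type := List Bool

/-- A fact `R(b₁, …, b_k)` over the set `Const` of constants. -/
structure Fact (Const : Type) where
  rel : Name
  args : List Const

/-- Function symbols of first-order sentences over a schema: the constants. -/
inductive SchemaFun (Const : Type) : ℕ → Type
  | const (c : Const) : SchemaFun Const 0

/-- Relation symbols of first-order sentences over a schema: the relation names of the schema, with
their arities, and the order on the constants. -/
inductive SchemaRel (rels : List (Name × ℕ)) : ℕ → Type
  | rel (R : Name) (k : ℕ) (h : (R, k) ∈ rels) : SchemaRel rels k
  | lt : SchemaRel rels 2

/-- The first-order language of a schema. -/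
def schemaLang (Const : Type) (rels : List (Name × ℕ)) : FirstOrder.Language where
  Functions := SchemaFun Const
  Relations := SchemaRel rels

/-- A set of facts, as a first-order structure with domain `Const`. -/
@[reducible] def factStructure {Const : Type} [LinearOrder Const] (rels : List (Name × ℕ))
    (F : Set (Fact Const)) : (schemaLang Const rels).Structure Const where
  funMap := fun f _ => match f with
    | SchemaFun.const c => c
  RelMap := fun r => match r with
    | SchemaRel.rel R _ _ => fun v => (⟨R, List.ofFn v⟩ : Fact Const) ∈ F
    | SchemaRel.lt => fun v => v 0 < v 1

/-- A relational schema: finitely many relation names, each with one arity, and a set of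
first-order sentences, the integrity constraints. -/
structure Schema (Const : Type) where
  rels : List (Name × ℕ)
  nodup : (rels.map Prod.fst).Nodup
  constraints : Set (schemaLang Const rels).Sentence

/-- An instance of a schema: a finite set of facts over the schema that satisfies the integrity
constraints. -/
structure Instance {Const : Type} [LinearOrder Const] (S : Schema Const) where
  facts : Finset (Fact Const)
  wf : ∀ f ∈ facts, (f.rel, f.args.length) ∈ S.rels
  sat : ∀ φ ∈ S.constraints,
    @FirstOrder.Language.Sentence.Realize _ Const
      (factStructure S.rels (facts : Set (Fact Const))) φ

/-! ## DL-Lite with role inclusions -/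

/-- Basic role expressions `R ::= P ∣ P⁻`. -/
inductive BasicRole
  | atom (P : Name)
  | inv (P : Name)

/-- Basic concept expressions `B ::= A ∣ ∃R`. -/
inductive BasicConcept
  | atom (A : Name)
  | ex (R : BasicRole)

/-- Concept expressions `C ::= B ∣ ¬B`. -/
inductive ConceptExpr
  | pos (B : BasicConcept)
  | neg (B : BasicConcept)

/-- Role expressions `E ::= R ∣ ¬R`. -/
inductive RoleExpr
  | pos (R : BasicRole)
  | neg (R : BasicRole)

/-- TBox axioms `B ⊑ C` and `R ⊑ E`. -/
inductive TBoxAxiom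
  | concept (B : BasicConcept) (C : ConceptExpr)
  | role (R : BasicRole) (E : RoleExpr)

/-- A TBox is a finite set of axioms, given by a list. -/
abbrev TBox : Type := List TBoxAxiom

/-- The basic concept `B` of the expressions `B` and `¬B`. -/
def ConceptExpr.base : ConceptExpr → BasicConcept
  | .pos B => B
  | .neg B => B

/-- The basic concept expression `D` occurs in the axiom. -/
def TBoxAxiom.Mentions : TBoxAxiom → BasicConcept → Prop
  | .concept B C, D => D = B ∨ D = C.base
  | .role _ _, _ => False

/-- An interpretation gives every atomic concept a unary relation and every atomic role a binary
relation over `Const`. -/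
structure Interpretation (Const : Type) where
  concept : Name → Set Const
  role : Name → Set (Const × Const)

namespace Interpretation

variable {Const : Type} (J : Interpretation Const)

def basicRole : BasicRole → Set (Const × Const)
  | .atom P => J.role P
  | .inv P => {p | (p.2, p.1) ∈ J.role P}

def basicConcept : BasicConcept → Set Const
  | .atom A => J.concept A
  | .ex R => {x | ∃ y, (x, y) ∈ J.basicRole R}

def conceptExpr : ConceptExpr → Set Const
  | .pos B => J.basicConcept B
  | .neg B => (J.basicConcept B)ᶜ

def roleExpr : RoleExpr → Set (Const × Const)
  | .pos R => J.basicRole R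
  | .neg R => (J.basicRole R)ᶜ

def SatAxiom : TBoxAxiom → Prop
  | .concept B C => J.basicConcept B ⊆ J.conceptExpr C
  | .role R E => J.basicRole R ⊆ J.roleExpr E

def SatTBox (T : TBox) : Prop := ∀ α ∈ T, J.SatAxiom α

end Interpretation

/-- `T ⊨ C₁ ⊑ C₂`, for concept expressions. -/
def Subsumes (Const : Type) (T : TBox) (C₁ C₂ : ConceptExpr) : Prop :=
  ∀ J : Interpretation Const, J.SatTBox T → J.conceptExpr C₁ ⊆ J.conceptExpr C₂

/-! ## GAV mapping assertions and OBDA specifications -/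

inductive Term (Const : Type)
  | var (x : Name)
  | const (c : Const)

/-- The value of a term under an assignment of constants to variables. -/
def Term.eval {Const : Type} (v : Name → Const) : Term Const → Const
  | .var x => v x
  | .const c => c

/-- An atom `R(t₁, …, t_k)`, where each `t_i` is a variable or a constant. -/
structure Atom (Const : Type) where
  rel : Name
  args : List (Term Const)

/-- The head `A(x)` or `P(x, y)` of a mapping assertion, where `x`, `y` are variables. -/
inductive Head
  | concept (A x : Name)
  | role (P x y : Name)

def Head.vars : Head → List Name
  | .concept _ x => [x]
  | .role _ x y => [x, y]

def Head.Holds {Const : Type} (J : Interpretation Const) (v : Name → Const) : Head → Prop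
  | .concept A x => v x ∈ J.concept A
  | .role P x y => (v x, v y) ∈ J.role P

/-- A GAV mapping assertion `∀ x⃗ (φ₁, …, φ_n → ψ)`. -/
structure Mapping (Const : Type) where
  body : List (Atom Const)
  head : Head

/-- The body is over the schema, and the variables of the head occur in the body. -/
def Mapping.WF {Const : Type} (rels : List (Name × ℕ)) (m : Mapping Const) : Prop :=
  (∀ a ∈ m.body, (a.rel, a.args.length) ∈ rels) ∧
    ∀ x ∈ m.head.vars, ∃ a ∈ m.body, Term.var x ∈ a.args

/-- `(I, J)` satisfies the mapping assertion. -/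
def Mapping.Sat {Const : Type} (F : Set (Fact Const)) (J : Interpretation Const)
    (m : Mapping Const) : Prop :=
  ∀ v : Name → Const,
    (∀ a ∈ m.body, (⟨a.rel, a.args.map (Term.eval v)⟩ : Fact Const) ∈ F) → m.head.Holds J v

/-- An OBDA specification `(T, S, M)`, where the TBox `T` is in DL-Lite with role inclusions and
`M` is a finite set of GAV mapping assertions, given by a list. -/
structure Spec (Const : Type) where
  tbox : TBox
  schema : Schema Const
  mappings : List (Mapping Const)
  wf : ∀ m ∈ mappings, m.WF schema.rels

section Semantics

variable {Const : Type} [LinearOrder Const]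

/-- `J` is a solution for the instance `I` with respect to `B`. -/
def IsSolution (B : Spec Const) (I : Instance B.schema) (J : Interpretation Const) : Prop :=
  (∀ m ∈ B.mappings, m.Sat (I.facts : Set (Fact Const)) J) ∧ J.SatTBox B.tbox

/-- `certain(C, I, B)`: the intersection of the sets `J(C)` over all solutions `J`; this is the set
of all constants if there is no solution. -/
def certain (B : Spec Const) (C : BasicConcept) (I : Instance B.schema) : Set Const :=
  {c | ∀ J : Interpretation Const, IsSolution B I J → c ∈ J.basicConcept C}

/-- An `S`-ontology with concepts from the type `κ`: a set of concepts, a pre-order on it (the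
subsumption relation), and an extension for each concept in each instance of the schema. That the
extension can be decided in polynomial time is part of `Description.Describes` below. -/
structure Ontology (S : Schema Const) (κ : Type) where
  concepts : Set κ
  sub : concepts → concepts → Prop
  sub_refl : ∀ C, sub C C
  sub_trans : ∀ C D E, sub C D → sub D E → sub C E
  ext : concepts → Instance S → Set Const

/-- The ontology induced by an OBDA specification. -/
def inducedOntology (B : Spec Const) : Ontology B.schema BasicConcept where
  concepts := {C | ∃ α ∈ B.tbox, α.Mentions C}
  sub := fun C D => Subsumes Const B.tbox (.pos C.1) (.pos D.1)
  sub_refl := fun _ _ _ => subset_rfl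
  sub_trans := fun _ _ _ h₁ h₂ J hJ => (h₁ J hJ).trans (h₂ J hJ)
  ext := fun C I => certain B C.1 I

end Semantics

/-! ## Descriptions of Turing machines -/

/-- The alphabet of all encodings: two binary digits and two brackets. -/
inductive Sym
  | zero | one | lp | rp
  deriving DecidableEq

instance : Fintype Sym where
  elems := {.zero, .one, .lp, .rp}
  complete := fun x => by cases x <;> decide

def Sym.ofBool : Bool → Sym
  | false => .zero
  | true => .one

/-- A multi-stack Turing machine as a finite object: its stacks, labels and internal states are
numbered, and every stack has alphabet `Sym`. -/
structure MachineCode where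
  numStacks : ℕ
  numLabels : ℕ
  numStates : ℕ
  inStack : Fin numStacks
  outStack : Fin numStacks
  main : Fin numLabels
  init : Fin numStates
  prog : Fin numLabels →
    Turing.TM2.Stmt (fun _ : Fin numStacks => Sym) (Fin numLabels) (Fin numStates)

/-- The machine that a code describes, as one of Mathlib's Turing machines. -/
def MachineCode.toTM (M : MachineCode) : Turing.FinTM2 where
  K := Fin M.numStacks
  k₀ := M.inStack
  k₁ := M.outStack
  Γ := fun _ => Sym
  Λ := Fin M.numLabels
  main := M.main
  σ := Fin M.numStates
  initialState := M.init
  Γk₀Fin := inferInstanceAs (Fintype Sym)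
  m := M.prog

/-- Started with `input` on its input stack, the machine halts after at most `t` steps with `output`
on its output stack. -/
def MachineCode.OutputsWithin (M : MachineCode) (input output : List Sym) (t : ℕ) : Prop :=
  Nonempty (Turing.TM2OutputsInTime M.toTM input (some output) t)

/-! ## Encodings as words over `Sym` -/

def encWord (w : List Bool) : List Sym := Sym.lp :: w.map Sym.ofBool ++ [Sym.rp]

def encList {α : Type} (e : α → List Sym) (l : List α) : List Sym :=
  Sym.lp :: l.flatMap e ++ [Sym.rp]

/-- Numbers are written in binary. -/
def encNat (n : ℕ) : List Sym := encWord n.bits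

def encBasicRole : BasicRole → List Sym
  | .atom P => Sym.zero :: encWord P
  | .inv P => Sym.one :: encWord P

def encBasicConcept : BasicConcept → List Sym
  | .atom A => Sym.zero :: encWord A
  | .ex R => Sym.one :: encBasicRole R

def encConceptExpr : ConceptExpr → List Sym
  | .pos B => Sym.zero :: encBasicConcept B
  | .neg B => Sym.one :: encBasicConcept B

def encRoleExpr : RoleExpr → List Sym
  | .pos R => Sym.zero :: encBasicRole R
  | .neg R => Sym.one :: encBasicRole R

def encAxiom : TBoxAxiom → List Sym
  | .concept B C => Sym.zero :: encBasicConcept B ++ encConceptExpr C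
  | .role R E => Sym.one :: encBasicRole R ++ encRoleExpr E

def encHead : Head → List Sym
  | .concept A x => Sym.zero :: encWord A ++ encWord x
  | .role P x y => Sym.one :: encWord P ++ encWord x ++ encWord y

section Encodings

variable {Const : Type} (e : Const → List Bool)

def encTerm : Term Const → List Sym
  | .var x => Sym.zero :: encWord x
  | .const c => Sym.one :: encWord (e c)

def encAtom (a : Atom Const) : List Sym := encWord a.rel ++ encList (encTerm e) a.args

def encMapping (m : Mapping Const) : List Sym := encList (encAtom e) m.body ++ encHead m.head

def encFact (f : Fact Const) : List Sym :=
  encWord f.rel ++ encList (fun c => encWord (e c)) f.args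

/-- The encoding of a specification. The integrity constraints, which may be infinitely many, are
left out, so that an algorithm that works on this encoding does not see them. -/
def encSpec (B : Spec Const) : List Sym :=
  encList encAxiom B.tbox ++ encList (fun r => encWord r.1 ++ encNat r.2) B.schema.rels ++
    encList (encMapping e) B.mappings

/-- The encoding of the input `(C, I, c)` of a machine that decides `c ∈ ext(C, I)`, where the facts
of `I` are listed in `l`. -/
def encQuery (C : BasicConcept) (l : List (Fact Const)) (c : Const) : List Sym :=
  encBasicConcept C ++ encList (encFact e) l ++ encWord (e c)

end Encodings

/-- Programs are written with the functions on internal states as explicit tables. -/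
def encStmt {k l s : ℕ} :
    Turing.TM2.Stmt (fun _ : Fin k => Sym) (Fin l) (Fin s) → List Sym
  | .push i f q => [.zero, .zero, .zero] ++ encNat i ++ List.ofFn f ++ encStmt q
  | .peek i f q => [.zero, .zero, .one] ++ encNat i ++ encOptTable f ++ encStmt q
  | .pop i f q => [.zero, .one, .zero] ++ encNat i ++ encOptTable f ++ encStmt q
  | .load f q => [.zero, .one, .one] ++ (List.ofFn f).flatMap (fun j => encNat j) ++ encStmt q
  | .branch f q₁ q₂ =>
      [.one, .zero, .zero] ++ (List.ofFn f).map Sym.ofBool ++ encStmt q₁ ++ encStmt q₂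
  | .goto f => [.one, .zero, .one] ++ (List.ofFn f).flatMap (fun j => encNat j)
  | .halt => [.one, .one, .zero]
where
  /-- The table of a transition function that depends on the top symbol, if there is one. -/
  encOptTable {s : ℕ} (f : Fin s → Option Sym → Fin s) : List Sym :=
    (List.ofFn f).flatMap fun g =>
      [none, some Sym.zero, some Sym.one, some Sym.lp, some Sym.rp].flatMap fun o => encNat (g o)

def encMachine (M : MachineCode) : List Sym :=
  encNat M.numStacks ++ encNat M.numLabels ++ encNat M.numStates ++ encNat M.inStack ++
    encNat M.outStack ++ encNat M.main ++ encNat M.init ++ (List.ofFn M.prog).flatMap encStmt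

/-! ## Finite descriptions of ontologies -/

/-- A finite ontology as an explicit object: a list of its concepts, a list of the pairs of the
subsumption relation, and a Turing machine for the extensions. -/
structure Description where
  concepts : List BasicConcept
  sub : List (BasicConcept × BasicConcept)
  machine : MachineCode

def encDescription (D : Description) : List Sym :=
  encList encBasicConcept D.concepts ++
    encList (fun p => encBasicConcept p.1 ++ encBasicConcept p.2) D.sub ++ encMachine D.machine

/-- `D` describes the ontology `O`: its lists are those of the concepts and of the subsumptions of
`O`, and its machine, given a concept `C`, an instance `I` and a constant `c`, decides in time
polynomial in the length of this input whether `c ∈ ext(C, I)`. The answer is the digit `1` for yes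
and `0` for no. -/
def Description.Describes {Const : Type} [LinearOrder Const] (e : Const → List Bool)
    {S : Schema Const} (D : Description) (O : Ontology S BasicConcept) : Prop :=
  (∀ C, C ∈ D.concepts ↔ C ∈ O.concepts) ∧
  (∀ C C', (C, C') ∈ D.sub ↔
    ∃ (h : C ∈ O.concepts) (h' : C' ∈ O.concepts), O.sub ⟨C, h⟩ ⟨C', h'⟩) ∧
  ∃ p : Polynomial ℕ, ∀ (C : O.concepts) (I : Instance S) (c : Const) (l : List (Fact Const)),
    (∀ f, f ∈ l ↔ f ∈ I.facts) →
    ∃ b : Bool, (b = true ↔ c ∈ O.ext C I) ∧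
      D.machine.OutputsWithin (encQuery e C l c) [Sym.ofBool b]
        (p.eval (encQuery e C l c).length)

end OBDA

namespace OBDA

open Turing Function

/-! ## A structured language of stack programs -/

/-! The logical core is that reasoning in this description logic is reachability in a graph. The
TBox is split into positive inclusions, closed under inverse roles, and disjointness statements
(`Interpretation.satTBox_iff`). A finite set of assertions that is consistent with the TBox has a
canonical model. A named constant lies in exactly those basic concepts that are reachable from its
asserted ones, and every element of `∃R` gets an anonymous `R`-successor. One witness `w (R, i)` per
role and level is enough, and since `Const` is infinite the witnesses can be fresh constants. The
successor lies one level above its source, so two elements are never witnesses of each other. Thus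
an edge to a witness stems from a single basic role.

Disjointness can then fail only because of an asserted concept that is unsatisfiable, two
conflicting concepts asserted of one constant, or two conflicting roles asserted of one pair
(`Assertions.canonical_satTBox`). Hence the entailed concept assertions are the reachable ones, or
all of them in case of inconsistency (`Assertions.entailed_iff`). For the single assertion `B(a)`
this yields subsumption: `D` is reachable from `B`, or `B` is unsatisfiable (`subsumes_iff`).

GAV mappings turn an instance into a finite set of assertions, found by trying all assignments of
constants of the instance to the body variables (`sat_iff_derived`). So membership in an extension
becomes a finite criterion on the facts alone (`mem_certain_iff`), in which the integrity
constraints play no role. The number of variables is only an exponent in the number of assignments,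
so for a fixed specification the list is polynomial (`sz_assignments`).

For the complexity bounds, structured stack programs are compiled to Mathlib's `TM2` machines
(`Exec.steps`), and the class `PT` of polynomial-time functions is shown to be closed under
composition, pairing, case distinction, size-bounded folds and reachability. A single program
answers the queries of all specifications (`exists_answering_program`). The machine for `B` writes
the encoding of `B` in front of its input and runs that program. Its description is a
letter-by-letter translation of the encoding of `B` between two fixed words (`exists_encMachine`),
which is easily printed in polynomial time. -/

/-- The contents of the stacks, which are numbered. -/
abbrev Store : Type := ℕ → List Sym

/-- Structured programs that work on stacks. -/
inductive Cmd
  | skip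
  | push (k : ℕ) (a : Sym)
  | pop (k : ℕ)
  | seq (c d : Cmd)
  | ite (k : ℕ) (p : Option Sym → Bool) (c d : Cmd)
  | while (k : ℕ) (p : Option Sym → Bool) (c : Cmd)

/-- `Exec c s s' t`: started in the store `s`, the program `c` ends in the store `s'` after `t`
steps. -/
inductive Exec : Cmd → Store → Store → ℕ → Prop
  | skip (s) : Exec .skip s s 1
  | push (s k a) : Exec (.push k a) s (update s k (a :: s k)) 1
  | pop (s k) : Exec (.pop k) s (update s k (s k).tail) 1
  | seq {c d s s₁ s₂ t₁ t₂} : Exec c s s₁ t₁ → Exec d s₁ s₂ t₂ → Exec (.seq c d) s s₂ (t₁ + t₂)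
  | ite_true {k p c d s s' t} : p (s k).head? = true → Exec c s s' t →
      Exec (.ite k p c d) s s' (1 + t)
  | ite_false {k p c d s s' t} : p (s k).head? = false → Exec d s s' t →
      Exec (.ite k p c d) s s' (1 + t)
  | while_true {k p c s s₁ s₂ t₁ t₂} : p (s k).head? = true → Exec c s s₁ t₁ →
      Exec (.while k p c) s₁ s₂ t₂ → Exec (.while k p c) s s₂ (1 + (t₁ + t₂))
  | while_false {k p c s} : p (s k).head? = false → Exec (.while k p c) s s 1

namespace Cmd

/-- The number of instructions of the compiled program. -/
def size : Cmd → ℕ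
  | skip => 1
  | push _ _ => 1
  | pop _ => 1
  | seq c d => c.size + d.size
  | ite _ _ c d => 1 + (c.size + d.size)
  | .while _ _ c => 1 + c.size

/-- A bound on the stacks that the program uses. -/
def width : Cmd → ℕ
  | skip => 0
  | push k _ => k
  | pop k => k
  | seq c d => max c.width d.width
  | ite k _ c d => max k (max c.width d.width)
  | .while k _ c => max k c.width

/-- Statements of the compiled programs. -/
abbrev Code (k l : ℕ) : Type := TM2.Stmt (fun _ : Fin (k + 1) => Sym) (Fin (l + 1)) (Fin 2)

/-- The statement that jumps to one of two addresses, depending on the top of a stack. -/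
def test (k l : ℕ) (i : ℕ) (p : Option Sym → Bool) (a b : ℕ) : Code k l :=
  .peek (Fin.ofNat (k + 1) i) (fun _ o => if p o then 1 else 0)
    (.goto fun v => if v = 1 then Fin.ofNat (l + 1) a else Fin.ofNat (l + 1) b)

/-- The compiled program, to be placed at address `a`; it ends with a jump to address `e`. -/
def compile (k l : ℕ) : Cmd → ℕ → ℕ → List (Code k l)
  | skip, _, e => [.goto fun _ => Fin.ofNat (l + 1) e]
  | push i x, _, e => [.push (Fin.ofNat (k + 1) i) (fun _ => x) (.goto fun _ => Fin.ofNat (l + 1) e)]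
  | pop i, _, e => [.pop (Fin.ofNat (k + 1) i) (fun v _ => v) (.goto fun _ => Fin.ofNat (l + 1) e)]
  | seq c d, a, e => c.compile k l a (a + c.size) ++ d.compile k l (a + c.size) e
  | ite i p c d, a, e => test k l i p (a + 1) (a + 1 + c.size) ::
      (c.compile k l (a + 1) e ++ d.compile k l (a + 1 + c.size) e)
  | .while i p c, a, e => test k l i p (a + 1) e :: c.compile k l (a + 1) a

theorem length_compile (k l : ℕ) (c : Cmd) (a e : ℕ) : (c.compile k l a e).length = c.size := by
  induction c generalizing a e <;> simp [compile, size, *] <;> omega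

end Cmd

/-! ### Simulation of structured programs by compiled code -/

/-- The machine gets from one configuration to another in exactly `t` steps. -/
def Steps {k l : ℕ} (M : Fin (l + 1) → Cmd.Code k l) (t : ℕ)
    (c d : TM2.Cfg (fun _ : Fin (k + 1) => Sym) (Fin (l + 1)) (Fin 2)) : Prop :=
  (flip bind (TM2.step M))^[t] (some c) = some d

section Simulation

variable {k l : ℕ} {M : Fin (l + 1) → Cmd.Code k l}

theorem Steps.trans {t u : ℕ} {c d e} (h : Steps M t c d) (h' : Steps M u d e) :
    Steps M (t + u) c e := by
  unfold Steps at *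
  rw [add_comm t u, iterate_add_apply, h, h']

theorem Steps.one {c d} (h : TM2.step M c = some d) : Steps M 1 c d := by
  simpa [Steps, flip] using h

/-- The instructions `is` stand in the program from address `a` on. -/
def CodeAt (M : Fin (l + 1) → Cmd.Code k l) : ℕ → List (Cmd.Code k l) → Prop
  | _, [] => True
  | a, i :: is => M (Fin.ofNat (l + 1) a) = i ∧ CodeAt M (a + 1) is

theorem codeAt_append {a : ℕ} {is js : List (Cmd.Code k l)} :
    CodeAt M a (is ++ js) ↔ CodeAt M a is ∧ CodeAt M (a + is.length) js := by
  induction is generalizing a with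
  | nil => simp [CodeAt]
  | cons i is ih => simp [CodeAt, ih, and_assoc, add_assoc, add_comm 1]

theorem codeAt_of_getElem {a : ℕ} {is : List (Cmd.Code k l)}
    (h : ∀ i (hi : i < is.length), M (Fin.ofNat (l + 1) (a + i)) = is[i]) : CodeAt M a is := by
  induction is generalizing a with
  | nil => trivial
  | cons j is ih =>
    refine ⟨h 0 (by simp), ih fun i hi => ?_⟩
    have := h (i + 1) (by simpa using hi)
    simpa [add_assoc, add_comm 1] using this

/-- The stacks of the machine that belong to a store. -/
def stackOf (k : ℕ) (s : Store) : Fin (k + 1) → List Sym := fun i => s i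

/-- Stack numbers are reduced modulo `k + 1`; the bound `i ≤ k` keeps an out-of-range number from
hitting another stack. -/
theorem stackOf_update {s : Store} {i : ℕ} (hi : i ≤ k) (w : List Sym) :
    update (stackOf k s) (Fin.ofNat (k + 1) i) w = stackOf k (update s i w) := by
  funext j
  have : j = Fin.ofNat (k + 1) i ↔ (j : ℕ) = i := by
    simp [Fin.ext_iff, Nat.mod_eq_of_lt (Nat.lt_succ_of_le hi)]
  simp only [stackOf, update_apply, this]

theorem stackOf_apply {s : Store} {i : ℕ} (hi : i ≤ k) :
    stackOf k s (Fin.ofNat (k + 1) i) = s i := by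
  simp [stackOf, Nat.mod_eq_of_lt (Nat.lt_succ_of_le hi)]

theorem steps_test {a i : ℕ} {p : Option Sym → Bool} {x y : ℕ} (hi : i ≤ k)
    (h : M (Fin.ofNat (l + 1) a) = Cmd.test k l i p x y) (s : Store) (v : Fin 2) :
    ∃ v', Steps M 1 ⟨some (Fin.ofNat (l + 1) a), v, stackOf k s⟩
      ⟨some (Fin.ofNat (l + 1) (if p (s i).head? then x else y)), v', stackOf k s⟩ := by
  refine ⟨if p (s i).head? then 1 else 0, Steps.one ?_⟩
  rw [TM2.step, h, Cmd.test, TM2.stepAux, TM2.stepAux, stackOf_apply hi]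
  cases p (s i).head? <;> simp

/-- Induction on the execution, not on the program, so that a loop has a hypothesis for its
remaining rounds. The step count is exact: every rule of `Exec` charges one step per executed label.
The state is arbitrary before and existential after, as it only carries the outcome of a test to the
next jump. -/
theorem Exec.steps {c : Cmd} {s s' : Store} {t : ℕ} (h : Exec c s s' t) :
    ∀ a e, c.width ≤ k → CodeAt M a (c.compile k l a e) → ∀ v, ∃ v',
      Steps M t ⟨some (Fin.ofNat (l + 1) a), v, stackOf k s⟩
        ⟨some (Fin.ofNat (l + 1) e), v', stackOf k s'⟩ := by
  induction h with
  | skip s =>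
    intro a e _ hc v
    refine ⟨v, Steps.one ?_⟩
    rw [TM2.step, hc.1, TM2.stepAux]
  | push s i x =>
    intro a e (hk : i ≤ k) hc v
    refine ⟨v, Steps.one ?_⟩
    rw [TM2.step, hc.1, TM2.stepAux, TM2.stepAux, stackOf_apply hk, stackOf_update hk]
  | pop s i =>
    intro a e (hk : i ≤ k) hc v
    refine ⟨v, Steps.one ?_⟩
    rw [TM2.step, hc.1, TM2.stepAux, TM2.stepAux, stackOf_apply hk, stackOf_update hk]
  | seq _ _ ih₁ ih₂ =>
    intro a e hk hc v
    simp only [Cmd.width, max_le_iff] at hk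
    rw [Cmd.compile, codeAt_append, Cmd.length_compile] at hc
    obtain ⟨v₁, h₁⟩ := ih₁ _ _ hk.1 hc.1 v
    obtain ⟨v₂, h₂⟩ := ih₂ _ _ hk.2 hc.2 v₁
    exact ⟨v₂, h₁.trans h₂⟩
  | ite_true hp _ ih =>
    intro a e hk hc v
    simp only [Cmd.width, max_le_iff] at hk
    rw [Cmd.compile, CodeAt, codeAt_append, Cmd.length_compile] at hc
    obtain ⟨v₁, h₁⟩ := steps_test hk.1 hc.1 _ v
    rw [hp, if_pos rfl] at h₁
    obtain ⟨v₂, h₂⟩ := ih _ _ hk.2.1 hc.2.1 v₁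
    exact ⟨v₂, h₁.trans h₂⟩
  | ite_false hp _ ih =>
    intro a e hk hc v
    simp only [Cmd.width, max_le_iff] at hk
    rw [Cmd.compile, CodeAt, codeAt_append, Cmd.length_compile] at hc
    obtain ⟨v₁, h₁⟩ := steps_test hk.1 hc.1 _ v
    rw [hp, if_neg (by simp)] at h₁
    obtain ⟨v₂, h₂⟩ := ih _ _ hk.2.2 hc.2.2 v₁
    exact ⟨v₂, h₁.trans h₂⟩
  | while_true hp _ _ ih₁ ih₂ =>
    intro a e hk hc v
    have hk' := hk
    have hc' := hc
    simp only [Cmd.width, max_le_iff] at hk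
    rw [Cmd.compile, CodeAt] at hc
    obtain ⟨v₁, h₁⟩ := steps_test hk.1 hc.1 _ v
    rw [hp, if_pos rfl] at h₁
    obtain ⟨v₂, h₂⟩ := ih₁ _ _ hk.2 hc.2 v₁
    obtain ⟨v₃, h₃⟩ := ih₂ _ _ hk' hc' v₂
    exact ⟨v₃, h₁.trans (h₂.trans h₃)⟩
  | while_false hp =>
    intro a e hk hc v
    simp only [Cmd.width, max_le_iff] at hk
    rw [Cmd.compile, CodeAt] at hc
    obtain ⟨v₁, h₁⟩ := steps_test hk.1 hc.1 _ v
    rw [hp, if_neg (by simp)] at h₁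
    exact ⟨v₁, h₁⟩

end Simulation

/-! ## Machine codes of stack programs -/

/-- The statement that pushes a word, so that its first letter comes on top, and jumps to label 1. -/
def pushWord (k l : ℕ) (w : List Sym) : Cmd.Code k l :=
  w.foldl (fun q a => .push 0 (fun _ => a) q) (.goto fun _ => Fin.ofNat (l + 1) 1)

/-- A chain of pushes inside one statement costs a single machine step, whatever the length of the
word. This is how a specification is hard-wired into its machine at constant cost in time. -/
theorem stepAux_pushWord (k l : ℕ) (w : List Sym) (v : Fin 2) (s : Store) :
    TM2.stepAux (pushWord k l w) v (stackOf k s) =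
      ⟨some (Fin.ofNat (l + 1) 1), v, stackOf k (update s 0 (w ++ s 0))⟩ := by
  -- The fold wraps the statement from the inside outwards, so the induction needs an arbitrary
  -- continuation `q`.
  suffices H : ∀ (w : List Sym) (q : Cmd.Code k l) (s : Store),
      TM2.stepAux (w.foldl (fun q a => .push 0 (fun _ => a) q) q) v (stackOf k s) =
        TM2.stepAux q v (stackOf k (update s 0 (w ++ s 0))) by
    rw [pushWord, H, TM2.stepAux]
  intro w
  induction w with
  | nil => intro q s; simp
  | cons a w ih =>
    intro q s
    rw [List.foldl_cons, ih, TM2.stepAux]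
    have h0 : (0 : Fin (k + 1)) = Fin.ofNat (k + 1) 0 := by simp
    rw [h0, stackOf_apply (Nat.zero_le _), stackOf_update (Nat.zero_le _)]
    simp

/-- The program of `machine`. -/
def machineProg (w : List Sym) (c : Cmd) (i : Fin (c.size + 1 + 1)) :
    Cmd.Code c.width (c.size + 1) :=
  (pushWord c.width (c.size + 1) w ::
    (c.compile c.width (c.size + 1) 1 (c.size + 1) ++ [.load (fun _ => 0) .halt])).get
    (i.cast (by simp [Cmd.length_compile]))

/-- The machine that puts the word `w` in front of its input and then runs `c`. -/
def machine (w : List Sym) (c : Cmd) : MachineCode where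
  numStacks := c.width + 1
  numLabels := c.size + 1 + 1
  numStates := 2
  inStack := 0
  outStack := 0
  main := 0
  init := 0
  prog := machineProg w c

/-- The store with a word on stack 0, all other stacks being empty. -/
def single (x : List Sym) : Store := update (fun _ => []) 0 x

/-- Two steps are added to the run of `c`: label 0 pushes `w`, and the last label resets the state
to 0 and halts. The reset is needed because a halting configuration must be in the initial state,
with all stacks but the output empty. -/
theorem machine_outputsWithin {w x y : List Sym} {c : Cmd} {t u : ℕ}
    (h : Exec c (single (w ++ x)) (single y) t) (hu : t + 2 ≤ u) :
    (machine w c).OutputsWithin x y u := by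
  have hmid : CodeAt (machineProg w c) 1 (c.compile c.width (c.size + 1) 1 (c.size + 1)) := by
    refine codeAt_of_getElem fun i hi => ?_
    have hi' := hi
    rw [Cmd.length_compile] at hi'
    have : (1 + i) % (c.size + 1 + 1) = i + 1 := by rw [Nat.mod_eq_of_lt] <;> omega
    simp only [machineProg, List.get_eq_getElem, Fin.val_cast, Fin.val_ofNat, this]
    rw [List.getElem_cons_succ, List.getElem_append_left hi]
  have hst : ∀ x, stackOf c.width (single x) = fun i => if i = 0 then x else [] := by
    intro x
    funext i
    simp [stackOf, single, update_apply]
  obtain ⟨v, hv⟩ := h.steps 1 (c.size + 1) le_rfl hmid 0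
  have h1 : Steps (machineProg w c) 1 ⟨some 0, 0, stackOf c.width (single x)⟩
      ⟨some (Fin.ofNat _ 1), 0, stackOf c.width (single (w ++ x))⟩ := by
    refine Steps.one ?_
    have : machineProg w c 0 = pushWord c.width (c.size + 1) w := rfl
    rw [TM2.step, this, stepAux_pushWord]
    simp [single]
  have h2 : Steps (machineProg w c) 1
      ⟨some (Fin.ofNat _ (c.size + 1)), v, stackOf c.width (single y)⟩
      ⟨none, 0, stackOf c.width (single y)⟩ := by
    refine Steps.one ?_
    have : machineProg w c (Fin.ofNat _ (c.size + 1)) = .load (fun _ => 0) .halt := by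
      have : (c.size + 1) % (c.size + 1 + 1) = c.size + 1 := Nat.mod_eq_of_lt (by omega)
      simp only [machineProg, List.get_eq_getElem, Fin.val_cast, Fin.val_ofNat, this]
      rw [List.getElem_cons_succ, List.getElem_append_right (by simp [Cmd.length_compile])]
      simp [Cmd.length_compile]
    rw [TM2.step, this, TM2.stepAux, TM2.stepAux]
  have h3 := (h1.trans hv).trans h2
  refine ⟨⟨⟨1 + t + 1, ?_⟩, by simpa using by omega⟩⟩
  have hi : initList (machine w c).toTM x =
      ⟨some (machine w c).main, (machine w c).init, stackOf c.width (single x)⟩ := by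
    rw [hst]; rfl
  have ho : haltList (machine w c).toTM y =
      ⟨none, (machine w c).init, stackOf c.width (single y)⟩ := by
    rw [hst]; rfl
  exact (congrArg (fun d => (flip bind (machine w c).toTM.step)^[1 + t + 1] (some d)) hi).trans
    (Eq.trans h3 (congrArg some ho).symm)

end OBDA

namespace OBDA

open Function

/-! ## Building blocks of stack programs -/

/-- The program leads from one store to another in at most `T` steps. -/
def Runs (c : Cmd) (s s' : Store) (T : ℕ) : Prop := ∃ t ≤ T, Exec c s s' t

theorem Runs.mono {c s s' T U} (h : Runs c s s' T) (hT : T ≤ U) : Runs c s s' U :=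
  let ⟨t, ht, h⟩ := h
  ⟨t, ht.trans hT, h⟩

theorem Runs.seq {c d s s₁ s₂ T U} (h : Runs c s s₁ T) (h' : Runs d s₁ s₂ U) :
    Runs (.seq c d) s s₂ (T + U) :=
  let ⟨t, ht, h⟩ := h
  let ⟨u, hu, h'⟩ := h'
  ⟨t + u, by omega, .seq h h'⟩

theorem Runs.congr {c s s' s'' T U} (h : Runs c s s' T) (hs : s' = s'') (hT : T ≤ U) :
    Runs c s s'' U :=
  hs ▸ h.mono hT

theorem Runs.skip (s) : Runs .skip s s 1 := ⟨1, le_rfl, .skip s⟩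

theorem Runs.push (s k a) : Runs (.push k a) s (update s k (a :: s k)) 1 := ⟨1, le_rfl, .push s k a⟩

theorem Runs.pop (s k) : Runs (.pop k) s (update s k (s k).tail) 1 := ⟨1, le_rfl, .pop s k⟩

theorem Runs.ite_true {k p c d s s' T} (hp : p (s k).head? = true) (h : Runs c s s' T) :
    Runs (.ite k p c d) s s' (1 + T) :=
  let ⟨t, ht, h⟩ := h
  ⟨1 + t, by omega, .ite_true hp h⟩

theorem Runs.ite_false {k p c d s s' T} (hp : p (s k).head? = false) (h : Runs d s s' T) :
    Runs (.ite k p c d) s s' (1 + T) :=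
  let ⟨t, ht, h⟩ := h
  ⟨1 + t, by omega, .ite_false hp h⟩

theorem Runs.while_true {k p c s s₁ s₂ T U} (hp : p (s k).head? = true) (h : Runs c s s₁ T)
    (h' : Runs (.while k p c) s₁ s₂ U) : Runs (.while k p c) s s₂ (1 + (T + U)) :=
  let ⟨t, ht, h⟩ := h
  let ⟨u, hu, h'⟩ := h'
  ⟨1 + (t + u), by omega, .while_true hp h h'⟩

theorem Runs.while_false {k p c s} (hp : p (s k).head? = false) : Runs (.while k p c) s s 1 :=
  ⟨1, le_rfl, .while_false hp⟩

/-- A step lengthens the stacks by at most one symbol. -/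
theorem Exec.length_le {c s s' t} (h : Exec c s s' t) (k : ℕ) :
    (s' k).length ≤ (s k).length + t := by
  induction h with
  | skip => omega
  | push s i a => simp only [update_apply]; split_ifs with h <;> simp [h]
  | pop s i => simp only [update_apply]; split_ifs with h <;> simp [h]; omega
  | while_false => omega
  | _ => omega

theorem Runs.length_le {c s s' T} (h : Runs c s s' T) (k : ℕ) :
    (s' k).length ≤ (s k).length + T :=
  let ⟨_, ht, h⟩ := h
  (h.length_le k).trans (by omega)

namespace Cmd

/-- Branch on the symbol on top of stack `i`. -/
def sel (i : ℕ) (f : Sym → Cmd) : Cmd :=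
  .ite i (· = some .zero) (f .zero) <| .ite i (· = some .one) (f .one) <|
    .ite i (· = some .lp) (f .lp) (f .rp)

/-- At most three tests are made. The bracket `rp` is the default branch, which an empty stack would
also take; hence the stack is required to be nonempty. -/
theorem runs_sel {i : ℕ} {f : Sym → Cmd} {s s' : Store} {T : ℕ} {a : Sym} {w : List Sym}
    (hi : s i = a :: w) (h : Runs (f a) s s' T) : Runs (sel i f) s s' (3 + T) := by
  unfold sel
  cases a
  · exact (Runs.ite_true (by simp [hi]) h).mono (by omega)
  · exact (Runs.ite_false (by simp [hi]) (Runs.ite_true (by simp [hi]) h)).mono (by omega)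
  · exact (Runs.ite_false (by simp [hi]) (Runs.ite_false (by simp [hi])
      (Runs.ite_true (by simp [hi]) h))).mono (by omega)
  · exact (Runs.ite_false (by simp [hi]) (Runs.ite_false (by simp [hi])
      (Runs.ite_false (by simp [hi]) h))).mono (by omega)

/-- Move the top symbol of stack `i` to stack `j`. -/
def xfer (i j : ℕ) : Cmd := sel i fun a => .seq (.pop i) (.push j a)

theorem runs_xfer {i j : ℕ} (hij : i ≠ j) {s : Store} {a : Sym} {w : List Sym}
    (hi : s i = a :: w) : Runs (xfer i j) s (update (update s i w) j (a :: s j)) 5 := by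
  have : Runs (.seq (.pop i) (.push j a)) s (update (update s i w) j (a :: s j)) 2 :=
    ((Runs.pop s i).seq (Runs.push _ j a)).congr (by simp [hi, update_of_ne hij.symm]) le_rfl
  exact runs_sel (f := fun a => .seq (.pop i) (.push j a)) hi this

/-- Move stack `i` to stack `j`, which reverses it. -/
def mv (i j : ℕ) : Cmd := .while i Option.isSome (xfer i j)

theorem runs_mv {i j : ℕ} (hij : i ≠ j) (s : Store) :
    Runs (mv i j) s (update (update s i []) j ((s i).reverse ++ s j)) (6 * (s i).length + 1) := by
  generalize hw : s i = w
  induction w generalizing s with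
  | nil =>
    refine (Runs.while_false (by simp [hw])).congr ?_ (by omega)
    rw [← hw, update_eq_self]
    simp [hw]
  | cons a w ih =>
    have := ih (update (update s i w) j (a :: s j)) (by simp [update_of_ne hij])
    refine ((runs_xfer hij hw).while_true (by simp [hw]) this).congr ?_ (by simp; omega)
    funext k
    simp only [update_apply]
    split_ifs <;> simp_all

/-- Empty stack `i`. -/
def clear (i : ℕ) : Cmd := .while i Option.isSome (.pop i)

theorem runs_clear (i : ℕ) (s : Store) :
    Runs (clear i) s (update s i []) (2 * (s i).length + 1) := by
  generalize hw : s i = w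
  induction w generalizing s with
  | nil =>
    refine (Runs.while_false (by simp [hw])).congr ?_ (by omega)
    rw [← hw, update_eq_self]
  | cons a w ih =>
    have : Runs (clear i) _ _ _ := ih (update s i w) (by simp)
    refine (Runs.while_true (by simp [hw]) (Runs.pop s i) (by rwa [hw])).congr ?_
      (by simp; omega)
    simp

/-- Move stack `i` on top of stack `j` by means of the empty stack `t`. -/
def move (i j t : ℕ) : Cmd := .seq (mv i t) (mv t j)

theorem runs_move {i j t : ℕ} (hij : i ≠ j) (hit : i ≠ t) (hjt : j ≠ t) {s : Store}
    (ht : s t = []) :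
    Runs (move i j t) s (update (update s i []) j (s i ++ s j)) (12 * (s i).length + 2) := by
  refine ((runs_mv hit s).seq (runs_mv hjt.symm _)).congr ?_ (by simp [ht]; omega)
  funext k
  simp only [update_apply]
  split_ifs <;> simp_all

/-- Move stack `t` to both of the stacks `i` and `j`, which reverses it. -/
def spread (t i j : ℕ) : Cmd :=
  .while t Option.isSome (.seq (sel t fun a => .push j a) (xfer t i))

theorem runs_spread {i j t : ℕ} (hij : i ≠ j) (hit : i ≠ t) (hjt : j ≠ t) (s : Store) :
    Runs (spread t i j) s
      (update (update (update s t []) i ((s t).reverse ++ s i)) j ((s t).reverse ++ s j))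
      (10 * (s t).length + 1) := by
  generalize hw : s t = w
  induction w generalizing s with
  | nil =>
    refine (Runs.while_false (by simp [hw])).congr ?_ (by omega)
    funext k
    simp only [update_apply]
    split_ifs <;> simp_all
  | cons a w ih =>
    have h1 : Runs (sel t fun a => .push j a) s _ _ := runs_sel hw (Runs.push s j a)
    have h2 := runs_xfer hit.symm (s := update s j (a :: s j)) (a := a) (w := w)
      (by simp [update_of_ne hjt.symm, hw])
    refine (Runs.while_true (by simp [hw]) (h1.seq h2) (ih _ ?_)).congr ?_ (by simp; omega)
    · simp [update_of_ne hit.symm]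
    · funext k
      simp only [update_apply]
      split_ifs <;> simp_all

/-- Copy stack `i` on top of stack `j` by means of the empty stack `t`. -/
def copy (i j t : ℕ) : Cmd := .seq (mv i t) (spread t i j)

theorem runs_copy {i j t : ℕ} (hij : i ≠ j) (hit : i ≠ t) (hjt : j ≠ t) {s : Store}
    (ht : s t = []) :
    Runs (copy i j t) s (update s j (s i ++ s j)) (16 * (s i).length + 2) := by
  refine ((runs_mv hit s).seq (runs_spread hij hit hjt _)).congr ?_ (by simp [ht]; omega)
  funext k
  simp only [update_apply]
  split_ifs <;> simp_all

/-- Push the word `w` on stack `i`, so that its first letter comes on top. -/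
def pushes (i : ℕ) : List Sym → Cmd
  | [] => .skip
  | a :: w => .seq (pushes i w) (.push i a)

theorem runs_pushes (i : ℕ) (w : List Sym) (s : Store) :
    Runs (pushes i w) s (update s i (w ++ s i)) (w.length + 1) := by
  induction w with
  | nil => exact (Runs.skip s).congr (by simp) (by simp)
  | cons a w ih => exact (ih.seq (Runs.push _ i a)).congr (by simp) (by simp)

/-- Compare stacks `i` and `j`, putting marks on stack `m` where they differ; stack `i` is emptied,
and what is left of stack `j` is also a sign of a difference. -/
def compare (i j m : ℕ) : Cmd :=
  .while i Option.isSome <| sel i fun a =>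
    .seq (.pop i) (.ite j (· = some a) (.pop j) (.push m .one))

/-- Only the emptiness of the two remainders decides equality, so their contents stay existential;
the length bounds pay for clearing them later. -/
theorem runs_compare {i j m : ℕ} (hij : i ≠ j) (him : i ≠ m) (hjm : j ≠ m) (s : Store) :
    ∃ v n, ((n = [] ∧ v = []) ↔ (s m = [] ∧ s i = s j)) ∧ v.length ≤ (s j).length ∧
      n.length ≤ (s m).length + (s i).length ∧
      Runs (compare i j m) s (update (update (update s i []) j v) m n) (7 * (s i).length + 1) := by
  generalize hw : s i = w
  induction w generalizing s with
  | nil =>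
    refine ⟨s j, s m, by simp [eq_comm], le_rfl, by simp, ?_⟩
    refine (Runs.while_false (by simp [hw])).congr ?_ (by omega)
    funext k
    simp only [update_apply]
    split_ifs <;> simp_all
  | cons a w ih =>
    by_cases h : (s j).head? = some a
    · obtain ⟨v', hv⟩ : ∃ v', s j = a :: v' := by
        cases hj : s j <;> simp_all
      obtain ⟨v, n, h1, h2, h3, h4⟩ := ih (update (update s i w) j v') (by simp [update_of_ne hij])
      refine ⟨v, n, ?_, ?_, ?_, ?_⟩
      · rw [h1, hv]; simp [update_of_ne him.symm, update_of_ne hjm.symm]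
      · simp at h2; simp [hv]; omega
      · simp [update_of_ne him.symm, update_of_ne hjm.symm] at h3; simp; omega
      · have : Runs (.seq (.pop i) (.ite j (· = some a) (.pop j) (.push m .one))) s
            (update (update s i w) j v') 3 :=
          ((Runs.pop s i).seq (Runs.ite_true (by simp [update_of_ne hij.symm, hv])
            (Runs.pop _ _))).congr (by simp [hw, update_of_ne hij.symm, hv]) (by simp)
        refine (Runs.while_true (by simp [hw]) (runs_sel hw this) h4).congr ?_ (by simp; omega)
        funext k
        simp only [update_apply]
        split_ifs <;> simp_all
    -- On a mismatch stack `j` is left alone and a mark is put on `m`. The mark is never removed, so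
    -- both sides of the equivalence are false.
    · obtain ⟨v, n, h1, h2, h3, h4⟩ := ih (update (update s i w) m (.one :: s m))
        (by simp [update_of_ne him])
      refine ⟨v, n, ?_, ?_, ?_, ?_⟩
      · rw [h1]
        have : a :: w ≠ s j := by rintro h'; simp [← h'] at h
        simp [this]
      · simpa [update_of_ne hij.symm, update_of_ne hjm] using h2
      · simp at h3; simp; omega
      · have : Runs (.seq (.pop i) (.ite j (· = some a) (.pop j) (.push m .one))) s
            (update (update s i w) m (.one :: s m)) 3 :=
          ((Runs.pop s i).seq (Runs.ite_false (by simp [update_of_ne hij.symm, h])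
            (Runs.push _ _ _))).congr (by simp [hw, update_of_ne him.symm]) (by simp)
        refine (Runs.while_true (by simp [hw]) (runs_sel hw this) h4).congr ?_ (by simp; omega)
        funext k
        simp only [update_apply]
        split_ifs <;> simp_all

/-- Move the rest of a bracketed word from stack `i` to stack `j`, where stack `t` holds the number
of open brackets in unary. -/
def closing (i j t : ℕ) : Cmd :=
  .while t Option.isSome <| .seq
    (sel i fun a => match a with
      | .lp => .push t .one
      | .rp => .pop t
      | _ => .skip)
    (xfer i j)

end Cmd

/-! ### Matching brackets -/

/-- The word closes all of `d` open brackets, but not before its end. -/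
def Closes : ℕ → List Sym → Prop
  | d, [] => d = 0
  | 0, _ :: _ => False
  | d + 1, .lp :: w => Closes (d + 2) w
  | d + 1, .rp :: w => Closes d w
  | d + 1, .zero :: w => Closes (d + 1) w
  | d + 1, .one :: w => Closes (d + 1) w

/-- The unary counter on stack `t` always equals the depth in `Closes`. It becomes empty exactly at
the end of `w`, so the loop stops there and leaves `u` untouched. -/
theorem Cmd.runs_closing {i j t : ℕ} (hij : i ≠ j) (hit : i ≠ t) (hjt : j ≠ t) {d : ℕ}
    {w u : List Sym} (h : Closes d w) (s : Store) (ht : s t = List.replicate d .one)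
    (hi : s i = w ++ u) :
    Runs (closing i j t) s (update (update (update s i u) t []) j (w.reverse ++ s j))
      (10 * w.length + 1) := by
  induction w generalizing d s with
  | nil =>
    obtain rfl : d = 0 := by simpa [Closes] using h
    refine (Runs.while_false (by simp [ht])).congr ?_ (by omega)
    funext k
    simp only [update_apply]
    split_ifs <;> simp_all
  | cons a w ih =>
    obtain _ | d := d
    · simp [Closes] at h
    -- One round of the loop, with the new depth `d'` as a parameter: the counter is adjusted while
    -- the symbol is still on stack `i`, then the symbol is moved.
    have key : ∀ d' (c : Sym → Cmd) , Closes d' w →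
        Runs (c a) s (update s t (List.replicate d' .one)) 1 →
        Runs (.seq (sel i c) (xfer i j)) s
          (update (update (update s i (w ++ u)) t (List.replicate d' .one)) j (a :: s j)) 9 := by
      intro d' c _ hr
      refine ((runs_sel hi hr).seq (runs_xfer hij (a := a) (w := w ++ u) ?_)).congr ?_ le_rfl
      · simp [update_of_ne hit, hi]
      · funext k
        simp only [update_apply]
        split_ifs <;> simp_all
    have fin : ∀ d', Closes d' w →
        Runs (.seq (sel i fun a => match a with
          | .lp => .push t .one
          | .rp => .pop t
          | _ => .skip) (xfer i j)) s
          (update (update (update s i (w ++ u)) t (List.replicate d' .one)) j (a :: s j)) 9 →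
        Runs (closing i j t) s (update (update (update s i u) t []) j ((a :: w).reverse ++ s j))
          (10 * (a :: w).length + 1) := by
      intro d' hd hr
      refine (Runs.while_true (by simp [ht, List.replicate_succ]) hr (ih hd _ ?_ ?_)).congr ?_
        (by simp; omega)
      · simp [update_of_ne hjt.symm]
      · simp [update_of_ne hij, update_of_ne hit]
      · funext k
        simp only [update_apply]
        split_ifs <;> simp_all
    cases a
    · refine fin (d + 1) h (key (d + 1) _ h ((Runs.skip s).congr ?_ le_rfl))
      rw [← ht, update_eq_self]
    · refine fin (d + 1) h (key (d + 1) _ h ((Runs.skip s).congr ?_ le_rfl))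
      rw [← ht, update_eq_self]
    · refine fin (d + 2) h (key (d + 2) _ h ((Runs.push s t _).congr ?_ le_rfl))
      rw [ht, ← List.replicate_succ]
    · refine fin d h (key d _ h ((Runs.pop s t).congr ?_ le_rfl))
      rw [ht]; simp

/-- The brackets in the word match. -/
def Balanced (w : List Sym) : Prop := ∀ d u, Closes (d + 1) u → Closes (d + 1) (w ++ u)

theorem Balanced.nil : Balanced [] := fun _ _ h => h

theorem Balanced.append {v w : List Sym} (hv : Balanced v) (hw : Balanced w) :
    Balanced (v ++ w) := fun d u h => by
  rw [List.append_assoc]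
  exact hv d _ (hw d u h)

theorem Balanced.bracket {w : List Sym} (hw : Balanced w) : Balanced (Sym.lp :: w ++ [Sym.rp]) :=
  fun d u h => by
    have : Closes (d + 2) (w ++ .rp :: u) := hw (d + 1) _ h
    simpa [Closes] using this

theorem Balanced.closes {w : List Sym} (hw : Balanced w) : Closes 1 (w ++ [.rp]) :=
  hw 0 [.rp] rfl

theorem balanced_zero : Balanced [.zero] := fun _ _ h => h

theorem balanced_one : Balanced [.one] := fun _ _ h => h

namespace Cmd

/-- Move a bracketed word from stack `i` to stack `j`, which reverses it. -/
def group (i j t : ℕ) : Cmd := .seq (xfer i j) (.seq (.push t .one) (closing i j t))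

theorem runs_group {i j t : ℕ} (hij : i ≠ j) (hit : i ≠ t) (hjt : j ≠ t) {w u : List Sym}
    (h : Balanced w) (s : Store) (ht : s t = []) (hi : s i = (Sym.lp :: w ++ [Sym.rp]) ++ u) :
    Runs (group i j t) s (update (update s i u) j ((Sym.lp :: w ++ [Sym.rp]).reverse ++ s j))
      (20 * (Sym.lp :: w ++ [Sym.rp]).length) := by
  refine ((runs_xfer hij hi).seq ((Runs.push _ t .one).seq
    (runs_closing hij hit hjt h.closes (u := u) _ ?_ ?_))).congr ?_ ?_
  · simp [update_of_ne hit.symm, update_of_ne hjt.symm, ht]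
  · simp [update_of_ne hit, update_of_ne hij]
  · funext k
    simp only [update_apply]
    split_ifs <;> simp_all
  · simp; omega

end Cmd

/-! ## Encodings on which stack programs work -/

/-- Types with a self-delimiting encoding, together with a program that finds the end of an encoded
value. -/
class Enc (α : Type) where
  enc : α → List Sym
  prefix_free : ∀ {a b : α} {v w : List Sym}, enc a ++ v = enc b ++ w → a = b ∧ v = w
  balanced : ∀ a : α, Balanced (enc a)
  head_ne : ∀ a : α, ∃ x w, enc a = x :: w ∧ x ≠ Sym.rp
  take : ℕ → ℕ → ℕ → Cmd
  runs_take : ∃ K, ∀ (i j t : ℕ), i ≠ j → i ≠ t → j ≠ t → ∀ (s : Store) (a : α) (u : List Sym),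
    s t = [] → s i = enc a ++ u →
      Runs (take i j t) s (update (update s i u) j ((enc a).reverse ++ s j)) (K * (enc a).length)

open Enc (enc)

theorem enc_injective {α : Type} [Enc α] : Function.Injective (enc : α → List Sym) := fun a b h =>
  (Enc.prefix_free (v := []) (w := []) (by rw [h])).1

theorem enc_length_pos {α : Type} [Enc α] (a : α) : 0 < (enc a).length := by
  obtain ⟨x, w, h, _⟩ := Enc.head_ne a
  simp [h]

/-- The encoding of a type that is embedded into another one. -/
@[reducible] def Enc.ofInjective {α β : Type} [Enc β] (f : α → β) (hf : Function.Injective f) : Enc α where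
  enc a := enc (f a)
  prefix_free h := ⟨hf (Enc.prefix_free h).1, (Enc.prefix_free h).2⟩
  balanced a := Enc.balanced (f a)
  head_ne a := Enc.head_ne (f a)
  take := Enc.take β
  runs_take :=
    let ⟨K, h⟩ := Enc.runs_take (α := β)
    ⟨K, fun i j t h₁ h₂ h₃ s a u => h i j t h₁ h₂ h₃ s (f a) u⟩

instance : Enc Bool where
  enc b := [Sym.ofBool b]
  prefix_free {a b v w} h := by cases a <;> cases b <;> simp_all [Sym.ofBool]
  balanced b := by cases b; exacts [balanced_zero, balanced_one]
  head_ne b := ⟨Sym.ofBool b, [], rfl, by cases b <;> simp [Sym.ofBool]⟩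
  take i j _ := Cmd.xfer i j
  runs_take := ⟨5, fun i j t hij _ _ s b u _ hi => by simpa using Cmd.runs_xfer hij hi⟩

/-- One symbol is spent on the unit, since `head_ne` forbids empty code words. -/
instance : Enc Unit := Enc.ofInjective (fun _ => false) fun _ _ _ => rfl

instance {α β : Type} [Enc α] [Enc β] : Enc (α × β) where
  enc p := enc p.1 ++ enc p.2
  prefix_free {a b v w} h := by
    rw [List.append_assoc, List.append_assoc] at h
    have h₁ := Enc.prefix_free h
    have h₂ := Enc.prefix_free h₁.2
    exact ⟨Prod.ext h₁.1 h₂.1, h₂.2⟩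
  balanced p := (Enc.balanced p.1).append (Enc.balanced p.2)
  head_ne p := by
    obtain ⟨x, w, h, hx⟩ := Enc.head_ne p.1
    exact ⟨x, w ++ enc p.2, by simp [h], hx⟩
  take i j t := .seq (Enc.take α i j t) (Enc.take β i j t)
  runs_take := by
    obtain ⟨K, hK⟩ := Enc.runs_take (α := α)
    obtain ⟨L, hL⟩ := Enc.runs_take (α := β)
    refine ⟨K + L, fun i j t hij hit hjt s p u ht hi => ?_⟩
    rw [List.append_assoc] at hi
    have h₁ := hK i j t hij hit hjt s p.1 _ ht hi
    have h₂ := hL i j t hij hit hjt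
      (update (update s i (enc p.2 ++ u)) j ((enc p.1).reverse ++ s j)) p.2 u
      (by simp [update_of_ne hjt.symm, update_of_ne hit.symm, ht]) (by simp [update_of_ne hij])
    refine (h₁.seq h₂).congr ?_ ?_
    · funext k
      simp only [update_apply]
      split_ifs <;> simp_all
    · simp only [List.length_append]
      nlinarith

instance {α β : Type} [Enc α] [Enc β] : Enc (α ⊕ β) where
  enc
    | .inl a => .zero :: enc a
    | .inr b => .one :: enc b
  prefix_free {a b v w} h := by
    rcases a with a | a <;> rcases b with b | b <;> simp only [List.cons_append, List.cons.injEq,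
      reduceCtorEq, false_and, true_and] at h
    · exact ⟨by rw [(Enc.prefix_free h).1], (Enc.prefix_free h).2⟩
    · exact ⟨by rw [(Enc.prefix_free h).1], (Enc.prefix_free h).2⟩
  balanced a := by
    rcases a with a | a
    · exact balanced_zero.append (Enc.balanced a)
    · exact balanced_one.append (Enc.balanced a)
  head_ne a := by rcases a with a | a <;> exact ⟨_, _, rfl, by simp⟩
  take i j t := .ite i (· = some .zero) (.seq (Cmd.xfer i j) (Enc.take α i j t))
    (.seq (Cmd.xfer i j) (Enc.take β i j t))
  runs_take := by
    obtain ⟨K, hK⟩ := Enc.runs_take (α := α)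
    obtain ⟨L, hL⟩ := Enc.runs_take (α := β)
    refine ⟨6 + K + L, fun i j t hij hit hjt s p u ht hi => ?_⟩
    rcases p with a | b
    · rw [List.cons_append] at hi
      have h₁ := Cmd.runs_xfer hij hi
      have h₂ := hK i j t hij hit hjt
        (update (update s i (enc a ++ u)) j (.zero :: s j)) a u
        (by simp [update_of_ne hjt.symm, update_of_ne hit.symm, ht]) (by simp [update_of_ne hij])
      refine (Runs.ite_true (by simp [hi]) (h₁.seq h₂)).congr ?_ ?_
      · funext k
        simp only [update_apply]
        split_ifs <;> simp_all
      · simp only [List.length_cons]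
        nlinarith
    · rw [List.cons_append] at hi
      have h₁ := Cmd.runs_xfer hij hi
      have h₂ := hL i j t hij hit hjt
        (update (update s i (enc b ++ u)) j (.one :: s j)) b u
        (by simp [update_of_ne hjt.symm, update_of_ne hit.symm, ht]) (by simp [update_of_ne hij])
      refine (Runs.ite_false (by simp [hi]) (h₁.seq h₂)).congr ?_ ?_
      · funext k
        simp only [update_apply]
        split_ifs <;> simp_all
      · simp only [List.length_cons]
        nlinarith

theorem encList_cons {α : Type} (e : α → List Sym) (a : α) (l : List α) :
    encList e (a :: l) = .lp :: (e a ++ (encList e l).tail) := by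
  simp [encList]

theorem encList_eq {α : Type} (e : α → List Sym) (l : List α) :
    encList e l = .lp :: (encList e l).tail := by
  simp [encList]

/-- No entry begins with `rp`, so the closing bracket is recognised as the end of the list, which
gives prefix-freeness. To find this end a program counts brackets without parsing the entries; this
is what balancedness of all encodings is for. -/
instance {α : Type} [Enc α] : Enc (List α) where
  enc := encList enc
  prefix_free {a b v w} h := by
    simp only [encList, List.cons_append, List.append_assoc, List.cons.injEq, true_and,
      List.nil_append] at h
    induction a generalizing b with
    | nil =>
      cases b with
      | nil => simpa using h
      | cons y b =>
        obtain ⟨x, u, hx, hne⟩ := Enc.head_ne y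
        simp [hx, hne.symm] at h
    | cons z a ih =>
      cases b with
      | nil =>
        obtain ⟨x, u, hx, hne⟩ := Enc.head_ne z
        simp [hx, hne] at h
      | cons y b =>
        simp only [List.flatMap_cons, List.append_assoc] at h
        have h₁ := Enc.prefix_free h
        have h₂ := ih h₁.2
        exact ⟨by rw [h₁.1, h₂.1], h₂.2⟩
  balanced l := by
    refine Balanced.bracket ?_
    induction l with
    | nil => exact Balanced.nil
    | cons a l ih => exact (Enc.balanced a).append ih
  head_ne l := ⟨.lp, l.flatMap enc ++ [.rp], rfl, by simp⟩
  take := Cmd.group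
  runs_take := by
    refine ⟨20, fun i j t hij hit hjt s l u ht hi => ?_⟩
    refine Cmd.runs_group hij hit hjt ?_ s ht hi
    clear hi
    induction l with
    | nil => exact Balanced.nil
    | cons a l ih => exact (Enc.balanced a).append ih

theorem enc_prod {α β : Type} [Enc α] [Enc β] (p : α × β) : enc p = enc p.1 ++ enc p.2 := rfl

theorem enc_inl {α β : Type} [Enc α] [Enc β] (a : α) :
    enc (Sum.inl a : α ⊕ β) = .zero :: enc a := rfl

theorem enc_inr {α β : Type} [Enc α] [Enc β] (b : β) :
    enc (Sum.inr b : α ⊕ β) = .one :: enc b := rfl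

theorem enc_list {α : Type} [Enc α] (l : List α) : enc l = encList enc l := rfl

theorem enc_bool (b : Bool) : enc b = [Sym.ofBool b] := rfl

theorem enc_name (w : Name) : enc w = encWord w := by
  have : (enc : Bool → List Sym) = fun b => [Sym.ofBool b] := rfl
  rw [enc_list, encList, encWord, this, List.map_eq_flatMap]

end OBDA

namespace OBDA

open Function
open Enc (enc)

/-! ## Functions that are computed by stack programs -/

/-- The store that agrees with `s` below stack `r` and has the given words on the next six stacks;
all other stacks are empty. -/
def frame (s : Store) (r : ℕ) (x₀ x₁ x₂ x₃ x₄ x₅ : List Sym) : Store :=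
  fun k => if k < r then s k else [x₀, x₁, x₂, x₃, x₄, x₅].getD (k - r) []

section Frame

variable (s : Store) (r : ℕ) (x₀ x₁ x₂ x₃ x₄ x₅ w : List Sym)

@[simp] theorem frame_zero : frame s r x₀ x₁ x₂ x₃ x₄ x₅ r = x₀ := by simp [frame]
@[simp] theorem frame_one : frame s r x₀ x₁ x₂ x₃ x₄ x₅ (r + 1) = x₁ := by simp [frame]
@[simp] theorem frame_two : frame s r x₀ x₁ x₂ x₃ x₄ x₅ (r + 2) = x₂ := by simp [frame]
@[simp] theorem frame_three : frame s r x₀ x₁ x₂ x₃ x₄ x₅ (r + 3) = x₃ := by simp [frame]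
@[simp] theorem frame_four : frame s r x₀ x₁ x₂ x₃ x₄ x₅ (r + 4) = x₄ := by simp [frame]
@[simp] theorem frame_five : frame s r x₀ x₁ x₂ x₃ x₄ x₅ (r + 5) = x₅ := by simp [frame]

theorem update_frame (i : ℕ) (hi : i < 6) :
    update (frame s r x₀ x₁ x₂ x₃ x₄ x₅) (r + i) w = fun k =>
      if k < r then s k else ([x₀, x₁, x₂, x₃, x₄, x₅].set i w).getD (k - r) [] := by
  funext k
  obtain h | ⟨j, rfl⟩ : k < r ∨ ∃ j, k = r + j :=
    (lt_or_ge k r).imp_right fun h => ⟨k - r, by omega⟩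
  · simp [frame, h, update_of_ne (show k ≠ r + i by omega)]
  · by_cases hj : j = i
    · subst hj
      simp [hi]
    · rw [update_of_ne (by omega)]
      simp [frame, Ne.symm hj]

@[simp] theorem update_frame_zero :
    update (frame s r x₀ x₁ x₂ x₃ x₄ x₅) r w = frame s r w x₁ x₂ x₃ x₄ x₅ :=
  update_frame s r x₀ x₁ x₂ x₃ x₄ x₅ w 0 (by omega)
@[simp] theorem update_frame_one :
    update (frame s r x₀ x₁ x₂ x₃ x₄ x₅) (r + 1) w = frame s r x₀ w x₂ x₃ x₄ x₅ :=
  update_frame s r x₀ x₁ x₂ x₃ x₄ x₅ w 1 (by omega)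
@[simp] theorem update_frame_two :
    update (frame s r x₀ x₁ x₂ x₃ x₄ x₅) (r + 2) w = frame s r x₀ x₁ w x₃ x₄ x₅ :=
  update_frame s r x₀ x₁ x₂ x₃ x₄ x₅ w 2 (by omega)
@[simp] theorem update_frame_three :
    update (frame s r x₀ x₁ x₂ x₃ x₄ x₅) (r + 3) w = frame s r x₀ x₁ x₂ w x₄ x₅ :=
  update_frame s r x₀ x₁ x₂ x₃ x₄ x₅ w 3 (by omega)
@[simp] theorem update_frame_four :
    update (frame s r x₀ x₁ x₂ x₃ x₄ x₅) (r + 4) w = frame s r x₀ x₁ x₂ x₃ w x₅ :=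
  update_frame s r x₀ x₁ x₂ x₃ x₄ x₅ w 4 (by omega)

theorem frame_above {j k : ℕ} (hk : r + j < k)
    (h : ∀ i, j < i → [x₀, x₁, x₂, x₃, x₄, x₅].getD i [] = []) :
    frame s r x₀ x₁ x₂ x₃ x₄ x₅ k = [] := by
  rw [frame, if_neg (by omega)]
  exact h _ (by omega)

theorem eq_frame (h : ∀ k, r < k → s k = []) : frame s r (s r) [] [] [] [] [] = s := by
  funext k
  rcases lt_trichotomy k r with hk | rfl | hk
  · simp [frame, hk]
  · simp
  · rw [h k hk]
    refine frame_above _ _ _ _ _ _ _ _ (j := 0) hk fun i hi => ?_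
    rcases i with _ | _ | _ | _ | _ | _ | _ <;> simp_all

end Frame

/-! ### Programs for basic functions, with explicit time bounds -/

section Computes

variable {α β γ δ : Type} [Enc α] [Enc β] [Enc γ] [Enc δ]

/-- The length of the encoding. -/
def sz (a : α) : ℕ := (enc a).length

theorem sz_prod (p : α × β) : sz p = sz p.1 + sz p.2 := by simp [sz, enc_prod]

theorem sz_pos (a : α) : 0 < sz a := enc_length_pos a

/-- The programs `P r` compute the function `f` on stack `r`, with the stacks above `r` as work
space, within time `T`. -/
def Computes (P : ℕ → Cmd) (f : α → β) (T : α → ℕ) : Prop :=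
  ∀ r s a, s r = enc a → (∀ k, r < k → s k = []) → Runs (P r) s (update s r (enc (f a))) (T a)

theorem computes_of_frame {P : ℕ → Cmd} {f : α → β} {T : α → ℕ}
    (h : ∀ r s a, Runs (P r) (frame s r (enc a) [] [] [] [] [])
      (frame s r (enc (f a)) [] [] [] [] []) (T a)) : Computes P f T := by
  intro r s a hs he
  have h₁ := h r s a
  have h₂ := eq_frame s r he
  rw [hs] at h₂
  rw [← update_frame_zero s r (enc a) [] [] [] [] [] (enc (f a)), h₂] at h₁
  exact h₁

theorem Computes.mono {P : ℕ → Cmd} {f : α → β} {T U : α → ℕ} (h : Computes P f T)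
    (hT : ∀ a, T a ≤ U a) : Computes P f U :=
  fun r s a hs he => (h r s a hs he).mono (hT a)

/-- A step lengthens a stack by at most one symbol, so a time bound is also a bound on the growth of
the output. This makes polynomial time stable under composition. -/
theorem Computes.sz_le {P : ℕ → Cmd} {f : α → β} {T : α → ℕ} (h : Computes P f T) (a : α) :
    sz (f a) ≤ sz a + T a := by
  have := (h 0 (single (enc a)) a (by simp [single]) (by
    intro k hk; simp [single, update_apply]; omega)).length_le 0
  simpa [single, sz] using this

theorem Computes.frame_zero {P : ℕ → Cmd} {f : α → β} {T : α → ℕ} (h : Computes P f T) (r s a) :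
    Runs (P r) (frame s r (enc a) [] [] [] [] []) (frame s r (enc (f a)) [] [] [] [] []) (T a) := by
  refine (h r _ a (by simp) fun k hk => frame_above _ _ _ _ _ _ _ _ (j := 0) hk ?_).congr
    (by simp) le_rfl
  rintro (_ | _ | _ | _ | _ | _ | _) <;> simp

theorem Computes.frame_one {P : ℕ → Cmd} {f : α → β} {T : α → ℕ} (h : Computes P f T) (r s a x₀) :
    Runs (P (r + 1)) (frame s r x₀ (enc a) [] [] [] []) (frame s r x₀ (enc (f a)) [] [] [] [])
      (T a) := by
  refine (h _ _ a (by simp) fun k hk => frame_above _ _ _ _ _ _ _ _ (j := 1) hk ?_).congr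
    (by simp) le_rfl
  rintro (_ | _ | _ | _ | _ | _ | _) <;> simp

theorem Computes.frame_two {P : ℕ → Cmd} {f : α → β} {T : α → ℕ} (h : Computes P f T)
    (r s a x₀ x₁) :
    Runs (P (r + 2)) (frame s r x₀ x₁ (enc a) [] [] []) (frame s r x₀ x₁ (enc (f a)) [] [] [])
      (T a) := by
  refine (h _ _ a (by simp) fun k hk => frame_above _ _ _ _ _ _ _ _ (j := 2) hk ?_).congr
    (by simp) le_rfl
  rintro (_ | _ | _ | _ | _ | _ | _) <;> simp

theorem Computes.frame_three {P : ℕ → Cmd} {f : α → β} {T : α → ℕ} (h : Computes P f T)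
    (r s a x₀ x₁ x₂) :
    Runs (P (r + 3)) (frame s r x₀ x₁ x₂ (enc a) [] []) (frame s r x₀ x₁ x₂ (enc (f a)) [] [])
      (T a) := by
  refine (h _ _ a (by simp) fun k hk => frame_above _ _ _ _ _ _ _ _ (j := 3) hk ?_).congr
    (by simp) le_rfl
  rintro (_ | _ | _ | _ | _ | _ | _) <;> simp

theorem Computes.comp {P Q : ℕ → Cmd} {f : α → β} {g : β → γ} {T : α → ℕ} {U : β → ℕ}
    (hg : Computes Q g U) (hf : Computes P f T) :
    Computes (fun r => .seq (P r) (Q r)) (fun a => g (f a)) (fun a => T a + U (f a)) :=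
  computes_of_frame fun r s a => (hf.frame_zero r s a).seq (hg.frame_zero r s (f a))

/-- The components are computed on copies of the input. Moving `g a` back first and `f a` on top of
it produces the encoding of the pair. -/
theorem Computes.pair {P Q : ℕ → Cmd} {f : α → β} {g : α → γ} {T U : α → ℕ}
    (hf : Computes P f T) (hg : Computes Q g U) :
    Computes (fun r => .seq (Cmd.copy r (r + 1) (r + 2)) <| .seq (Q (r + 1)) <|
        .seq (Cmd.copy r (r + 2) (r + 3)) <| .seq (P (r + 2)) <| .seq (Cmd.clear r) <|
        .seq (Cmd.move (r + 1) r (r + 3)) (Cmd.move (r + 2) r (r + 3)))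
      (fun a => (f a, g a)) (fun a => 60 * sz a + 20 * T a + 20 * U a + 20) := by
  refine computes_of_frame fun r s a => ?_
  have hF := hf.sz_le a
  have hG := hg.sz_le a
  have h₁ := Cmd.runs_copy (i := r) (j := r + 1) (t := r + 2)
    (s := frame s r (enc a) [] [] [] [] []) (by omega) (by omega) (by omega) (by simp)
  have h₂ := Cmd.runs_copy (i := r) (j := r + 2) (t := r + 3)
    (s := frame s r (enc a) (enc (g a)) [] [] [] []) (by omega) (by omega) (by omega) (by simp)
  have h₃ := Cmd.runs_clear r (frame s r (enc a) (enc (g a)) (enc (f a)) [] [] [])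
  have h₄ := Cmd.runs_move (i := r + 1) (j := r) (t := r + 3)
    (s := frame s r [] (enc (g a)) (enc (f a)) [] [] []) (by omega) (by omega) (by omega) (by simp)
  have h₅ := Cmd.runs_move (i := r + 2) (j := r) (t := r + 3)
    (s := frame s r (enc (g a)) [] (enc (f a)) [] [] []) (by omega) (by omega) (by omega) (by simp)
  simp at h₁ h₂ h₃ h₄ h₅
  refine (h₁.seq <| (hg.frame_one r s a _).seq <| h₂.seq <| (hf.frame_two r s a _ _).seq <|
    h₃.seq <| h₄.seq h₅).mono ?_
  simp only [sz] at *
  omega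

theorem computes_fst : ∃ P K, Computes P (Prod.fst : α × β → α) (fun p => K * sz p + K) := by
  obtain ⟨K, hK⟩ := Enc.runs_take (α := α)
  refine ⟨fun r => .seq (Enc.take α r (r + 1) (r + 2)) <| .seq (Cmd.clear r) (Cmd.mv (r + 1) r),
    K + 20, computes_of_frame fun r s p => ?_⟩
  refine ((hK r (r + 1) (r + 2) (by omega) (by omega) (by omega) _ p.1 (enc p.2)
    (by simp) (by simp [enc_prod])).seq <| (Cmd.runs_clear _ _).seq <|
    Cmd.runs_mv (by omega) _).congr ?_ ?_
  · simp
  · simp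
    simp only [sz, enc_prod, List.length_append]
    nlinarith

theorem computes_snd : ∃ P K, Computes P (Prod.snd : α × β → β) (fun p => K * sz p + K) := by
  obtain ⟨K, hK⟩ := Enc.runs_take (α := α)
  refine ⟨fun r => .seq (Enc.take α r (r + 1) (r + 2)) (Cmd.clear (r + 1)), K + 20,
    computes_of_frame fun r s p => ?_⟩
  refine ((hK r (r + 1) (r + 2) (by omega) (by omega) (by omega) _ p.1 (enc p.2)
    (by simp) (by simp [enc_prod])).seq <| Cmd.runs_clear _ _).congr ?_ ?_
  · simp
  · simp
    simp only [sz, enc_prod, List.length_append]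
    nlinarith

theorem computes_const (b : β) : ∃ P K, Computes P (fun _ : α => b) (fun a => K * sz a + K) := by
  refine ⟨fun r => .seq (Cmd.clear r) (Cmd.pushes r (enc b)), (enc b).length + 2,
    computes_of_frame fun r s a => ?_⟩
  refine ((Cmd.runs_clear _ _).seq (Cmd.runs_pushes _ _ _)).congr ?_ ?_
  · simp
  · simp only [frame_zero, sz]
    nlinarith

/-- Functions that put a fixed word in front of the encoding. -/
theorem computes_pushes (w : List Sym) {f : α → β} (hf : ∀ a, enc (f a) = w ++ enc a) :
    Computes (fun r => Cmd.pushes r w) f (fun _ => w.length + 1) := by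
  refine computes_of_frame fun r s a => ?_
  exact (Cmd.runs_pushes r w _).congr (by simp [hf]) le_rfl

theorem Computes.branch {P Q : ℕ → Cmd} {f : α → δ} {g : β → δ} {h : γ → δ} {T : β → ℕ}
    {U : γ → ℕ} {V : α → ℕ} (hg : Computes P g T) (hh : Computes Q h U)
    (H : ∀ a, (∃ b, enc a = .zero :: enc b ∧ f a = g b ∧ T b ≤ V a) ∨
      ∃ c, enc a = .one :: enc c ∧ f a = h c ∧ U c ≤ V a) :
    Computes (fun r => .ite r (· = some .zero) (.seq (.pop r) (P r)) (.seq (.pop r) (Q r))) f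
      (fun a => V a + 2) := by
  refine computes_of_frame fun r s a => ?_
  have h₀ := Runs.pop (frame s r (enc a) [] [] [] [] []) r
  rcases H a with ⟨b, h₁, h₂, h₃⟩ | ⟨b, h₁, h₂, h₃⟩ <;> simp [h₁] at h₀ <;> rw [h₂, h₁]
  · exact (Runs.ite_true (by simp) (h₀.seq (hg.frame_zero r s b))).mono (by omega)
  · exact (Runs.ite_false (by simp) (h₀.seq (hh.frame_zero r s b))).mono (by omega)

/-- The encodings of the pair and of the extended list differ only in the place of the opening
bracket, which has to move in front of the new entry. -/
theorem computes_cons :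
    ∃ P K, Computes P (fun p : α × List α => p.1 :: p.2) (fun p => K * sz p + K) := by
  obtain ⟨K, hK⟩ := Enc.runs_take (α := α)
  refine ⟨fun r => .seq (Enc.take α r (r + 1) (r + 2)) <| .seq (.pop r) <|
    .seq (Cmd.mv (r + 1) r) (.push r .lp), K + 20, computes_of_frame fun r s p => ?_⟩
  refine ((hK r (r + 1) (r + 2) (by omega) (by omega) (by omega) _ p.1 (enc p.2)
    (by simp) (by simp [enc_prod])).seq <| (Runs.pop _ _).seq <|
    (Cmd.runs_mv (by omega) _).seq <| Runs.push _ _ _).congr ?_ ?_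
  · have h₁ : enc (p.1 :: p.2) = .lp :: (enc p.1 ++ (enc p.2).tail) := encList_cons _ _ _
    simp [h₁]
  · simp
    simp only [sz, enc_prod, List.length_append]
    nlinarith

/-- The head and the tail of a list, if it is not empty. -/
def uncons : List α → Unit ⊕ (α × List α)
  | [] => .inl ()
  | a :: l => .inr (a, l)

/-- After the opening bracket is removed, the list is empty if and only if `rp` is on top, because
entries never begin with `rp`. The two zeros written in that case encode `Sum.inl ()`. -/
theorem computes_uncons :
    ∃ P K, Computes P (uncons : List α → Unit ⊕ (α × List α)) (fun p => K * sz p + K) := by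
  obtain ⟨K, hK⟩ := Enc.runs_take (α := α)
  refine ⟨fun r => .seq (.pop r) <| .ite r (· = some .rp)
    (.seq (.pop r) <| .seq (.push r .zero) (.push r .zero))
    (.seq (Enc.take α r (r + 1) (r + 2)) <| .seq (.push r .lp) <|
    .seq (Cmd.mv (r + 1) r) (.push r .one)), K + 20, computes_of_frame fun r s l => ?_⟩
  cases l with
  | nil =>
    have h₁ : enc ([] : List α) = [.lp, .rp] := rfl
    refine ((Runs.pop _ r).seq (Runs.ite_true ?_ ((Runs.pop _ _).seq <|
      (Runs.push _ _ _).seq (Runs.push _ _ _)))).congr ?_ ?_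
    · simp [h₁]
    · simp [h₁, uncons, enc_inl]
      rfl
    · generalize (K + 20) * _ = m
      omega
  | cons a l =>
    have h₁ : enc (a :: l) = .lp :: (enc a ++ (enc l).tail) := encList_cons _ _ _
    have h₂ : enc l = .lp :: (enc l).tail := encList_eq _ _
    have h₃ : enc (uncons (a :: l)) = .one :: (enc a ++ enc l) := rfl
    obtain ⟨x, w, hx, hne⟩ := Enc.head_ne a
    refine ((Runs.pop _ r).seq (Runs.ite_false ?_ ((hK r (r + 1) (r + 2) (by omega) (by omega)
      (by omega) _ a (enc l).tail ?_ ?_).seq <| (Runs.push _ _ _).seq <|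
      (Cmd.runs_mv (by omega) _).seq (Runs.push _ _ _)))).congr ?_ ?_
    · simp [h₁, hx, hne]
    · simp
    · simp [h₁]
    · simp only [update_frame_zero, update_frame_one, frame_zero, frame_one, h₃]
      simp [← h₂]
    · simp
      simp only [sz, h₁, List.length_append, List.length_cons]
      nlinarith

-- Values are equal if and only if their encodings are. Both encodings arrive reversed on their work
-- stacks, so comparing the reversals suffices.
open Classical in
theorem computes_eq :
    ∃ P K, Computes P (fun p : α × α => decide (p.1 = p.2)) (fun p => K * sz p + K) := by
  obtain ⟨K, hK⟩ := Enc.runs_take (α := α)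
  refine ⟨fun r => .seq (Enc.take α r (r + 1) (r + 2)) <| .seq (Cmd.mv r (r + 2)) <|
    .seq (Cmd.compare (r + 1) (r + 2) (r + 3)) <|
    .seq (.ite (r + 3) (·.isNone) (.ite (r + 2) (·.isNone) (.push r .one) (.push r .zero))
      (.push r .zero)) <| .seq (Cmd.clear (r + 2)) (Cmd.clear (r + 3)), K + 40,
    computes_of_frame fun r s p => ?_⟩
  have h₁ := (hK r (r + 1) (r + 2) (by omega) (by omega) (by omega)
    (frame s r (enc p) [] [] [] [] []) p.1 (enc p.2)
    (by simp) (by simp [enc_prod]))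
  have h₁' := Cmd.runs_mv (i := r) (j := r + 2) (by omega)
    (frame s r (enc p.2) (enc p.1).reverse [] [] [] [])
  obtain ⟨v, n, h₂, h₃, h₄, h₅⟩ := Cmd.runs_compare (i := r + 1) (j := r + 2) (m := r + 3)
    (by omega) (by omega) (by omega)
    (frame s r [] (enc p.1).reverse (enc p.2).reverse [] [] [])
  simp at h₁ h₁' h₂ h₃ h₄ h₅
  have h₆ : (n = [] ∧ v = []) ↔ p.1 = p.2 := by
    rw [h₂]
    exact ⟨fun h => enc_injective h, fun h => by rw [h]⟩
  have h₇ : Runs (.ite (r + 3) (·.isNone) (.ite (r + 2) (·.isNone) (.push r .one)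
      (.push r .zero)) (.push r .zero)) (frame s r [] [] v n [] [])
      (frame s r (enc (decide (p.1 = p.2))) [] v n [] []) 3 := by
    by_cases hn : n = []
    · by_cases hv : v = []
      · refine (Runs.ite_true (by simp [hn]) (Runs.ite_true (by simp [hv])
          (Runs.push _ _ _))).congr ?_ le_rfl
        rw [decide_eq_true (h₆.1 ⟨hn, hv⟩)]
        simp [enc_bool, Sym.ofBool]
      · refine (Runs.ite_true (by simp [hn]) (Runs.ite_false (by simp [hv])
          (Runs.push _ _ _))).congr ?_ le_rfl
        rw [decide_eq_false (fun h => hv (h₆.2 h).2)]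
        simp [enc_bool, Sym.ofBool]
    · refine (Runs.ite_false (by simp [hn]) (Runs.push _ _ _)).congr ?_ (by omega)
      rw [decide_eq_false (fun h => hn (h₆.2 h).1)]
      simp [enc_bool, Sym.ofBool]
  refine (h₁.seq <| h₁'.seq <| h₅.seq <| h₇.seq <| (Cmd.runs_clear _ _).seq
    (Cmd.runs_clear _ _)).congr ?_ ?_
  · simp
  · simp
    simp only [sz, enc_prod, List.length_append]
    nlinarith

/-! ### Folds over lists -/

/-- The program of `computes_foldl`, for a program `P` that computes the step. -/
def foldProg (γ β : Type) [Enc γ] [Enc β] (P : ℕ → Cmd) (r : ℕ) : Cmd :=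
  .seq (Enc.take (List β) r (r + 4) (r + 5)) <| .seq (Cmd.mv (r + 4) (r + 1)) <|
  .seq (Enc.take γ r (r + 4) (r + 5)) <| .seq (Cmd.mv (r + 4) (r + 2)) <| .seq (.pop (r + 1)) <|
  .seq (.while (r + 1) (· ≠ some .rp) <|
    .seq (Cmd.copy r (r + 3) (r + 4)) <| .seq (Cmd.copy (r + 2) (r + 3) (r + 4)) <|
    .seq (Enc.take β (r + 1) (r + 4) (r + 5)) <| .seq (Cmd.mv (r + 4) (r + 3)) <|
    .seq (P (r + 3)) <| .seq (Cmd.clear (r + 2)) (Cmd.move (r + 3) (r + 2) (r + 4))) <|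
  .seq (.pop (r + 1)) <| .seq (Cmd.clear r) (Cmd.move (r + 2) r (r + 3))

/-- A fold over a list. The bound `S a` on the length of the intermediate results enters the time
bound. -/
theorem computes_foldl {P : ℕ → Cmd} {step : β × γ × α → γ} {p : ℕ → ℕ} (hp : Monotone p)
    (hP : Computes P step (fun a => p (sz a))) {S : List β × γ × α → ℕ}
    (hS : ∀ a l₁ l₂, a.1 = l₁ ++ l₂ → sz (l₁.foldl (fun g b => step (b, g, a.2.2)) a.2.1) ≤ S a) :
    ∃ K, Computes (foldProg γ β P)
      (fun a : List β × γ × α => a.1.foldl (fun g b => step (b, g, a.2.2)) a.2.1)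
      (fun a => (K * (sz a + S a) + K) * ((sz a + S a) + p (sz a + S a) + 1)) := by
  obtain ⟨K, hK⟩ := Enc.runs_take (α := β)
  obtain ⟨L, hL⟩ := Enc.runs_take (α := γ)
  obtain ⟨M, hM⟩ := Enc.runs_take (α := List β)
  refine ⟨K + L + M + 100, computes_of_frame fun r s ⟨l, g, a⟩ => ?_⟩
  have hS' := hS (l, g, a)
  dsimp only at hS' ⊢
  generalize S (l, g, a) = N at *
  -- Loop invariant: stack `r` holds the parameter, `r + 1` the remaining list without its opening
  -- bracket, `r + 2` the accumulator; `r + 3` is free for the argument of the step. The bound `Z`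
  -- stays fixed while the list shrinks, so that all rounds have the same time bound.
  have loop : ∀ (l : List β) (g : γ) (Z : ℕ), sz l ≤ Z →
      (∀ l₁ l₂, l = l₁ ++ l₂ → sz (l₁.foldl (fun g b => step (b, g, a)) g) ≤ N) →
      Runs (.while (r + 1) (· ≠ some .rp) <|
        .seq (Cmd.copy r (r + 3) (r + 4)) <| .seq (Cmd.copy (r + 2) (r + 3) (r + 4)) <|
        .seq (Enc.take β (r + 1) (r + 4) (r + 5)) <| .seq (Cmd.mv (r + 4) (r + 3)) <|
        .seq (P (r + 3)) <| .seq (Cmd.clear (r + 2)) (Cmd.move (r + 3) (r + 2) (r + 4)))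
        (frame s r (enc a) (enc l).tail (enc g) [] [] [])
        (frame s r (enc a) [.rp] (enc (l.foldl (fun g b => step (b, g, a)) g)) [] [] [])
        (l.length * (40 * (sz a + N + Z) + K * Z + p (sz a + N + Z) + 20) + 1) := by
    intro l
    induction l with
    | nil =>
      intro g Z hZ h
      have h₁ : enc ([] : List β) = [.lp, .rp] := rfl
      exact (Runs.while_false (by simp [h₁])).congr (by simp [h₁]) (by simp)
    | cons b l ih =>
      intro g Z hZ h
      have h₁ : enc (b :: l) = .lp :: (enc b ++ (enc l).tail) := encList_cons _ _ _
      obtain ⟨x, w, hx, hne⟩ := Enc.head_ne b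
      have hbl : sz b + sz l ≤ Z := by
        have h₂ : enc l = .lp :: (enc l).tail := encList_eq _ _
        have h₃ := congrArg List.length h₂
        simp only [sz, h₁, List.length_cons, List.length_append] at hZ h₃ ⊢
        omega
      have hg : sz g ≤ N := h [] _ rfl
      have hg' : sz (step (b, g, a)) ≤ N := h [b] l rfl
      have c₁ := Cmd.runs_copy (i := r) (j := r + 3) (t := r + 4)
        (s := frame s r (enc a) (enc (b :: l)).tail (enc g) [] [] [])
        (by omega) (by omega) (by omega) (by simp)
      have c₂ := Cmd.runs_copy (i := r + 2) (j := r + 3) (t := r + 4)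
        (s := frame s r (enc a) (enc (b :: l)).tail (enc g) (enc a) [] [])
        (by omega) (by omega) (by omega) (by simp)
      have c₃ := hK (r + 1) (r + 4) (r + 5) (by omega) (by omega) (by omega)
        (frame s r (enc a) (enc (b :: l)).tail (enc g) (enc g ++ enc a) [] []) b (enc l).tail
        (by simp) (by simp [h₁])
      have c₄ := Cmd.runs_mv (i := r + 4) (j := r + 3) (by omega)
        (frame s r (enc a) (enc l).tail (enc g) (enc g ++ enc a) (enc b).reverse [])
      have c₅ := hP.frame_three r s (b, g, a) (enc a) (enc l).tail (enc g)
      have c₆ := Cmd.runs_clear (r + 2)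
        (frame s r (enc a) (enc l).tail (enc g) (enc (step (b, g, a))) [] [])
      have c₇ := Cmd.runs_move (i := r + 3) (j := r + 2) (t := r + 4)
        (s := frame s r (enc a) (enc l).tail [] (enc (step (b, g, a))) [] [])
        (by omega) (by omega) (by omega) (by simp)
      rw [enc_prod, enc_prod] at c₅
      simp at c₁ c₂ c₃ c₄ c₆ c₇
      refine (Runs.while_true (by simp [h₁, hx, hne]) (c₁.seq <| c₂.seq <| c₃.seq <| c₄.seq <|
        c₅.seq <| c₆.seq c₇) (ih (step (b, g, a)) Z (by omega) ?_)).congr ?_ ?_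
      · intro l₁ l₂ hl
        exact h (b :: l₁) l₂ (by rw [hl]; rfl)
      · simp
      · have hm : p (sz (b, g, a)) ≤ p (sz a + N + Z) := hp (by
          simp only [sz_prod]; omega)
        have hkz : K * (enc b).length ≤ K * Z := Nat.mul_le_mul_left _ (by simp only [sz] at *; omega)
        simp only [List.length_cons, add_mul, one_mul]
        simp only [sz] at *
        generalize l.length * _ = m
        omega
  have d₁ := hM r (r + 4) (r + 5) (by omega) (by omega) (by omega)
    (frame s r (enc (l, g, a)) [] [] [] [] []) l (enc g ++ enc a) (by simp) (by simp [enc_prod])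
  have d₂ := Cmd.runs_mv (i := r + 4) (j := r + 1) (by omega)
    (frame s r (enc g ++ enc a) [] [] [] (enc l).reverse [])
  have d₃ := hL r (r + 4) (r + 5) (by omega) (by omega) (by omega)
    (frame s r (enc g ++ enc a) (enc l) [] [] [] []) g (enc a) (by simp) (by simp)
  have d₄ := Cmd.runs_mv (i := r + 4) (j := r + 2) (by omega)
    (frame s r (enc a) (enc l) [] [] (enc g).reverse [])
  have d₅ := Runs.pop (frame s r (enc a) (enc l) (enc g) [] [] []) (r + 1)
  have d₆ := loop l g (sz l) le_rfl hS'
  have hfin := hS' l [] (by simp)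
  generalize l.foldl (fun g b => step (b, g, a)) g = v at *
  have d₇ := Runs.pop (frame s r (enc a) [.rp] (enc v) [] [] []) (r + 1)
  have d₈ := Cmd.runs_clear r (frame s r (enc a) [] (enc v) [] [] [])
  have d₉ := Cmd.runs_move (i := r + 2) (j := r) (t := r + 3)
    (s := frame s r [] [] (enc v) [] [] []) (by omega) (by omega) (by omega) (by simp)
  simp at d₁ d₂ d₃ d₄ d₅ d₇ d₈ d₉
  refine (d₁.seq <| d₂.seq <| d₃.seq <| d₄.seq <| d₅.seq <| d₆.seq <| d₇.seq <| d₈.seq d₉).mono ?_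
  have hlen : l.length ≤ sz l := by
    rw [sz, enc_list, encList]
    simp only [List.cons_append, List.length_cons, List.length_append, List.length_flatMap]
    have : l.length ≤ (l.map fun a => (enc a).length).sum := by
      clear * -
      induction l with
      | nil => simp
      | cons b l ih =>
        have := enc_length_pos b
        simp only [List.length_cons, List.map_cons, List.sum_cons]
        omega
    omega
  have hz : sz (l, g, a) = sz l + sz g + sz a := by simp only [sz_prod]; omega
  set Y := sz (l, g, a) + N with hY
  have hpY : p (sz a + N + sz l) ≤ p Y := hp (by omega)
  generalize p (sz a + N + sz l) = q at *
  generalize p Y = Q at *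
  simp only [sz] at *
  have h1 : l.length * (40 * ((enc a).length + N + (enc l).length) + K * (enc l).length + q + 20) ≤
      Y * (40 * Y + K * Y + Q + 20) := by
    refine Nat.mul_le_mul (by omega) ?_
    have : K * (enc l).length ≤ K * Y := Nat.mul_le_mul_left _ (by omega)
    omega
  have h2 : M * (enc l).length ≤ M * Y := Nat.mul_le_mul_left _ (by omega)
  have h3 : L * (enc g).length ≤ L * Y := Nat.mul_le_mul_left _ (by omega)
  have h4 : (K + L + M + 100) * Y * 1 ≤ (K + L + M + 100) * Y * (Y + Q + 1) :=
    Nat.mul_le_mul_left _ (by omega)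
  have h5 : Y * (40 * Y + K * Y + Q + 20) + M * Y + L * Y + 40 * Y + 40 ≤
      ((K + L + M + 100) * Y + (K + L + M + 100)) * (Y + Q + 1) := by
    nlinarith [Nat.zero_le (L * Y * Y), Nat.zero_le (M * Y * Y), Nat.zero_le (K * Y * Q),
      Nat.zero_le (L * Y * Q), Nat.zero_le (M * Y * Q), Nat.zero_le (Y * Q), Nat.zero_le (K * Y),
      Nat.zero_le (K * Q), Nat.zero_le (L * Q), Nat.zero_le (M * Q), Nat.zero_le (Y * Y)]
  omega

end Computes

/-! ## Functions computable in polynomial time -/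

section PolyTime

variable {α β γ δ : Type} [Enc α] [Enc β] [Enc γ] [Enc δ]

theorem eval_mono (p : Polynomial ℕ) : Monotone fun n => p.eval n := by
  intro m n h
  induction p using Polynomial.induction_on' with
  | add p q hp hq => simpa using Nat.add_le_add hp hq
  | monomial k c => simpa using Nat.mul_le_mul_left c (Nat.pow_le_pow_left h k)

/-- The function is computed by a stack program in polynomial time. -/
@[fun_prop] def PT (f : α → β) : Prop :=
  ∃ P, ∃ p : Polynomial ℕ, Computes P f fun a => p.eval (sz a)

theorem PT.of_linear {f : α → β} (h : ∃ P K, Computes P f fun a => K * sz a + K) : PT f :=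
  let ⟨P, K, h⟩ := h
  ⟨P, .C K * .X + .C K, h.mono fun a => by simp⟩

theorem PT.sz_le {f : α → β} (h : PT f) : ∃ q : Polynomial ℕ, ∀ a, sz (f a) ≤ q.eval (sz a) :=
  let ⟨_, p, h⟩ := h
  ⟨.X + p, fun a => by simpa using h.sz_le a⟩

-- The second program runs on an input of size at most `q` of the original size, and polynomials
-- over `ℕ` are monotone.
@[fun_prop] theorem PT.comp {g : β → γ} {f : α → β} (hg : PT g) (hf : PT f) :
    PT fun a => g (f a) := by
  obtain ⟨q, hq⟩ := hf.sz_le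
  obtain ⟨P, p, hP⟩ := hf
  obtain ⟨Q, r, hQ⟩ := hg
  refine ⟨_, p + r.comp q, (hQ.comp hP).mono fun a => ?_⟩
  have := eval_mono r (hq a)
  simpa using this

@[fun_prop] theorem PT.of_enc {f : α → β} (h : ∀ a, enc (f a) = enc a) : PT f := by
  refine ⟨_, .C 1, (computes_pushes [] (f := f) (by simpa using h)).mono fun a => ?_⟩
  simp

@[fun_prop] theorem PT.id : PT fun a : α => a := PT.of_enc fun _ => rfl

@[fun_prop] theorem PT.const (b : β) : PT fun _ : α => b := .of_linear (computes_const b)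

@[fun_prop] theorem PT.pair {f : α → β} {g : α → γ} (hf : PT f) (hg : PT g) :
    PT fun a => (f a, g a) := by
  obtain ⟨P, p, hP⟩ := hf
  obtain ⟨Q, q, hQ⟩ := hg
  refine ⟨_, .C 60 * .X + .C 20 * p + .C 20 * q + .C 20, (hP.pair hQ).mono fun a => ?_⟩
  simp

@[fun_prop] theorem PT.fst {f : α → β × γ} (hf : PT f) : PT fun a => (f a).1 :=
  PT.comp (.of_linear computes_fst) hf

@[fun_prop] theorem PT.snd {f : α → β × γ} (hf : PT f) : PT fun a => (f a).2 :=
  PT.comp (.of_linear computes_snd) hf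

@[fun_prop] theorem PT.inl {f : α → β} (hf : PT f) : PT fun a => (Sum.inl (f a) : β ⊕ γ) :=
  PT.comp ⟨_, .C 2, (computes_pushes [.zero] fun _ => rfl).mono fun _ => by simp⟩ hf

@[fun_prop] theorem PT.inr {f : α → γ} (hf : PT f) : PT fun a => (Sum.inr (f a) : β ⊕ γ) :=
  PT.comp ⟨_, .C 2, (computes_pushes [.one] fun _ => rfl).mono fun _ => by simp⟩ hf

/-- The hypothesis speaks of the leading digit of the encoding and not of a type, so it covers both
sums and pairs with a Boolean or a sum in front. -/
theorem PT.branch {f : α → δ} {g : β → δ} {h : γ → δ} (hg : PT g) (hh : PT h)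
    (H : ∀ a, (∃ b, enc a = .zero :: enc b ∧ f a = g b) ∨
      ∃ c, enc a = .one :: enc c ∧ f a = h c) : PT f := by
  obtain ⟨P, p, hP⟩ := hg
  obtain ⟨Q, q, hQ⟩ := hh
  refine ⟨_, p + q + .C 2, (hP.branch hQ (V := fun a => (p + q).eval (sz a)) fun a => ?_).mono
    fun a => by simp⟩
  rcases H a with ⟨b, h₁, h₂⟩ | ⟨b, h₁, h₂⟩
  · have := eval_mono p (show sz b ≤ sz a by simp [sz, h₁])
    exact .inl ⟨b, h₁, h₂, by simp at this ⊢; omega⟩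
  · have := eval_mono q (show sz b ≤ sz a by simp [sz, h₁])
    exact .inr ⟨b, h₁, h₂, by simp at this ⊢; omega⟩

theorem PT.sumElim {f : α → β ⊕ γ} {g : α → β → δ} {h : α → γ → δ} (hf : PT f)
    (hg : PT fun p : α × β => g p.1 p.2) (hh : PT fun p : α × γ => h p.1 p.2) :
    PT fun a => Sum.elim (g a) (h a) (f a) := by
  have h₁ : PT fun p : β × α => g p.2 p.1 := hg.comp (f := fun p : β × α => (p.2, p.1)) (by fun_prop)
  have h₂ : PT fun p : γ × α => h p.2 p.1 := hh.comp (f := fun p : γ × α => (p.2, p.1)) (by fun_prop)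
  have h₃ : PT fun p : (β ⊕ γ) × α => Sum.elim (g p.2) (h p.2) p.1 := by
    refine PT.branch h₁ h₂ fun ⟨x, a⟩ => ?_
    rcases x with b | c
    · exact .inl ⟨(b, a), by simp [enc_prod, enc_inl], rfl⟩
    · exact .inr ⟨(c, a), by simp [enc_prod, enc_inr], rfl⟩
  exact h₃.comp (f := fun a => (f a, a)) (by fun_prop)

@[fun_prop] theorem PT.cons {f : α → β} {g : α → List β} (hf : PT f) (hg : PT g) :
    PT fun a => f a :: g a :=
  PT.comp (.of_linear computes_cons) (hf.pair hg)

@[fun_prop] theorem PT.uncons {f : α → List β} (hf : PT f) : PT fun a => uncons (f a) :=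
  PT.comp (.of_linear computes_uncons) hf

/-- The predicate is decided by a stack program in polynomial time. -/
@[fun_prop] def PTPred (p : α → Prop) : Prop := PT fun a => @decide (p a) (Classical.propDecidable _)

theorem PTPred.congr {p q : α → Prop} (hp : PTPred p) (h : ∀ a, p a ↔ q a) : PTPred q := by
  obtain rfl : p = q := funext fun a => propext (h a)
  exact hp

theorem PTPred.eq {f g : α → β} (hf : PT f) (hg : PT g) : PTPred fun a => f a = g a := by
  have := PT.comp (.of_linear (computes_eq (α := β))) (hf.pair hg)
  convert! this

/-- The truth value is computed and placed in front of the input as its leading digit, on which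
`PT.branch` then acts. -/
theorem PT.ite {c : α → Prop} [DecidablePred c] {f g : α → β} (hc : PTPred c) (hf : PT f) (hg : PT g) :
    PT fun a => if c a then f a else g a := by
  have : PT fun p : Bool × α => if p.1 = true then f p.2 else g p.2 := by
    refine PT.branch (g := g) (h := f) (by fun_prop) (by fun_prop) fun ⟨x, a⟩ => ?_
    cases x
    · exact .inl ⟨a, by simp [enc_prod, enc_bool, Sym.ofBool], by simp⟩
    · exact .inr ⟨a, by simp [enc_prod, enc_bool, Sym.ofBool], by simp⟩
  have h₂ := this.comp (hc.pair PT.id)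
  simpa using h₂

theorem PTPred.not {p : α → Prop} (hp : PTPred p) : PTPred fun a => ¬p a := by
  classical
  have := PT.ite hp (PT.const false) (PT.const true)
  refine Eq.mp (congrArg PT (funext fun a => ?_)) this
  by_cases h : p a <;> simp [h]

theorem PTPred.and {p q : α → Prop} (hp : PTPred p) (hq : PTPred q) :
    PTPred fun a => p a ∧ q a := by
  classical
  have := PT.ite hp hq (PT.const false)
  refine Eq.mp (congrArg PT (funext fun a => ?_)) this
  by_cases h : p a <;> simp [h]

theorem PTPred.or {p q : α → Prop} (hp : PTPred p) (hq : PTPred q) :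
    PTPred fun a => p a ∨ q a := by
  classical
  have := PT.ite hp (PT.const true) hq
  refine Eq.mp (congrArg PT (funext fun a => ?_)) this
  by_cases h : p a <;> simp [h]

/-! ### Lists -/

theorem sz_nil : sz ([] : List α) = 2 := rfl

theorem sz_cons (a : α) (l : List α) : sz (a :: l) = sz a + sz l := by
  simp [sz, enc_list, encList]
  omega

theorem sz_append (l m : List α) : sz (l ++ m) + 2 = sz l + sz m := by
  induction l with
  | nil => simp [sz_nil]; omega
  | cons a l ih => simp only [List.cons_append, sz_cons]; omega

theorem sz_reverse (l : List α) : sz l.reverse = sz l := by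
  induction l with
  | nil => rfl
  | cons a l ih =>
    have := sz_append l.reverse [a]
    simp only [List.reverse_cons, sz_cons, sz_nil] at *
    omega

theorem sz_mem {a : α} {l : List α} (h : a ∈ l) : sz a ≤ sz l := by
  induction h with
  | head => rw [sz_cons]; omega
  | tail _ _ ih => rw [sz_cons]; omega

theorem length_le_sz (l : List α) : l.length ≤ sz l := by
  induction l with
  | nil => simp
  | cons a l ih =>
    have := sz_pos a
    rw [sz_cons, List.length_cons]
    omega

theorem sz_le_of_forall {l : List α} {n : ℕ} (h : ∀ a ∈ l, sz a ≤ n) : sz l ≤ 2 + l.length * n := by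
  induction l with
  | nil => simp [sz_nil]
  | cons a l ih =>
    have h₁ := h a (by simp)
    have h₂ := ih fun b hb => h b (by simp [hb])
    rw [sz_cons, List.length_cons, add_mul]
    omega

theorem sz_sublist {l m : List α} (h : l.Sublist m) : sz l ≤ sz m := by
  induction h with
  | slnil => rfl
  | cons a _ ih => rw [sz_cons]; omega
  | cons_cons a _ ih => rw [sz_cons, sz_cons]; omega

/-- A fold over a list, with an arbitrary bound on the length of the intermediate results. -/
theorem PT.foldl_bound {f : α → List β} {i : α → γ} {step : α → γ → β → γ} (hf : PT f) (hi : PT i)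
    (hs : PT fun p : α × γ × β => step p.1 p.2.1 p.2.2) :
    ∃ P, ∃ Q : Polynomial ℕ, ∀ S : α → ℕ,
      (∀ a l₁ l₂, f a = l₁ ++ l₂ → sz (l₁.foldl (step a) (i a)) ≤ S a) →
      Computes P (fun a => (f a).foldl (step a) (i a)) fun a => Q.eval (sz a + S a) := by
  have hs' : PT fun p : β × γ × α => step p.2.2 p.2.1 p.1 :=
    hs.comp (f := fun p : β × γ × α => (p.2.2, p.2.1, p.1)) (by fun_prop)
  have ht : PT fun a => (f a, i a, a) := by fun_prop
  obtain ⟨q, hq⟩ := ht.sz_le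
  obtain ⟨P, p, hP⟩ := ht
  obtain ⟨P', p', hP'⟩ := hs'
  -- The bound used here is the sharpest one, the maximum over all prefixes. Thus the program and
  -- `Q` are fixed before `S` is given, and `S` need not be polynomial.
  obtain ⟨K, hK⟩ := computes_foldl (eval_mono p') hP'
    (S := fun a => (Finset.range (a.1.length + 1)).sup fun n =>
      sz ((a.1.take n).foldl (fun g b => step a.2.2 g b) a.2.1)) (by
    intro a l₁ l₂ h
    have : l₁ = a.1.take l₁.length := by simp [h]
    conv_lhs => rw [this]
    refine Finset.le_sup (f := fun n => sz ((a.1.take n).foldl (fun g b => step a.2.2 g b) a.2.1))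
      ?_
    simp [h])
  refine ⟨fun r => .seq (P r) (foldProg γ β P' r),
    p + (.C K * (q + .X) + .C K) * ((q + .X) + p'.comp (q + .X) + .C 1), fun S hS => ?_⟩
  refine (hK.comp hP).mono fun a => ?_
  have h₁ : ((Finset.range ((f a).length + 1)).sup fun n =>
      sz (((f a).take n).foldl (fun g b => step a g b) (i a))) ≤ S a :=
    Finset.sup_le fun n _ => hS a _ ((f a).drop n) (by simp)
  have h₂ := hq a
  simp only [Polynomial.eval_add, Polynomial.eval_mul, Polynomial.eval_C, Polynomial.eval_X,
    Polynomial.eval_comp]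
  have h₃ := eval_mono p (show sz a ≤ sz a + S a by omega)
  have h₄ := eval_mono q (show sz a ≤ sz a + S a by omega)
  have h₅ : sz (f a, i a, a) + ((Finset.range ((f a).length + 1)).sup fun n =>
      sz (((f a).take n).foldl (fun g b => step a g b) (i a))) ≤
      q.eval (sz a + S a) + (sz a + S a) := by
    dsimp only at h₄
    omega
  have h₆ := eval_mono p' h₅
  dsimp only at h₃ h₆ ⊢
  gcongr

/-- A polynomial-time step can double its argument, so iterating it may lead to exponential size;
the hypothesis `hb` excludes this. -/
theorem PT.foldl {f : α → List β} {i : α → γ} {step : α → γ → β → γ} (hf : PT f) (hi : PT i)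
    (hs : PT fun p : α × γ × β => step p.1 p.2.1 p.2.2)
    (hb : ∃ q : Polynomial ℕ, ∀ a l₁ l₂, f a = l₁ ++ l₂ →
      sz (l₁.foldl (step a) (i a)) ≤ q.eval (sz a)) :
    PT fun a => (f a).foldl (step a) (i a) := by
  obtain ⟨P, Q, h⟩ := PT.foldl_bound hf hi hs
  obtain ⟨q, hq⟩ := hb
  exact ⟨P, Q.comp (.X + q), (h _ hq).mono fun a => by simp⟩

@[fun_prop] theorem PT.reverse {f : α → List β} (hf : PT f) : PT fun a => (f a).reverse := by
  have : PT fun l : List β => l.foldl (fun m b => b :: m) [] := by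
    refine PT.foldl (step := fun _ m b => b :: m) PT.id (PT.const []) (by fun_prop)
      ⟨.X, fun l l₁ l₂ h => ?_⟩
    have : l₁.foldl (fun m b => b :: m) [] = l₁.reverse := by simp
    rw [this, sz_reverse, h, Polynomial.eval_X]
    exact sz_sublist (by simp)
  refine PT.comp (g := List.reverse) ?_ hf
  simpa using this

@[fun_prop] theorem PT.append {f g : α → List β} (hf : PT f) (hg : PT g) :
    PT fun a => f a ++ g a := by
  have : PT fun l : List β × List β => l.1.reverse.foldl (fun m b => b :: m) l.2 := by
    refine PT.foldl (step := fun _ m b => b :: m) (by fun_prop) (by fun_prop) (by fun_prop)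
      ⟨.X, fun l l₁ l₂ h => ?_⟩
    have : l₁.foldl (fun m b => b :: m) l.2 = l₁.reverse ++ l.2 := by simp
    have h₁ := sz_append l₁.reverse l.2
    have h₂ : sz l₁ ≤ sz l.1.reverse := by
      rw [h]
      exact sz_sublist (by simp)
    rw [sz_reverse] at h₁ h₂
    rw [this, Polynomial.eval_X, sz_prod]
    omega
  have h₂ := this.comp (hf.pair hg)
  simpa using h₂

/-- The partial results are bounded by the number of entries times the largest size of some `g a b`,
and both factors are polynomial. -/
theorem PT.flatMap {f : α → List β} {g : α → β → List γ} (hf : PT f)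
    (hg : PT fun p : α × β => g p.1 p.2) : PT fun a => (f a).flatMap (g a) := by
  have key : ∀ a (l : List β) (i : List γ),
      l.foldl (fun m b => m ++ g a b) i = i ++ l.flatMap (g a) := by
    intro a l
    induction l with
    | nil => simp
    | cons b l ih => intro i; simp [ih]
  have : PT fun a => (f a).foldl (fun m b => m ++ g a b) [] := by
    have hg' : PT fun p : α × List γ × β => g p.1 p.2.2 :=
      hg.comp (f := fun p : α × List γ × β => (p.1, p.2.2)) (by fun_prop)
    obtain ⟨q, hq⟩ := hg.sz_le
    obtain ⟨r, hr⟩ := hf.sz_le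
    refine PT.foldl (step := fun a m b => m ++ g a b) hf (by fun_prop) (by fun_prop)
      ⟨.C 2 + r * q.comp (.X + r), fun a l₁ l₂ h => ?_⟩
    have h₁ : ∀ b ∈ l₁, sz (g a b) ≤ q.eval (sz a + r.eval (sz a)) := fun b hb =>
      (hq (a, b)).trans (eval_mono q (by
        rw [sz_prod]
        have := (sz_mem (show b ∈ f a by simp [h, hb])).trans (hr a)
        simpa using this))
    have h₂ : l₁.length ≤ r.eval (sz a) := by
      have := (length_le_sz (f a)).trans (hr a)
      rw [h, List.length_append] at this
      omega
    rw [key, List.nil_append]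
    simp only [Polynomial.eval_add, Polynomial.eval_mul, Polynomial.eval_C, Polynomial.eval_X,
      Polynomial.eval_comp]
    refine le_trans ?_ (Nat.add_le_add_left (Nat.mul_le_mul_right _ h₂) _)
    clear h h₂
    induction l₁ with
    | nil => simp [sz_nil]
    | cons b l ih =>
      have h₃ := ih fun c hc => h₁ c (by simp [hc])
      have h₄ := h₁ b (by simp)
      have h₅ := sz_append (g a b) (l.flatMap (g a))
      rw [List.flatMap_cons, List.length_cons, add_mul]
      omega
  refine Eq.mp (congrArg PT (funext fun a => ?_)) this
  rw [key, List.nil_append]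

theorem PT.map {f : α → List β} {g : α → β → γ} (hf : PT f)
    (hg : PT fun p : α × β => g p.1 p.2) : PT fun a => (f a).map (g a) := by
  have := PT.flatMap (g := fun a b => [g a b]) hf (by fun_prop)
  refine Eq.mp (congrArg PT (funext fun a => ?_)) this
  rw [List.map_eq_flatMap]

theorem PT.filter {f : α → List β} {c : α → β → Prop} [∀ a, DecidablePred (c a)] (hf : PT f)
    (hc : PTPred fun p : α × β => c p.1 p.2) : PT fun a => (f a).filter (c a ·) := by
  classical
  have := PT.flatMap (g := fun a b => if c a b then [b] else []) hf
    (PT.ite hc (by fun_prop) (by fun_prop))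
  refine Eq.mp (congrArg PT (funext fun a => ?_)) this
  induction f a with
  | nil => rfl
  | cons b l ih =>
    rw [List.flatMap_cons, ih, List.filter_cons]
    by_cases h : c a b <;> simp [h]

theorem PTPred.exists_mem {f : α → List β} {c : α → β → Prop} (hf : PT f)
    (hc : PTPred fun p : α × β => c p.1 p.2) : PTPred fun a => ∃ b ∈ f a, c a b :=
  open Classical in (PTPred.eq (PT.filter hf hc) (PT.const [])).not.congr fun a => by simp

theorem PTPred.forall_mem {f : α → List β} {c : α → β → Prop} (hf : PT f)
    (hc : PTPred fun p : α × β => c p.1 p.2) : PTPred fun a => ∀ b ∈ f a, c a b :=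
  (PTPred.exists_mem (c := fun a b => ¬c a b) hf hc.not).not.congr fun a => by simp

theorem PTPred.mem {f : α → β} {g : α → List β} (hf : PT f) (hg : PT g) :
    PTPred fun a => f a ∈ g a :=
  (PTPred.exists_mem (c := fun a b => f a = b) hg (PTPred.eq (by fun_prop) (by fun_prop))).congr
    fun a => by simp

theorem PT.product {f : α → List β} {g : α → List γ} (hf : PT f) (hg : PT g) :
    PT fun a => (f a).product (g a) :=
  PT.flatMap (g := fun a b => (g a).map (Prod.mk b)) hf
    (PT.map (f := fun p : α × β => g p.1) (g := fun p c => (p.2, c)) (by fun_prop) (by fun_prop))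

/-! ### Reachability -/

/-- One step of the computation of the reachability relation: the edge `e` is added to a graph. -/
noncomputable def addEdge (U : List (β × β)) (m : List (β × β)) (e : β × β) : List (β × β) :=
  open Classical in U.filter fun p => p ∈ m ∨ ((p.1, e.1) ∈ m ∧ (e.2, p.2) ∈ m)

/-- The pairs in `U × U` that are connected by a path with edges in `l`. -/
noncomputable def reachPairs (U : List β) (l : List (β × β)) : List (β × β) :=
  open Classical in
  l.foldl (addEdge (U.product U)) ((U.product U).filter fun p => p.1 = p.2)

/-- Every intermediate list is a filter of the fixed list `U × U`, so the fold cannot blow up. -/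
theorem PT.reachPairs {f : α → List β} {g : α → List (β × β)} (hf : PT f) (hg : PT g) :
    PT fun a => reachPairs (f a) (g a) := by
  classical
  have hp := PT.product hf hf
  obtain ⟨q, hq⟩ := hp.sz_le
  refine PT.foldl (step := fun a => addEdge ((f a).product (f a))) hg
    (PT.filter (c := fun _ p => p.1 = p.2) hp (PTPred.eq (by fun_prop) (by fun_prop))) ?_
    ⟨q, fun a l₁ l₂ _ => ?_⟩
  · unfold addEdge
    refine PT.filter (f := fun p : α × List (β × β) × (β × β) => (f p.1).product (f p.1))
      (c := fun p b => b ∈ p.2.1 ∨ ((b.1, p.2.2.1) ∈ p.2.1 ∧ (p.2.2.2, b.2) ∈ p.2.1))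
      (hp.comp (by fun_prop)) ?_
    exact (PTPred.mem (by fun_prop) (by fun_prop)).or
      ((PTPred.mem (by fun_prop) (by fun_prop)).and (PTPred.mem (by fun_prop) (by fun_prop)))
  · refine (sz_sublist ?_).trans (hq a)
    rcases l₁.eq_nil_or_concat with rfl | ⟨l, e, rfl⟩
    · exact List.filter_sublist
    · rw [List.concat_eq_append, List.foldl_append]
      exact List.filter_sublist

/-- A path that uses the new edge is cut at its first and at its last use; the outer pieces consist
of old edges. -/
theorem reflTransGen_add_edge {ι : Type} {r : ι → ι → Prop} {u v x y : ι} :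
    Relation.ReflTransGen (fun a b => r a b ∨ (a = u ∧ b = v)) x y ↔
      Relation.ReflTransGen r x y ∨
        (Relation.ReflTransGen r x u ∧ Relation.ReflTransGen r v y) := by
  constructor
  · intro h
    induction h with
    | refl => exact .inl .refl
    | tail _ hbc ih =>
      rcases hbc with hbc | ⟨rfl, rfl⟩
      · exact ih.imp (·.tail hbc) fun h => ⟨h.1, h.2.tail hbc⟩
      · exact .inr ⟨ih.elim id (·.1), .refl⟩
  · rintro (h | ⟨h₁, h₂⟩)
    · exact .mono (fun _ _ => .inl) _ _ h
    · exact (Relation.ReflTransGen.tail (.mono (fun _ _ => .inl) _ _ h₁)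
        (.inr ⟨rfl, rfl⟩)).trans (.mono (fun _ _ => .inl) _ _ h₂)

/-- After each step of the fold the list is the reachability relation on `U` of the edges treated so
far. The ends of the edges must lie in `U`, since the pairs that lead to and from the new edge are
looked up there. -/
theorem mem_reachPairs {ι : Type} {U : List ι} {l : List (ι × ι)} (h : ∀ e ∈ l, e.1 ∈ U ∧ e.2 ∈ U) (x y : ι) :
    (x, y) ∈ reachPairs U l ↔
      x ∈ U ∧ y ∈ U ∧ Relation.ReflTransGen (fun a b => (a, b) ∈ l) x y := by
  classical
  induction l using List.reverseRecOn generalizing x y with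
  | nil =>
    have : (fun a b : ι => (a, b) ∈ ([] : List (ι × ι))) = fun _ _ => False := by
      funext a b; simp
    simp only [reachPairs, List.foldl_nil, List.mem_filter, List.pair_mem_product,
      decide_eq_true_eq, this, and_assoc]
    refine and_congr_right fun _ => and_congr_right fun _ => ⟨fun h => h ▸ .refl, fun h => ?_⟩
    rcases h.cases_head with h | ⟨_, h, _⟩
    · exact h
    · exact h.elim
  | append_singleton l e ih =>
    have ih := ih fun e he => h e (by simp [he])
    have he := h e (by simp)
    have h₁ : (fun a b => (a, b) ∈ l ++ [e]) = fun a b => (a, b) ∈ l ∨ (a = e.1 ∧ b = e.2) := by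
      funext a b
      simp [Prod.ext_iff]
    rw [reachPairs, List.foldl_append, List.foldl_cons, List.foldl_nil, ← reachPairs, addEdge,
      List.mem_filter, List.pair_mem_product, h₁, reflTransGen_add_edge]
    simp only [ih, decide_eq_true_eq]
    tauto

/-- Reachability in a graph that is given by the list of its edges. -/
theorem PTPred.reach {f : α → List (β × β)} {x y : α → β} (hf : PT f) (hx : PT x) (hy : PT y) :
    PTPred fun a => Relation.ReflTransGen (fun u v => (u, v) ∈ f a) (x a) (y a) := by
  -- The two points are added to the ends of the edges, because an isolated point still reaches
  -- itself.
  have hU : PT fun a => x a :: y a :: ((f a).map (fun e => e.1) ++ (f a).map (fun e => e.2)) :=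
    hx.cons (hy.cons ((PT.map (g := fun _ e => e.1) hf (by fun_prop)).append
      (PT.map (g := fun _ e => e.2) hf (by fun_prop))))
  refine (PTPred.mem (hx.pair hy) (PT.reachPairs hU hf)).congr fun a => ?_
  rw [mem_reachPairs]
  · simp
  · intro e he
    simp only [List.mem_cons, List.mem_append, List.mem_map]
    exact ⟨.inr (.inr (.inl ⟨e, he, rfl⟩)), .inr (.inr (.inr ⟨e, he, rfl⟩))⟩

end PolyTime

/-! ## Encodings of ontologies, mappings and instances -/

def BasicRole.toSum : BasicRole → Name ⊕ Name
  | .atom P => .inl P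
  | .inv P => .inr P

instance : Enc BasicRole := .ofInjective BasicRole.toSum fun a b h => by
  cases a <;> cases b <;> simp_all [BasicRole.toSum]

def BasicConcept.toSum : BasicConcept → Name ⊕ BasicRole
  | .atom A => .inl A
  | .ex R => .inr R

instance : Enc BasicConcept := .ofInjective BasicConcept.toSum fun a b h => by
  cases a <;> cases b <;> simp_all [BasicConcept.toSum]

def ConceptExpr.toSum : ConceptExpr → BasicConcept ⊕ BasicConcept
  | .pos B => .inl B
  | .neg B => .inr B

instance : Enc ConceptExpr := .ofInjective ConceptExpr.toSum fun a b h => by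
  cases a <;> cases b <;> simp_all [ConceptExpr.toSum]

def RoleExpr.toSum : RoleExpr → BasicRole ⊕ BasicRole
  | .pos R => .inl R
  | .neg R => .inr R

instance : Enc RoleExpr := .ofInjective RoleExpr.toSum fun a b h => by
  cases a <;> cases b <;> simp_all [RoleExpr.toSum]

def TBoxAxiom.toSum : TBoxAxiom → (BasicConcept × ConceptExpr) ⊕ (BasicRole × RoleExpr)
  | .concept B C => .inl (B, C)
  | .role R E => .inr (R, E)

instance : Enc TBoxAxiom := .ofInjective TBoxAxiom.toSum fun a b h => by
  cases a <;> cases b <;> simp_all [TBoxAxiom.toSum]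

def Head.toSum : Head → (Name × Name) ⊕ (Name × Name × Name)
  | .concept A x => .inl (A, x)
  | .role P x y => .inr (P, x, y)

instance : Enc Head := .ofInjective Head.toSum fun a b h => by
  cases a <;> cases b <;> simp_all [Head.toSum]

instance : Enc ℕ := .ofInjective Nat.bits fun a b h => by
  have h' := congrArg (List.map fun b => cond b 1 0) h
  rw [← Nat.digits_two_eq_bits, ← Nat.digits_two_eq_bits] at h'
  exact Nat.digits_inj_iff.1 h'

section

variable {Const : Type} [Enc Const]

def Term.toSum : Term Const → Name ⊕ Const
  | .var x => .inl x
  | .const c => .inr c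

instance : Enc (Term Const) := .ofInjective Term.toSum fun a b h => by
  cases a <;> cases b <;> simp_all [Term.toSum]

def Atom.toProd (a : Atom Const) : Name × List (Term Const) := (a.rel, a.args)

instance : Enc (Atom Const) := .ofInjective Atom.toProd fun a b h => by
  cases a; cases b; simp_all [Atom.toProd]

def Mapping.toProd (m : Mapping Const) : List (Atom Const) × Head := (m.body, m.head)

instance : Enc (Mapping Const) := .ofInjective Mapping.toProd fun a b h => by
  cases a; cases b; simp_all [Mapping.toProd]

def Fact.toProd (f : Fact Const) : Name × List Const := (f.rel, f.args)

instance : Enc (Fact Const) := .ofInjective Fact.toProd fun a b h => by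
  cases a; cases b; simp_all [Fact.toProd]

end

/-! ### Constructors and projections in polynomial time -/

section Projections

variable {Const α β γ δ : Type} [Enc Const] [Enc α] [Enc β] [Enc γ] [Enc δ]

theorem PT.of_eq {f g : α → β} (hf : PT f) (h : ∀ a, f a = g a) : PT g :=
  funext h ▸ hf

/-- Programs see only encodings, so passing between a type and the sum or product that encodes it
costs nothing. -/
theorem PT.congr_enc {f : α → β} {g : α → γ} (hf : PT f) (h : ∀ a, enc (g a) = enc (f a)) : PT g :=
  let ⟨P, p, hP⟩ := hf
  ⟨P, p, fun r s a hs he => by rw [h]; exact hP r s a hs he⟩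

@[fun_prop] theorem PT.roleAtom {f : α → Name} (hf : PT f) : PT fun a => BasicRole.atom (f a) :=
  (PT.inl (γ := Name) hf).congr_enc fun _ => rfl

@[fun_prop] theorem PT.roleInv {f : α → Name} (hf : PT f) : PT fun a => BasicRole.inv (f a) :=
  (PT.inr (β := Name) hf).congr_enc fun _ => rfl

@[fun_prop] theorem PT.roleToSum {f : α → BasicRole} (hf : PT f) : PT fun a => (f a).toSum :=
  hf.congr_enc fun _ => rfl

@[fun_prop] theorem PT.conceptAtom {f : α → Name} (hf : PT f) :
    PT fun a => BasicConcept.atom (f a) :=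
  (PT.inl (γ := BasicRole) hf).congr_enc fun _ => rfl

@[fun_prop] theorem PT.conceptEx {f : α → BasicRole} (hf : PT f) :
    PT fun a => BasicConcept.ex (f a) :=
  (PT.inr (β := Name) hf).congr_enc fun _ => rfl

@[fun_prop] theorem PT.conceptToSum {f : α → BasicConcept} (hf : PT f) : PT fun a => (f a).toSum :=
  hf.congr_enc fun _ => rfl

@[fun_prop] theorem PT.conceptExprToSum {f : α → ConceptExpr} (hf : PT f) :
    PT fun a => (f a).toSum :=
  hf.congr_enc fun _ => rfl

@[fun_prop] theorem PT.roleExprToSum {f : α → RoleExpr} (hf : PT f) : PT fun a => (f a).toSum :=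
  hf.congr_enc fun _ => rfl

@[fun_prop] theorem PT.axiomToSum {f : α → TBoxAxiom} (hf : PT f) : PT fun a => (f a).toSum :=
  hf.congr_enc fun _ => rfl

@[fun_prop] theorem PT.headToSum {f : α → Head} (hf : PT f) : PT fun a => (f a).toSum :=
  hf.congr_enc fun _ => rfl

@[fun_prop] theorem PT.termToSum {f : α → Term Const} (hf : PT f) : PT fun a => (f a).toSum :=
  hf.congr_enc fun _ => rfl

theorem PT.atomToProd {f : α → Atom Const} (hf : PT f) : PT fun a => (f a).toProd :=
  hf.congr_enc fun _ => rfl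

@[fun_prop] theorem PT.atomRel {f : α → Atom Const} (hf : PT f) : PT fun a => (f a).rel :=
  hf.atomToProd.fst

@[fun_prop] theorem PT.atomArgs {f : α → Atom Const} (hf : PT f) : PT fun a => (f a).args :=
  hf.atomToProd.snd

theorem PT.mappingToProd {f : α → Mapping Const} (hf : PT f) : PT fun a => (f a).toProd :=
  hf.congr_enc fun _ => rfl

@[fun_prop] theorem PT.mappingBody {f : α → Mapping Const} (hf : PT f) : PT fun a => (f a).body :=
  hf.mappingToProd.fst

@[fun_prop] theorem PT.mappingHead {f : α → Mapping Const} (hf : PT f) : PT fun a => (f a).head :=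
  hf.mappingToProd.snd

theorem PT.factToProd {f : α → Fact Const} (hf : PT f) : PT fun a => (f a).toProd :=
  hf.congr_enc fun _ => rfl

@[fun_prop] theorem PT.factRel {f : α → Fact Const} (hf : PT f) : PT fun a => (f a).rel :=
  hf.factToProd.fst

@[fun_prop] theorem PT.factArgs {f : α → Fact Const} (hf : PT f) : PT fun a => (f a).args :=
  hf.factToProd.snd

end Projections

/-! ## Reasoning in the TBox -/

/-- The inverse role. -/
def BasicRole.inverse : BasicRole → BasicRole
  | .atom P => .inv P
  | .inv P => .atom P

/-- The role inclusions of an axiom, with their inverses. -/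
def TBoxAxiom.roleEdges : TBoxAxiom → List (BasicRole × BasicRole)
  | .role R (.pos S) => [(R, S), (R.inverse, S.inverse)]
  | _ => []

/-- The role disjointness statements of an axiom, with their inverses. -/
def TBoxAxiom.roleDisjoint : TBoxAxiom → List (BasicRole × BasicRole)
  | .role R (.neg S) => [(R, S), (R.inverse, S.inverse)]
  | _ => []

/-- The concept inclusions of an axiom. -/
def TBoxAxiom.conceptEdges : TBoxAxiom → List (BasicConcept × BasicConcept)
  | .concept B (.pos D) => [(B, D)]
  | _ => []

/-- The concept disjointness statements of an axiom. -/
def TBoxAxiom.conceptDisjoint : TBoxAxiom → List (BasicConcept × BasicConcept)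
  | .concept B (.neg D) => [(B, D)]
  | _ => []

/-- The basic concepts that occur in an axiom. -/
def TBoxAxiom.concepts : TBoxAxiom → List BasicConcept
  | .concept B C => [B, C.base]
  | .role _ _ => []

/-- The role `R` of a concept `∃R`. -/
def BasicConcept.exRole : BasicConcept → List BasicRole
  | .atom _ => []
  | .ex R => [R]

namespace TBox

variable (T : TBox)

def roleEdges : List (BasicRole × BasicRole) := T.flatMap (·.roleEdges)

def roleDisjoint : List (BasicRole × BasicRole) := T.flatMap (·.roleDisjoint)

/-- The concept inclusions that follow from the axioms one by one. -/
def conceptEdges : List (BasicConcept × BasicConcept) :=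
  T.flatMap (·.conceptEdges) ++ (roleEdges T).map fun p => (.ex p.1, .ex p.2)

def conceptDisjoint : List (BasicConcept × BasicConcept) := T.flatMap (·.conceptDisjoint)

def concepts : List BasicConcept := T.flatMap (·.concepts)

/-- The roles `R` such that `∃R` or `∃R⁻` matters for the satisfiability of concepts. -/
def roles : List BasicRole :=
  ((conceptEdges T ++ conceptDisjoint T).flatMap fun p => p.1.exRole ++ p.2.exRole) ++
    (roleDisjoint T).flatMap fun p => [p.1, p.2]

/-- The concept inclusions, and the edges from `∃R` to `∃R⁻`. -/
def jumpEdges : List (BasicConcept × BasicConcept) :=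
  conceptEdges T ++ (roles T).flatMap fun R =>
    [(.ex R, .ex R.inverse), (.ex R.inverse, .ex R)]

/-- Reachability by role inclusions. -/
def RoleReach : BasicRole → BasicRole → Prop :=
  Relation.ReflTransGen fun R S => (R, S) ∈ roleEdges T

/-- Reachability by concept inclusions. -/
def ConceptReach : BasicConcept → BasicConcept → Prop :=
  Relation.ReflTransGen fun B D => (B, D) ∈ conceptEdges T

/-- The second concept is not empty if the first one is not. -/
def JumpReach : BasicConcept → BasicConcept → Prop :=
  Relation.ReflTransGen fun B D => (B, D) ∈ jumpEdges T

/-- A common element of both concepts would violate a disjointness axiom. The relation need not be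
symmetric, which is harmless because it is tested on all ordered pairs of concepts of an element. -/
def ConceptClash (B D : BasicConcept) : Prop :=
  ∃ p ∈ conceptDisjoint T, ConceptReach T B p.1 ∧ ConceptReach T D p.2

def RoleClash (R S : BasicRole) : Prop :=
  ∃ p ∈ roleDisjoint T, RoleReach T R p.1 ∧ RoleReach T S p.2

/-- The concept cannot have elements, as they would violate a disjointness axiom. -/
def Clash (B : BasicConcept) : Prop :=
  ConceptClash T B B ∨ ∃ R ∈ B.exRole, RoleClash T R R

/-- All concepts that occur in what follows from the axioms. -/
def vertices : List BasicConcept :=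
  (conceptEdges T ++ conceptDisjoint T).flatMap (fun p => [p.1, p.2]) ++
    (roles T).flatMap fun R => [.ex R, .ex R.inverse]

/-- The concept is empty in all models of the TBox. -/
def Unsat (B : BasicConcept) : Prop := ∃ D ∈ vertices T, JumpReach T B D ∧ Clash T D

end TBox

/-! ### TBox reasoning in polynomial time -/

section

variable {α : Type} [Enc α]

@[fun_prop] theorem PT.roleInverse {f : α → BasicRole} (hf : PT f) :
    PT fun a => (f a).inverse :=
  (PT.sumElim (g := fun _ P => BasicRole.inv P) (h := fun _ P => BasicRole.atom P) hf.roleToSum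
    (by fun_prop) (by fun_prop)).of_eq fun a => by cases f a <;> rfl

@[fun_prop] theorem PT.axiomRoleEdges {f : α → TBoxAxiom} (hf : PT f) :
    PT fun a => (f a).roleEdges :=
  (PT.sumElim (g := fun _ _ => []) (h := fun _ p => Sum.elim
      (fun S => [(p.1, S), (p.1.inverse, S.inverse)]) (fun _ => []) p.2.toSum)
    hf.axiomToSum (by fun_prop) (PT.sumElim
      (f := fun p : α × BasicRole × RoleExpr => p.2.2.toSum)
      (g := fun p S => [(p.2.1, S), (p.2.1.inverse, S.inverse)]) (h := fun _ _ => [])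
      (by fun_prop) (by fun_prop) (by fun_prop))).of_eq fun a => by
    rcases f a with ⟨_, _⟩ | ⟨_, _ | _⟩ <;> rfl

@[fun_prop] theorem PT.axiomRoleDisjoint {f : α → TBoxAxiom} (hf : PT f) :
    PT fun a => (f a).roleDisjoint :=
  (PT.sumElim (g := fun _ _ => []) (h := fun _ p => Sum.elim (fun _ => [])
      (fun S => [(p.1, S), (p.1.inverse, S.inverse)]) p.2.toSum)
    hf.axiomToSum (by fun_prop) (PT.sumElim
      (f := fun p : α × BasicRole × RoleExpr => p.2.2.toSum) (g := fun _ _ => [])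
      (h := fun p S => [(p.2.1, S), (p.2.1.inverse, S.inverse)])
      (by fun_prop) (by fun_prop) (by fun_prop))).of_eq fun a => by
    rcases f a with ⟨_, _⟩ | ⟨_, _ | _⟩ <;> rfl

@[fun_prop] theorem PT.axiomConceptEdges {f : α → TBoxAxiom} (hf : PT f) :
    PT fun a => (f a).conceptEdges :=
  (PT.sumElim (h := fun _ _ => []) (g := fun _ p => Sum.elim
      (fun D => [(p.1, D)]) (fun _ => []) p.2.toSum)
    hf.axiomToSum (PT.sumElim (f := fun p : α × BasicConcept × ConceptExpr => p.2.2.toSum)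
      (g := fun p D => [(p.2.1, D)]) (h := fun _ _ => [])
      (by fun_prop) (by fun_prop) (by fun_prop)) (by fun_prop)).of_eq fun a => by
    rcases f a with ⟨_, _ | _⟩ | ⟨_, _⟩ <;> rfl

@[fun_prop] theorem PT.axiomConceptDisjoint {f : α → TBoxAxiom} (hf : PT f) :
    PT fun a => (f a).conceptDisjoint :=
  (PT.sumElim (h := fun _ _ => []) (g := fun _ p => Sum.elim (fun _ => [])
      (fun D => [(p.1, D)]) p.2.toSum)
    hf.axiomToSum (PT.sumElim (f := fun p : α × BasicConcept × ConceptExpr => p.2.2.toSum)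
      (g := fun _ _ => []) (h := fun p D => [(p.2.1, D)])
      (by fun_prop) (by fun_prop) (by fun_prop)) (by fun_prop)).of_eq fun a => by
    rcases f a with ⟨_, _ | _⟩ | ⟨_, _⟩ <;> rfl

@[fun_prop] theorem PT.axiomConcepts {f : α → TBoxAxiom} (hf : PT f) :
    PT fun a => (f a).concepts :=
  (PT.sumElim (h := fun _ _ => []) (g := fun _ p => Sum.elim (fun D => [p.1, D])
      (fun D => [p.1, D]) p.2.toSum)
    hf.axiomToSum (PT.sumElim (f := fun p : α × BasicConcept × ConceptExpr => p.2.2.toSum)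
      (g := fun p D => [p.2.1, D]) (h := fun p D => [p.2.1, D])
      (by fun_prop) (by fun_prop) (by fun_prop)) (by fun_prop)).of_eq fun a => by
    rcases f a with ⟨_, _ | _⟩ | ⟨_, _⟩ <;> rfl

@[fun_prop] theorem PT.exRole {f : α → BasicConcept} (hf : PT f) : PT fun a => (f a).exRole :=
  (PT.sumElim (g := fun _ _ => []) (h := fun _ R => [R]) hf.conceptToSum
    (by fun_prop) (by fun_prop)).of_eq fun a => by cases f a <;> rfl

variable {T : α → TBox}

@[fun_prop] theorem PT.roleEdges (hT : PT T) : PT fun a => TBox.roleEdges (T a) :=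
  PT.flatMap (g := fun _ x => TBoxAxiom.roleEdges x) hT (by fun_prop)

@[fun_prop] theorem PT.roleDisjoint (hT : PT T) : PT fun a => TBox.roleDisjoint (T a) :=
  PT.flatMap (g := fun _ x => TBoxAxiom.roleDisjoint x) hT (by fun_prop)

@[fun_prop] theorem PT.conceptDisjoint (hT : PT T) : PT fun a => TBox.conceptDisjoint (T a) :=
  PT.flatMap (g := fun _ x => TBoxAxiom.conceptDisjoint x) hT (by fun_prop)

@[fun_prop] theorem PT.concepts (hT : PT T) : PT fun a => TBox.concepts (T a) :=
  PT.flatMap (g := fun _ x => TBoxAxiom.concepts x) hT (by fun_prop)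

@[fun_prop] theorem PT.conceptEdges (hT : PT T) : PT fun a => TBox.conceptEdges (T a) :=
  (PT.flatMap (g := fun _ x => TBoxAxiom.conceptEdges x) hT (by fun_prop)).append
    (PT.map (g := fun _ p => (BasicConcept.ex p.1, BasicConcept.ex p.2)) hT.roleEdges (by fun_prop))

@[fun_prop] theorem PT.roles (hT : PT T) : PT fun a => TBox.roles (T a) :=
  (PT.flatMap (f := fun a => TBox.conceptEdges (T a) ++ TBox.conceptDisjoint (T a))
    (g := fun _ p => BasicConcept.exRole p.1 ++ BasicConcept.exRole p.2)
    (hT.conceptEdges.append hT.conceptDisjoint) (by fun_prop)).append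
    (PT.flatMap (f := fun a => TBox.roleDisjoint (T a)) (g := fun _ p => [p.1, p.2])
      hT.roleDisjoint (by fun_prop))

@[fun_prop] theorem PT.jumpEdges (hT : PT T) : PT fun a => TBox.jumpEdges (T a) :=
  hT.conceptEdges.append (PT.flatMap (g := fun _ R => [(BasicConcept.ex R,
    BasicConcept.ex R.inverse), (BasicConcept.ex R.inverse, BasicConcept.ex R)]) hT.roles
    (by fun_prop))

@[fun_prop] theorem PT.vertices (hT : PT T) : PT fun a => TBox.vertices (T a) :=
  (PT.flatMap (f := fun a => TBox.conceptEdges (T a) ++ TBox.conceptDisjoint (T a))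
    (g := fun _ p => [p.1, p.2]) (hT.conceptEdges.append hT.conceptDisjoint)
    (by fun_prop)).append (PT.flatMap (f := fun a => TBox.roles (T a))
      (g := fun _ R => [BasicConcept.ex R, BasicConcept.ex R.inverse]) hT.roles (by fun_prop))

theorem PTPred.conceptClash {B D : α → BasicConcept} (hT : PT T) (hB : PT B) (hD : PT D) :
    PTPred fun a => TBox.ConceptClash (T a) (B a) (D a) :=
  PTPred.exists_mem hT.conceptDisjoint
    ((PTPred.reach (f := fun p : α × BasicConcept × BasicConcept => TBox.conceptEdges (T p.1))
      (x := fun p => B p.1) (y := fun p => p.2.1) (by fun_prop) (by fun_prop) (by fun_prop)).and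
    (PTPred.reach (f := fun p : α × BasicConcept × BasicConcept => TBox.conceptEdges (T p.1))
      (x := fun p => D p.1) (y := fun p => p.2.2) (by fun_prop) (by fun_prop) (by fun_prop)))

theorem PTPred.roleClash {R S : α → BasicRole} (hT : PT T) (hR : PT R) (hS : PT S) :
    PTPred fun a => TBox.RoleClash (T a) (R a) (S a) :=
  PTPred.exists_mem hT.roleDisjoint
    ((PTPred.reach (f := fun p : α × BasicRole × BasicRole => TBox.roleEdges (T p.1))
      (x := fun p => R p.1) (y := fun p => p.2.1) (by fun_prop) (by fun_prop) (by fun_prop)).and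
    (PTPred.reach (f := fun p : α × BasicRole × BasicRole => TBox.roleEdges (T p.1))
      (x := fun p => S p.1) (y := fun p => p.2.2) (by fun_prop) (by fun_prop) (by fun_prop)))

theorem PTPred.unsat {B : α → BasicConcept} (hT : PT T) (hB : PT B) :
    PTPred fun a => TBox.Unsat (T a) (B a) :=
  PTPred.exists_mem hT.vertices
    ((PTPred.reach (f := fun p : α × BasicConcept => TBox.jumpEdges (T p.1))
      (x := fun p => B p.1) (y := fun p => p.2) (by fun_prop) (by fun_prop) (by fun_prop)).and
    ((PTPred.conceptClash (by fun_prop) (by fun_prop) (by fun_prop)).or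
      (PTPred.exists_mem (f := fun p : α × BasicConcept => p.2.exRole)
        (c := fun p R => TBox.RoleClash (T p.1) R R) (by fun_prop)
        (PTPred.roleClash (by fun_prop) (by fun_prop) (by fun_prop)))))

/-- The list of all pairs in the subsumption relation on the concepts of the TBox. -/
noncomputable def TBox.subsumptions (T : TBox) : List (BasicConcept × BasicConcept) :=
  open Classical in
  ((concepts T).product (concepts T)).filter fun p => ConceptReach T p.1 p.2 ∨ Unsat T p.1

theorem PT.subsumptions (hT : PT T) : PT fun a => TBox.subsumptions (T a) := by
  classical
  unfold TBox.subsumptions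
  refine PT.filter (c := fun a p => TBox.ConceptReach (T a) p.1 p.2 ∨ TBox.Unsat (T a) p.1)
    (PT.product hT.concepts hT.concepts) (PTPred.or ?_ (PTPred.unsat (by fun_prop) (by fun_prop)))
  exact PTPred.reach (by fun_prop) (by fun_prop) (by fun_prop)

end

/-! ## Soundness of the reasoning in the TBox -/

@[simp] theorem BasicRole.inverse_inverse (R : BasicRole) : R.inverse.inverse = R := by
  cases R <;> rfl

namespace TBox

variable {T : TBox}

theorem inverse_mem_roleEdges {R S : BasicRole} (h : (R, S) ∈ roleEdges T) :
    (R.inverse, S.inverse) ∈ roleEdges T := by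
  obtain ⟨α, hα, h⟩ := List.mem_flatMap.1 h
  refine List.mem_flatMap.2 ⟨α, hα, ?_⟩
  rcases α with _ | ⟨R', S' | S'⟩ <;> simp_all [TBoxAxiom.roleEdges]
  rcases h with ⟨rfl, rfl⟩ | ⟨rfl, rfl⟩ <;> simp

theorem RoleReach.inverse {R S : BasicRole} (h : RoleReach T R S) :
    RoleReach T R.inverse S.inverse := by
  induction h with
  | refl => exact .refl
  | tail _ h ih => exact ih.tail (inverse_mem_roleEdges h)

theorem RoleReach.ex {R S : BasicRole} (h : RoleReach T R S) :
    ConceptReach T (.ex R) (.ex S) := by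
  induction h with
  | refl => exact .refl
  | tail _ h ih => exact ih.tail (List.mem_append_right _ (List.mem_map.2 ⟨_, h, rfl⟩))

theorem mem_vertices_of_edge {B D : BasicConcept}
    (h : (B, D) ∈ conceptEdges T ++ conceptDisjoint T) : B ∈ vertices T ∧ D ∈ vertices T :=
  ⟨List.mem_append_left _ (List.mem_flatMap.2 ⟨_, h, by simp⟩),
    List.mem_append_left _ (List.mem_flatMap.2 ⟨_, h, by simp⟩)⟩

theorem mem_roles_of_mem_vertices {R : BasicRole} (h : .ex R ∈ vertices T) :
    R ∈ roles T ∨ R.inverse ∈ roles T := by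
  rcases List.mem_append.1 h with h | h <;> obtain ⟨p, hp, h⟩ := List.mem_flatMap.1 h
  · left
    refine List.mem_append_left _ (List.mem_flatMap.2 ⟨p, hp, ?_⟩)
    simp only [List.mem_cons, List.not_mem_nil, or_false] at h
    rcases h with h | h <;> simp [← h, BasicConcept.exRole]
  · simp only [List.mem_cons, List.not_mem_nil, or_false, BasicConcept.ex.injEq] at h
    rcases h with h | h <;> simp [h, hp]

theorem inverse_mem_vertices {R : BasicRole} (h : .ex R ∈ vertices T) :
    (.ex R.inverse ∈ vertices T) ∧ (.ex R.inverse, .ex R) ∈ jumpEdges T := by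
  rcases mem_roles_of_mem_vertices h with h | h <;>
  exact ⟨List.mem_append_right _ (List.mem_flatMap.2 ⟨_, h, by simp⟩),
    List.mem_append_right _ (List.mem_flatMap.2 ⟨_, h, by simp⟩)⟩

/-- A derivation of a clash begins with an inclusion edge or directly with a disjointness statement,
and either one mentions the concept. -/
theorem Clash.mem_vertices {B : BasicConcept} (h : Clash T B) : B ∈ vertices T := by
  rcases h with ⟨p, hp, h, _⟩ | ⟨R, hR, p, hp, h, _⟩
  · rcases h.cases_head with rfl | ⟨D, h, _⟩
    · exact (mem_vertices_of_edge (List.mem_append_right _ hp)).1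
    · exact (mem_vertices_of_edge (List.mem_append_left _ h)).1
  · obtain rfl : B = .ex R := by
      cases B <;> simp_all [BasicConcept.exRole]
    rcases h.cases_head with rfl | ⟨S, h, _⟩
    · refine List.mem_append_right _ (List.mem_flatMap.2 ⟨p.1, ?_, by simp⟩)
      exact List.mem_append_right _ (List.mem_flatMap.2 ⟨p, hp, by simp⟩)
    · exact (mem_vertices_of_edge (D := .ex S) (List.mem_append_left _
        (List.mem_append_right _ (List.mem_map.2 ⟨_, h, rfl⟩)))).1

/-- To decide satisfiability, it is enough to look at the vertices of the TBox. -/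
theorem unsat_of_clash {B D : BasicConcept} (hD : Clash T D)
    (h : Relation.ReflTransGen (fun B D => (B, D) ∈ conceptEdges T ∨
      ∃ R, B = .ex R ∧ D = .ex R.inverse) B D) : Unsat T B := by
  -- The given path may jump between `∃R` and `∃R⁻` for any role, whereas `jumpEdges` has only
  -- finitely many jumps. Going backwards from the vertex `D`, every concept on the path is a
  -- vertex, so all its jumps are available.
  suffices H : B ∈ vertices T ∧ JumpReach T B D from ⟨D, hD.mem_vertices, H.2, hD⟩
  induction h using Relation.ReflTransGen.head_induction_on with
  | refl => exact ⟨hD.mem_vertices, .refl⟩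
  | head h _ ih =>
    rcases h with h | ⟨R, rfl, rfl⟩
    · exact ⟨(mem_vertices_of_edge (List.mem_append_left _ h)).1,
        ih.2.head (List.mem_append_left _ h)⟩
    · have := inverse_mem_vertices ih.1
      rw [BasicRole.inverse_inverse] at this
      exact ⟨this.1, ih.2.head this.2⟩

end TBox

namespace Interpretation

variable {Const : Type} {J : Interpretation Const} {T : TBox}

theorem mem_inverse {R : BasicRole} {x y : Const} :
    (x, y) ∈ J.basicRole R.inverse ↔ (y, x) ∈ J.basicRole R := by
  cases R <;> rfl

/-- A normal form of the axioms. The edges that do not stand in the TBox, those between inverse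
roles and between `∃R` and `∃S`, are consequences of its role axioms. -/
theorem satTBox_iff : J.SatTBox T ↔
    (∀ p ∈ TBox.roleEdges T, J.basicRole p.1 ⊆ J.basicRole p.2) ∧
    (∀ p ∈ TBox.roleDisjoint T, ∀ q, q ∈ J.basicRole p.1 → q ∉ J.basicRole p.2) ∧
    (∀ p ∈ TBox.conceptEdges T, J.basicConcept p.1 ⊆ J.basicConcept p.2) ∧
    ∀ p ∈ TBox.conceptDisjoint T, ∀ x, x ∈ J.basicConcept p.1 → x ∉ J.basicConcept p.2 := by
  constructor
  · intro h
    have hr : ∀ p ∈ TBox.roleEdges T, J.basicRole p.1 ⊆ J.basicRole p.2 := by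
      intro p hp
      obtain ⟨α, hα, hp⟩ := List.mem_flatMap.1 hp
      have := h α hα
      rcases α with _ | ⟨R, S | S⟩ <;> simp [TBoxAxiom.roleEdges] at hp
      rcases hp with rfl | rfl
      · exact this
      · rintro ⟨x, y⟩ hxy
        exact mem_inverse.2 (this (mem_inverse.1 hxy))
    refine ⟨hr, fun p hp => ?_, fun p hp => ?_, fun p hp => ?_⟩
    · obtain ⟨α, hα, hp⟩ := List.mem_flatMap.1 hp
      have := h α hα
      rcases α with _ | ⟨R, S | S⟩ <;> simp [TBoxAxiom.roleDisjoint] at hp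
      rcases hp with rfl | rfl
      · exact fun q hq => this hq
      · rintro ⟨x, y⟩ hxy hxy'
        exact this (mem_inverse.1 hxy) (mem_inverse.1 hxy')
    · rcases List.mem_append.1 hp with hp | hp
      · obtain ⟨α, hα, hp⟩ := List.mem_flatMap.1 hp
        have := h α hα
        rcases α with ⟨B, D | D⟩ | _ <;> simp [TBoxAxiom.conceptEdges] at hp
        subst hp
        exact this
      · obtain ⟨q, hq, rfl⟩ := List.mem_map.1 hp
        rintro x ⟨y, hxy⟩
        exact ⟨y, hr q hq hxy⟩
    · obtain ⟨α, hα, hp⟩ := List.mem_flatMap.1 hp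
      have := h α hα
      rcases α with ⟨B, D | D⟩ | _ <;> simp [TBoxAxiom.conceptDisjoint] at hp
      subst hp
      exact fun q hq => this hq
  · rintro ⟨h₁, h₂, h₃, h₄⟩ α hα
    rcases α with ⟨B, D | D⟩ | ⟨R, S | S⟩
    · exact h₃ (B, D) (List.mem_append_left _ (List.mem_flatMap.2 ⟨_, hα, by
        simp [TBoxAxiom.conceptEdges]⟩))
    · exact fun x hx => h₄ (B, D) (List.mem_flatMap.2 ⟨_, hα, by
        simp [TBoxAxiom.conceptDisjoint]⟩) x hx
    · exact h₁ (R, S) (List.mem_flatMap.2 ⟨_, hα, by simp [TBoxAxiom.roleEdges]⟩)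
    · exact fun x hx => h₂ (R, S) (List.mem_flatMap.2 ⟨_, hα, by
        simp [TBoxAxiom.roleDisjoint]⟩) x hx

theorem SatTBox.conceptReach (h : J.SatTBox T) {B D : BasicConcept}
    (hBD : TBox.ConceptReach T B D) : J.basicConcept B ⊆ J.basicConcept D := by
  induction hBD with
  | refl => exact subset_rfl
  | tail _ hp ih => exact ih.trans ((satTBox_iff.1 h).2.2.1 _ hp)

theorem SatTBox.roleReach (h : J.SatTBox T) {R S : BasicRole}
    (hRS : TBox.RoleReach T R S) : J.basicRole R ⊆ J.basicRole S := by
  induction hRS with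
  | refl => exact subset_rfl
  | tail _ hp ih => exact ih.trans ((satTBox_iff.1 h).1 _ hp)

/-- A jump from `∃R` to `∃R⁻` passes to the other end of a pair, so only nonemptiness survives and
not membership of a given element. -/
theorem SatTBox.jumpReach (h : J.SatTBox T) {B D : BasicConcept}
    (hBD : TBox.JumpReach T B D) (hB : (J.basicConcept B).Nonempty) :
    (J.basicConcept D).Nonempty := by
  induction hBD with
  | refl => exact hB
  | tail _ hp ih =>
    rcases List.mem_append.1 hp with hp | hp
    · exact ih.mono ((satTBox_iff.1 h).2.2.1 _ hp)
    · obtain ⟨R, _, hp⟩ := List.mem_flatMap.1 hp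
      simp only [List.mem_cons, Prod.mk.injEq, List.not_mem_nil, or_false] at hp
      obtain ⟨x, hx⟩ := ih
      rcases hp with ⟨rfl, rfl⟩ | ⟨rfl, rfl⟩ <;> obtain ⟨y, hxy⟩ := hx
      · exact ⟨y, x, mem_inverse.2 hxy⟩
      · exact ⟨y, x, mem_inverse.1 hxy⟩

theorem SatTBox.not_conceptClash (h : J.SatTBox T) {B D : BasicConcept} {x : Const}
    (hB : x ∈ J.basicConcept B) (hD : x ∈ J.basicConcept D) : ¬TBox.ConceptClash T B D :=
  fun ⟨p, hp, h₁, h₂⟩ =>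
    (satTBox_iff.1 h).2.2.2 p hp x (h.conceptReach h₁ hB) (h.conceptReach h₂ hD)

theorem SatTBox.not_roleClash (h : J.SatTBox T) {R S : BasicRole} {q : Const × Const}
    (hR : q ∈ J.basicRole R) (hS : q ∈ J.basicRole S) : ¬TBox.RoleClash T R S :=
  fun ⟨p, hp, h₁, h₂⟩ => (satTBox_iff.1 h).2.1 p hp q (h.roleReach h₁ hR) (h.roleReach h₂ hS)

theorem SatTBox.not_unsat (h : J.SatTBox T) {B : BasicConcept} {x : Const}
    (hB : x ∈ J.basicConcept B) : ¬TBox.Unsat T B := by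
  rintro ⟨D, _, hD, hc⟩
  obtain ⟨y, hy⟩ := h.jumpReach hD ⟨x, hB⟩
  rcases hc with hc | ⟨R, hR, hc⟩
  · exact h.not_conceptClash hy hy hc
  · cases D with
    | atom A => simp [BasicConcept.exRole] at hR
    | ex S =>
      obtain rfl : R = S := by simpa [BasicConcept.exRole] using hR
      obtain ⟨z, hz⟩ := hy
      exact h.not_roleClash hz hz hc

end Interpretation

/-! ## The canonical model -/

/-- A set of assertions, closed under the passage from a role to its inverse and from a role to its
domain. -/
structure Assertions (Const : Type) where
  concept : BasicConcept → Const → Prop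
  role : BasicRole → Const → Const → Prop
  role_inverse : ∀ {R x y}, role R x y → role R.inverse y x
  concept_ex : ∀ {R x}, concept (.ex R) x ↔ ∃ y, role R x y

namespace Assertions

variable {Const : Type} (𝒜 : Assertions Const) (T : TBox)

/-- The assertions have no common model with the TBox. -/
def Inconsistent : Prop :=
  (∃ D x, 𝒜.concept D x ∧ TBox.Unsat T D) ∨
  (∃ x D E, 𝒜.concept D x ∧ 𝒜.concept E x ∧ TBox.ConceptClash T D E) ∨
  ∃ x y R S, 𝒜.role R x y ∧ 𝒜.role S x y ∧ TBox.RoleClash T R S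

/-- The interpretation satisfies all assertions. -/
structure Model (J : Interpretation Const) : Prop where
  concept : ∀ {D x}, 𝒜.concept D x → x ∈ J.basicConcept D
  role : ∀ {R x y}, 𝒜.role R x y → (x, y) ∈ J.basicRole R

variable {𝒜 T}

theorem Model.not_inconsistent {J : Interpretation Const} (hJ : 𝒜.Model J) (hT : J.SatTBox T) :
    ¬𝒜.Inconsistent T := by
  rintro (⟨D, x, h, hu⟩ | ⟨x, D, E, h₁, h₂, hc⟩ | ⟨x, y, R, S, h₁, h₂, hc⟩)
  · exact hT.not_unsat (hJ.concept h) hu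
  · exact hT.not_conceptClash (hJ.concept h₁) (hJ.concept h₂) hc
  · exact hT.not_roleClash (hJ.role h₁) (hJ.role h₂) hc

variable (𝒜 T) (w : BasicRole × ℕ → Const)

/-- The concept `∃R` has an element in every model. -/
def Live (R : BasicRole) : Prop :=
  ∃ D x, 𝒜.concept D x ∧ Relation.ReflTransGen (fun B D => (B, D) ∈ TBox.conceptEdges T ∨
    ∃ R, B = BasicConcept.ex R ∧ D = .ex R.inverse) D (.ex R)

/-- The concepts of the elements of the canonical model, where `w (R, i)` is an anonymous
`R`-successor of the elements of level `i`. -/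
def Has (x : Const) (D : BasicConcept) : Prop :=
  (∃ B, 𝒜.concept B x ∧ TBox.ConceptReach T B D) ∨
    ∃ R i, x = w (R, i) ∧ 𝒜.Live T R ∧ TBox.ConceptReach T (.ex R.inverse) D

open Classical in
/-- The level of an element of the canonical model. -/
noncomputable def level (x : Const) : ℕ :=
  if h : ∃ p, x = w p then h.choose.2 + 1 else 0

variable {w} in
theorem level_apply (hw : Injective w) (R : BasicRole) (i : ℕ) : level w (w (R, i)) = i + 1 := by
  have h : ∃ p, w (R, i) = w p := ⟨_, rfl⟩
  rw [level, dif_pos h, ← hw h.choose_spec]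

/-- The edges of the canonical model. -/
def Edge (R : BasicRole) (x y : Const) : Prop :=
  𝒜.role R x y ∨ (𝒜.Has T w x (.ex R) ∧ y = w (R, level w x)) ∨
    (𝒜.Has T w y (.ex R.inverse) ∧ x = w (R.inverse, level w y))

/-- The canonical model. -/
def canonical : Interpretation Const where
  concept A := {x | 𝒜.Has T w x (.atom A)}
  role P := {p | ∃ R, 𝒜.Edge T w R p.1 p.2 ∧ TBox.RoleReach T R (.atom P)}

variable {𝒜 T w}

theorem Edge.inverse {R : BasicRole} {x y : Const} (h : 𝒜.Edge T w R x y) :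
    𝒜.Edge T w R.inverse y x := by
  rcases h with h | h | h
  · exact .inl (𝒜.role_inverse h)
  · exact .inr (.inr (by rwa [BasicRole.inverse_inverse]))
  · exact .inr (.inl h)

theorem mem_canonical_role {S : BasicRole} {x y : Const} :
    (x, y) ∈ (𝒜.canonical T w).basicRole S ↔ ∃ R, 𝒜.Edge T w R x y ∧ TBox.RoleReach T R S := by
  cases S with
  | atom P => rfl
  | inv P =>
    constructor <;> rintro ⟨R, h₁, h₂⟩ <;> exact ⟨R.inverse, h₁.inverse, h₂.inverse⟩

theorem Has.trans {x : Const} {B D : BasicConcept} (h : 𝒜.Has T w x B)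
    (h' : TBox.ConceptReach T B D) : 𝒜.Has T w x D := by
  rcases h with ⟨B, h₁, h₂⟩ | ⟨R, i, h₁, h₂, h₃⟩
  · exact .inl ⟨B, h₁, h₂.trans h'⟩
  · exact .inr ⟨R, i, h₁, h₂, h₃.trans h'⟩

/-- If the element is a witness for `S`, the derivation that makes `∃S` live is continued by the
jump from `∃S` to `∃S⁻` and from there by inclusions. -/
theorem Has.live {x : Const} {R : BasicRole} (h : 𝒜.Has T w x (.ex R)) : 𝒜.Live T R := by
  rcases h with ⟨B, h₁, h₂⟩ | ⟨S, i, rfl, ⟨B, y, h₁, h₂⟩, h₃⟩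
  · exact ⟨B, x, h₁, .mono (fun _ _ => .inl) _ _ h₂⟩
  · exact ⟨B, y, h₁, (h₂.tail (.inr ⟨S, rfl, rfl⟩)).trans (.mono (fun _ _ => .inl) _ _ h₃)⟩

/-- In the last case `x` is a witness for `R⁻`, so it starts out in the inverse of that role's
domain concept, which is `∃R`. -/
theorem Edge.has {R : BasicRole} {x y : Const} (h : 𝒜.Edge T w R x y) : 𝒜.Has T w x (.ex R) := by
  rcases h with h | h | ⟨h, rfl⟩
  · exact .inl ⟨.ex R, 𝒜.concept_ex.2 ⟨y, h⟩, .refl⟩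
  · exact h.1
  · refine .inr ⟨R.inverse, _, rfl, h.live, ?_⟩
    rw [BasicRole.inverse_inverse]
    exact .refl

/-- For `∃S`, no edge adds a concept that was not derived, by `Edge.has`; conversely, every element
with `∃S` has its own witness on the next level. -/
theorem mem_canonical_concept {D : BasicConcept} {x : Const} :
    x ∈ (𝒜.canonical T w).basicConcept D ↔ 𝒜.Has T w x D := by
  cases D with
  | atom A => rfl
  | ex S =>
    constructor
    · rintro ⟨y, hxy⟩
      obtain ⟨R, h₁, h₂⟩ := mem_canonical_role.1 hxy
      exact h₁.has.trans h₂.ex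
    · intro h
      exact ⟨w (S, level w x), mem_canonical_role.2 ⟨S, .inr (.inl ⟨h, rfl⟩), .refl⟩⟩

theorem canonical_model : 𝒜.Model (𝒜.canonical T w) where
  concept h := mem_canonical_concept.2 (.inl ⟨_, h, .refl⟩)
  role h := mem_canonical_role.2 ⟨_, .inl h, .refl⟩

/-- A clash at either end of an anonymous edge propagates back along the derivation and makes the
asserted concept `D` unsatisfiable, against consistency. -/
theorem Live.not_clash {R : BasicRole} (hc : ¬𝒜.Inconsistent T) (hR : 𝒜.Live T R) :
    ¬TBox.Clash T (.ex R) ∧ ¬TBox.Clash T (.ex R.inverse) := by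
  obtain ⟨D, x, h₁, h₂⟩ := hR
  exact ⟨fun h => hc (.inl ⟨D, x, h₁, TBox.unsat_of_clash h h₂⟩),
    fun h => hc (.inl ⟨D, x, h₁, TBox.unsat_of_clash h (h₂.tail (.inr ⟨R, rfl, rfl⟩))⟩)⟩

/-- Inclusions hold since membership is defined by reachability. For disjointness, two conflicting
memberships have their origins either both in assertions, which is inconsistency, or both in the
same witness, which is excluded by `Live.not_clash`. Witnesses are not named by `hx`, so origins
never mix. -/
theorem canonical_satTBox (hw : Injective w) (hx : ∀ D x, 𝒜.concept D x → ∀ p, x ≠ w p)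
    (hc : ¬𝒜.Inconsistent T) : (𝒜.canonical T w).SatTBox T := by
  have hx₁ : ∀ {R x y}, 𝒜.role R x y → ∀ p, x ≠ w p := fun h => hx _ _ (𝒜.concept_ex.2 ⟨_, h⟩)
  have hx₂ : ∀ {R x y}, 𝒜.role R x y → ∀ p, y ≠ w p := fun h => hx₁ (𝒜.role_inverse h)
  refine Interpretation.satTBox_iff.2 ⟨?_, ?_, ?_, ?_⟩
  · rintro p hp ⟨x, y⟩ h
    obtain ⟨R, h₁, h₂⟩ := mem_canonical_role.1 h
    exact mem_canonical_role.2 ⟨R, h₁, h₂.tail hp⟩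
  · rintro p hp ⟨x, y⟩ h h'
    obtain ⟨R, h₁, h₂⟩ := mem_canonical_role.1 h
    obtain ⟨S, h₃, h₄⟩ := mem_canonical_role.1 h'
    -- Two edges of the same live role: their conflict would be a clash of that role with itself.
    have key : ∀ R', 𝒜.Live T R' → R = R' → S = R' → False := by
      rintro R' hl rfl rfl
      exact (hl.not_clash hc).1 (.inr ⟨S, by simp [BasicConcept.exRole], p, hp, h₂, h₄⟩)
    have hlive := h₁.has.live
    -- Each edge is asserted, or leads from `x` to its witness, or is the reverse of one from `y` to
    -- its witness. Both ends of an asserted edge are named, so it cannot meet an edge of another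
    -- kind.
    rcases h₁ with h₁ | ⟨_, h₁⟩ | ⟨_, h₁⟩ <;> rcases h₃ with h₃ | ⟨_, h₃⟩ | ⟨_, h₃⟩
    · exact hc (.inr (.inr ⟨x, y, R, S, h₁, h₃, p, hp, h₂, h₄⟩))
    · exact hx₂ h₁ _ h₃
    · exact hx₁ h₁ _ h₃
    · exact hx₂ h₃ _ h₁
    · have := hw (h₁.symm.trans h₃)
      exact key R hlive rfl (Prod.ext_iff.1 this).1.symm
    -- Here `x` and `y` would be witnesses of each other, so each would be one level above the
    -- other.
    · have e₁ := level_apply hw R (level w x)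
      have e₂ := level_apply hw S.inverse (level w y)
      rw [← h₁] at e₁
      rw [← h₃] at e₂
      omega
    · exact hx₁ h₃ _ h₁
    · have e₁ := level_apply hw R.inverse (level w y)
      have e₂ := level_apply hw S (level w x)
      rw [← h₁] at e₁
      rw [← h₃] at e₂
      omega
    · have := (Prod.ext_iff.1 (hw (h₁.symm.trans h₃))).1
      refine key R hlive rfl ?_
      rw [← BasicRole.inverse_inverse S, ← BasicRole.inverse_inverse R]
      exact congrArg _ this.symm
  · intro p hp x h
    exact mem_canonical_concept.2 ((mem_canonical_concept.1 h).trans (.single hp))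
  · intro p hp x h h'
    rcases mem_canonical_concept.1 h with ⟨B, h₁, h₂⟩ | ⟨R, i, h₁, h₂, h₃⟩ <;>
    rcases mem_canonical_concept.1 h' with ⟨B', h₁', h₂'⟩ | ⟨R', i', h₁', h₂', h₃'⟩
    · exact hc (.inr (.inl ⟨x, B, B', h₁, h₁', p, hp, h₂, h₂'⟩))
    · exact hx _ _ h₁ _ h₁'
    · exact hx _ _ h₁' _ h₁
    · have := (Prod.ext_iff.1 (hw (h₁.symm.trans h₁'))).1
      dsimp only at this
      subst this
      exact (h₂.not_clash hc).2 (.inl ⟨p, hp, h₃, h₃'⟩)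

/-- A concept assertion holds in all common models of the TBox and the assertions only if it can be
derived. -/
theorem entailed_iff [Infinite Const] {F : Finset Const} (hF : ∀ D x, 𝒜.concept D x → x ∈ F)
    {D : BasicConcept} {c : Const} :
    (∀ J : Interpretation Const, 𝒜.Model J → J.SatTBox T → c ∈ J.basicConcept D) ↔
      (∃ B, 𝒜.concept B c ∧ TBox.ConceptReach T B D) ∨ 𝒜.Inconsistent T := by
  classical
  constructor
  · intro h
    by_contra! hn
    obtain ⟨hn, hc⟩ := hn
    have : Countable BasicRole := by
      refine Function.Injective.countable (f := BasicRole.toSum) fun a b h => ?_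
      cases a <;> cases b <;> simp_all [BasicRole.toSum]
    obtain ⟨g, hg⟩ := exists_injective_nat (BasicRole × ℕ)
    -- The witnesses avoid `c` as well as `F`: a derivation of `D` at `c` then has to start from an
    -- assertion, even if `c` is not in `F`.
    have hinf : (↑(insert c F) : Set Const)ᶜ.Infinite := (insert c F).finite_toSet.infinite_compl
    let v := Set.Infinite.natEmbedding _ hinf
    have hv : ∀ n, (v n : Const) ∉ insert c F := fun n => (v n).2
    have hw : Injective fun p => (v (g p) : Const) :=
      Subtype.val_injective.comp (v.injective.comp hg)
    have := h (𝒜.canonical T fun p => v (g p)) canonical_model (canonical_satTBox hw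
      (fun D x hx p hp => hv (g p) (by
        rw [← hp]
        exact Finset.mem_insert_of_mem (hF D x hx))) hc)
    rcases mem_canonical_concept.1 this with ⟨B, h₁, h₂⟩ | ⟨R, i, h₁, _⟩
    · exact hn B h₁ h₂
    · exact hv (g (R, i)) (by
        dsimp only at h₁
        rw [← h₁]
        exact Finset.mem_insert_self _ _)
  · rintro (⟨B, h₁, h₂⟩ | h) J hJ hT
    · exact hT.conceptReach h₂ (hJ.concept h₁)
    · exact absurd h (hJ.not_inconsistent hT)

end Assertions

/-! ## Subsumption -/

namespace TBox

variable {T : TBox}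

theorem Clash.unsat {B : BasicConcept} (h : Clash T B) : Unsat T B :=
  ⟨B, h.mem_vertices, .refl, h⟩

/-- A path from `∃R` to a clash is also reached from `∃R⁻` by one more jump. -/
theorem Unsat.inverse {R : BasicRole} (h : Unsat T (.ex R)) : Unsat T (.ex R.inverse) := by
  obtain ⟨D, _, h₁, h₂⟩ := h
  refine unsat_of_clash h₂ (.head (.inr ⟨_, rfl, rfl⟩) ?_)
  rw [BasicRole.inverse_inverse]
  refine .mono (fun B D h => ?_) _ _ h₁
  rcases List.mem_append.1 h with h | h
  · exact .inl h
  · obtain ⟨R, _, h⟩ := List.mem_flatMap.1 h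
    simp only [List.mem_cons, Prod.mk.injEq, List.not_mem_nil, or_false] at h
    rcases h with ⟨rfl, rfl⟩ | ⟨rfl, rfl⟩
    · exact .inr ⟨R, rfl, rfl⟩
    · exact .inr ⟨R.inverse, rfl, by rw [BasicRole.inverse_inverse]⟩

end TBox

/-- The assertion `B(a)`, with `b` as the other end of an edge if `B` is `∃R`. -/
def Assertions.single {Const : Type} (B : BasicConcept) (a b : Const) : Assertions Const where
  role R x y := (B = .ex R ∧ x = a ∧ y = b) ∨ (B = .ex R.inverse ∧ x = b ∧ y = a)
  concept D x := (D = B ∧ x = a) ∨ (∃ R, D = .ex R ∧ B = .ex R.inverse ∧ x = b)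
  role_inverse := by
    rintro R x y (⟨rfl, rfl, rfl⟩ | ⟨rfl, rfl, rfl⟩)
    · exact .inr ⟨by rw [BasicRole.inverse_inverse], rfl, rfl⟩
    · exact .inl ⟨rfl, rfl, rfl⟩
  concept_ex := by
    intro R x
    constructor
    · rintro (⟨rfl, rfl⟩ | ⟨S, h, rfl, rfl⟩)
      · exact ⟨b, .inl ⟨rfl, rfl, rfl⟩⟩
      · obtain rfl : R = S := by simpa using h
        exact ⟨a, .inr ⟨rfl, rfl, rfl⟩⟩
    · rintro ⟨y, ⟨rfl, rfl, rfl⟩ | ⟨rfl, rfl, rfl⟩⟩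
      · exact .inl ⟨rfl, rfl⟩
      · exact .inr ⟨R, rfl, rfl, rfl⟩

/-- Apply `entailed_iff` to the single assertion `B(a)`. Because `a` and `b` are distinct, `a`
carries only `B`, and `b` at most the opposite domain concept, so an inconsistency of this assertion
is already the unsatisfiability of `B`. -/
theorem subsumes_iff {Const : Type} [Infinite Const] {T : TBox} {B D : BasicConcept} :
    Subsumes Const T (.pos B) (.pos D) ↔ TBox.ConceptReach T B D ∨ TBox.Unsat T B := by
  classical
  constructor
  · intro h
    obtain ⟨a, b, hab⟩ := exists_pair_ne Const
    -- The other asserted concept, at `b`, is the inverse domain of `B`, and the two are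
    -- unsatisfiable together.
    have seed : ∀ {E x}, (Assertions.single B a b).concept E x → TBox.Unsat T E →
        TBox.Unsat T B := by
      rintro E x (⟨rfl, _⟩ | ⟨R, rfl, rfl, _⟩) hE
      · exact hE
      · exact hE.inverse
    have h₁ := (Assertions.entailed_iff (𝒜 := .single B a b) (T := T) (F := {a, b}) (D := D)
      (c := a) (by rintro E x (⟨_, rfl⟩ | ⟨_, _, _, rfl⟩) <;> simp)).1
      fun J hJ hT => h J hT (hJ.concept (.inl ⟨rfl, rfl⟩))
    rcases h₁ with ⟨E, ⟨rfl, _⟩ | ⟨_, _, _, h₁⟩, h₂⟩ | ⟨E, x, h₁, h₂⟩ | ⟨x, E, E', h₁, h₂, h₃⟩ |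
      ⟨x, y, R, S, h₁, h₂, h₃⟩
    · exact .inl h₂
    · exact absurd h₁ hab
    · exact .inr (seed h₁ h₂)
    · right
      -- Each of the two elements carries at most one asserted concept, so a conflict is a concept
      -- clashing with itself.
      have : E = E' := by
        rcases h₁ with ⟨h₄, rfl⟩ | ⟨R, h₄, h₆, rfl⟩ <;> rcases h₂ with ⟨h₅, h⟩ | ⟨S, h₅, h₇, h⟩
        · exact h₄.trans h₅.symm
        · exact absurd h hab
        · exact absurd h.symm hab
        · have := congrArg BasicRole.inverse (BasicConcept.ex.inj (h₆.symm.trans h₇))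
          simp only [BasicRole.inverse_inverse] at this
          rw [h₄, h₅, this]
      subst this
      exact seed h₁ (TBox.Clash.unsat (.inl h₃))
    · right
      -- The pairs `(a, b)` and `(b, a)` differ, and each carries at most one asserted role.
      have : R = S := by
        rcases h₁ with ⟨h₄, rfl, rfl⟩ | ⟨h₄, rfl, rfl⟩ <;> rcases h₂ with ⟨h₅, h, _⟩ | ⟨h₅, h, _⟩
        · exact BasicConcept.ex.inj (h₄.symm.trans h₅)
        · exact absurd h hab
        · exact absurd h.symm hab
        · have := congrArg BasicRole.inverse (BasicConcept.ex.inj (h₄.symm.trans h₅))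
          simpa only [BasicRole.inverse_inverse] using this
      subst this
      exact seed ((Assertions.single B a b).concept_ex.2 ⟨y, h₁⟩)
        (TBox.Clash.unsat (.inr ⟨R, by simp [BasicConcept.exRole], h₃⟩))
  · rintro (h | h) J hJ
    · exact hJ.conceptReach h
    · exact fun x hx => absurd h (hJ.not_unsat hx)

theorem mem_concepts {T : TBox} {C : BasicConcept} :
    C ∈ TBox.concepts T ↔ ∃ α ∈ T, α.Mentions C := by
  simp only [TBox.concepts, List.mem_flatMap]
  refine exists_congr fun α => and_congr_right fun _ => ?_
  cases α <;> simp [TBoxAxiom.concepts, TBoxAxiom.Mentions]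

/-! ## Evaluation of mapping assertions -/

section Evaluation

variable {Const : Type}

/-- The value of a variable under a partial assignment. -/
def lookup (σ : List (Name × Const)) (x : Name) : Unit ⊕ Const :=
  Sum.elim (fun _ => .inl ()) (fun p => .inr p.1.2) (uncons (σ.filter (·.1 = x)))

theorem lookup_map (v : Name → Const) {l : List Name} {x : Name} (hx : x ∈ l) :
    lookup (l.map fun y => (y, v y)) x = .inr (v x) := by
  induction l with
  | nil => simp at hx
  | cons y l ih =>
    rw [List.map_cons, lookup, List.filter_cons]
    by_cases h : y = x
    · simp [h, uncons]
    · simp only [h, decide_false, Bool.false_eq_true, if_false]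
      exact ih (by simpa [Ne.symm h] using hx)

/-- The value of a term under a partial assignment. -/
def Term.lookup (σ : List (Name × Const)) (t : Term Const) : Unit ⊕ Const :=
  Sum.elim (OBDA.lookup σ) .inr t.toSum

def Atom.vars (a : Atom Const) : List Name :=
  a.args.flatMap fun t => Sum.elim (fun x => [x]) (fun _ => []) t.toSum

theorem Atom.mem_vars {a : Atom Const} {x : Name} : x ∈ a.vars ↔ .var x ∈ a.args := by
  simp only [Atom.vars, List.mem_flatMap]
  constructor
  · rintro ⟨_ | _, h, hx⟩
    · obtain rfl : x = _ := by simpa [Term.toSum] using hx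
      exact h
    · simp [Term.toSum] at hx
  · exact fun h => ⟨_, h, by simp [Term.toSum]⟩

/-- The variables of the bodies of the mapping assertions. -/
def bodyVars (M : List (Mapping Const)) : List Name := M.flatMap fun m => m.body.flatMap (·.vars)

/-- The constants that occur in the facts. -/
def factConsts (l : List (Fact Const)) : List Const := l.flatMap (·.args)

/-- All assignments of constants from a list to the variables. -/
def assignments (xs : List Name) (cs : List Const) : List (List (Name × Const)) :=
  xs.foldl (fun acc x => acc.flatMap fun σ => cs.map fun c => (x, c) :: σ) [[]]

/-- The fold puts each new variable in front, which accounts for the reversal. -/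
theorem mem_assignments (v : Name → Const) {xs : List Name} {cs : List Const}
    (h : ∀ x ∈ xs, v x ∈ cs) : xs.reverse.map (fun x => (x, v x)) ∈ assignments xs cs := by
  induction xs using List.reverseRecOn with
  | nil => simp [assignments]
  | append_singleton xs x ih =>
    rw [assignments, List.foldl_append]
    refine List.mem_flatMap.2 ⟨_, ih fun y hy => h y (by simp [hy]), ?_⟩
    exact List.mem_map.2 ⟨v x, h x (by simp), by simp⟩

/-- The partial assignment maps the body of the mapping assertion to facts. -/
def Mapping.Matches (m : Mapping Const) (l : List (Fact Const)) (σ : List (Name × Const)) : Prop :=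
  ∀ a ∈ m.body, (a.rel, a.args.map (Term.lookup σ)) ∈ l.map fun f => (f.rel, f.args.map Sum.inr)

/-- A fact `A(c)` or `P(c, d)` over the concepts and roles. -/
abbrev Assertion (Const : Type) : Type := (Name × Const) ⊕ (Name × Const × Const)

def Assertion.Holds (J : Interpretation Const) : Assertion Const → Prop
  | .inl p => p.2 ∈ J.concept p.1
  | .inr p => p.2 ∈ J.role p.1

/-- The image of the head of a mapping assertion, if all of its variables have a value. -/
def Head.assertions (σ : List (Name × Const)) (h : Head) : List (Assertion Const) :=
  Sum.elim (fun p => Sum.elim (fun _ => []) (fun c => [.inl (p.1, c)]) (lookup σ p.2))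
    (fun p => Sum.elim (fun _ => []) (fun c => Sum.elim (fun _ => [])
      (fun d => [.inr (p.1, c, d)]) (lookup σ p.2.2)) (lookup σ p.2.1)) h.toSum

open Classical in
/-- The assertions that the mapping assertions derive from the facts. -/
noncomputable def derived (M : List (Mapping Const)) (l : List (Fact Const))
    (as : List (List (Name × Const))) : List (Assertion Const) :=
  M.flatMap fun m => (as.filter fun σ => m.Matches l σ).flatMap fun σ => m.head.assertions σ

theorem Head.holds_of_assertions {J : Interpretation Const} {σ : List (Name × Const)}
    {v : Name → Const} {h : Head} (hv : ∀ x ∈ h.vars, lookup σ x = .inr (v x)) :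
    (∀ g ∈ h.assertions σ, Assertion.Holds J g) ↔ h.Holds J v := by
  cases h with
  | concept A x => simp [assertions, toSum, hv x (by simp [vars]), Assertion.Holds, Holds]
  | role P x y =>
    simp [assertions, toSum, hv x (by simp [vars]), hv y (by simp [vars]), Assertion.Holds, Holds]

theorem Head.assertions_eq_nil {σ : List (Name × Const)} {h : Head} {x : Name} (hx : x ∈ h.vars)
    (hσ : lookup σ x = .inl ()) : h.assertions σ = [] := by
  cases h with
  | concept A y =>
    obtain rfl : x = y := by simpa [vars] using hx
    simp [assertions, toSum, hσ]
  | role P y z =>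
    obtain rfl | rfl : x = y ∨ x = z := by simpa [vars] using hx
    · simp [assertions, toSum, hσ]
    · rcases h : lookup σ y with u | c <;> simp [assertions, toSum, hσ, h]

theorem Term.lookup_eq {σ : List (Name × Const)} {v : Name → Const} {t : Term Const}
    (hv : ∀ x, t = .var x → OBDA.lookup σ x = .inr (v x)) : t.lookup σ = .inr (t.eval v) := by
  cases t with
  | var x => simp [lookup, toSum, hv, eval]
  | const c => simp [lookup, toSum, eval]

/-- An interpretation satisfies the mapping assertions if and only if it satisfies the assertions
that are derived. -/
theorem sat_iff_derived [Nonempty Const] {rels : List (Name × ℕ)} {M : List (Mapping Const)}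
    (hM : ∀ m ∈ M, m.WF rels) {l : List (Fact Const)} {F : Set (Fact Const)}
    (hF : ∀ f, f ∈ l ↔ f ∈ F) {J : Interpretation Const} :
    (∀ m ∈ M, m.Sat F J) ↔
      ∀ g ∈ derived M l (assignments (bodyVars M) (factConsts l)), Assertion.Holds J g := by
  classical
  have hget : ∀ f : Fact Const, f ∈ l ↔
      (f.rel, f.args.map (Sum.inr : Const → Unit ⊕ Const)) ∈
        l.map fun f => (f.rel, f.args.map Sum.inr) := by
    intro f
    refine (List.mem_map_of_injective (f := fun f : Fact Const =>
      (f.rel, f.args.map (Sum.inr : Const → Unit ⊕ Const))) ?_).symm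
    rintro ⟨r, a⟩ ⟨r', a'⟩ h
    simp only [Prod.mk.injEq, (List.map_injective_iff.2 Sum.inr_injective).eq_iff] at h
    rw [h.1, h.2]
  constructor
  · intro h g hg
    simp only [derived, List.mem_flatMap, List.mem_filter, decide_eq_true_eq] at hg
    obtain ⟨m, hm, σ, ⟨-, hσ⟩, hg⟩ := hg
    -- A total assignment that extends `σ`; the default value is immaterial, because body variables
    -- always have a value, as shown next.
    let v : Name → Const := fun x => Sum.elim (fun _ => Classical.arbitrary _) id (lookup σ x)
    have hv : ∀ x, lookup σ x ≠ .inl () → lookup σ x = .inr (v x) := by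
      intro x hx
      rcases h : lookup σ x with u | c
      · exact absurd h hx
      · simp [v, h]
    have h₁ : m.head.Holds J v := by
      refine h m hm v fun a ha => ?_
      rw [← hF, hget]
      convert hσ a ha using 2
      rw [List.map_map]
      refine List.map_congr_left fun t ht => ?_
      rw [Function.comp_apply, Term.lookup_eq]
      rintro x rfl
      -- The arguments of the facts are all compared as `Sum.inr`, so an atom with an unassigned
      -- variable cannot match any of them.
      refine hv x fun hx => ?_
      have := hσ a ha
      simp only [List.mem_map, Prod.mk.injEq] at this
      obtain ⟨f, -, -, hf⟩ := this
      have : Term.lookup σ (.var x) ∈ a.args.map (Term.lookup σ) := List.mem_map.2 ⟨_, ht, rfl⟩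
      rw [← hf] at this
      simp [Term.lookup, Term.toSum, hx] at this
    by_cases h₂ : ∀ x ∈ m.head.vars, lookup σ x = .inr (v x)
    · exact (Head.holds_of_assertions h₂).2 h₁ g hg
    · push Not at h₂
      obtain ⟨x, hx, h₂⟩ := h₂
      rw [Head.assertions_eq_nil hx (by by_contra h; exact h₂ (hv x h))] at hg
      simp at hg
  · intro h m hm v hv
    have hbody : ∀ a ∈ m.body, ∀ x, .var x ∈ a.args → v x ∈ factConsts l := by
      intro a ha x hx
      exact List.mem_flatMap.2 ⟨_, (hF _).2 (hv a ha), List.mem_map.2 ⟨_, hx, rfl⟩⟩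
    -- A default constant exists: the head has a variable, which occurs in the matched body and so
    -- takes its value from a fact.
    obtain ⟨c, hc⟩ : ∃ c, c ∈ factConsts l := by
      obtain ⟨x, hx⟩ : ∃ x, x ∈ m.head.vars := by
        rcases m.head with ⟨_, x⟩ | ⟨_, x, _⟩ <;> exact ⟨x, by simp [Head.vars]⟩
      obtain ⟨a, ha, hx⟩ := (hM m hm).2 x hx
      exact ⟨_, hbody a ha x hx⟩
    -- The enumerated assignments give values to the variables of all mapping assertions at once.
    -- Where `v` leaves the constants of the facts it is replaced by `c`; this does not affect the
    -- variables of the body of `m`.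
    let w : Name → Const := fun x => if v x ∈ factConsts l then v x else c
    have hw : ∀ x, v x ∈ factConsts l → w x = v x := fun x hx => if_pos hx
    have hmem : ∀ a ∈ m.body, ∀ x, .var x ∈ a.args → x ∈ (bodyVars M).reverse := by
      intro a ha x hx
      simp only [bodyVars, List.mem_reverse, List.mem_flatMap]
      exact ⟨m, hm, a, ha, Atom.mem_vars.2 hx⟩
    have h₁ := mem_assignments w (xs := bodyVars M) (cs := factConsts l) fun x _ => by
      by_cases hx : v x ∈ factConsts l
      · rwa [hw x hx]
      · simpa only [w, if_neg hx] using hc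
    have h₂ : ∀ a ∈ m.body, ∀ x, .var x ∈ a.args →
        lookup ((bodyVars M).reverse.map fun x => (x, w x)) x = .inr (v x) := by
      intro a ha x hx
      rw [lookup_map w (hmem a ha x hx), hw x (hbody a ha x hx)]
    refine (Head.holds_of_assertions (σ := (bodyVars M).reverse.map fun x => (x, w x))
      fun x hx => ?_).1 fun g hg => h g ?_
    · obtain ⟨a, ha, hx⟩ := (hM m hm).2 x hx
      exact h₂ a ha x hx
    · simp only [derived, List.mem_flatMap, List.mem_filter, decide_eq_true_eq]
      refine ⟨m, hm, _, ⟨h₁, fun a ha => ?_⟩, hg⟩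
      have := (hget _).1 ((hF _).2 (hv a ha))
      rw [List.map_map] at this
      convert! this using 2
      exact List.map_congr_left fun t ht => Term.lookup_eq fun x hx => h₂ a ha x (hx ▸ ht)

/-! ## Certain answers -/

def conceptSeeds (G : List (Assertion Const)) : List (BasicConcept × Const) :=
  G.flatMap (Sum.elim (fun p => [(.atom p.1, p.2)])
    fun p => [(.ex (.atom p.1), p.2.1), (.ex (.inv p.1), p.2.2)])

def roleSeeds (G : List (Assertion Const)) : List (BasicRole × Const × Const) :=
  G.flatMap (Sum.elim (fun _ => []) fun p => [(.atom p.1, p.2), (.inv p.1, p.2.2, p.2.1)])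

theorem mem_conceptSeeds_atom {G : List (Assertion Const)} {A : Name} {x : Const} :
    (.atom A, x) ∈ conceptSeeds G ↔ .inl (A, x) ∈ G := by
  simp [conceptSeeds]

theorem mem_roleSeeds_atom {G : List (Assertion Const)} {P : Name} {x y : Const} :
    (.atom P, x, y) ∈ roleSeeds G ↔ .inr (P, x, y) ∈ G := by
  simp [roleSeeds]

theorem mem_roleSeeds_inv {G : List (Assertion Const)} {P : Name} {x y : Const} :
    (.inv P, x, y) ∈ roleSeeds G ↔ .inr (P, y, x) ∈ G := by
  simp [roleSeeds]

theorem mem_conceptSeeds_ex {G : List (Assertion Const)} {R : BasicRole} {x : Const} :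
    (.ex R, x) ∈ conceptSeeds G ↔ ∃ y, (R, x, y) ∈ roleSeeds G := by
  cases R <;> simp [conceptSeeds, roleSeeds]

/-- The closure of a list of assertions. -/
def closure (G : List (Assertion Const)) : Assertions Const where
  concept D x := (D, x) ∈ conceptSeeds G
  role R x y := (R, x, y) ∈ roleSeeds G
  role_inverse {R} _ _ h := by
    cases R with
    | atom P => exact mem_roleSeeds_inv.2 (mem_roleSeeds_atom.1 h)
    | inv P => exact mem_roleSeeds_atom.2 (mem_roleSeeds_inv.1 h)
  concept_ex := mem_conceptSeeds_ex

theorem closure_model_iff {G : List (Assertion Const)} {J : Interpretation Const} :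
    (closure G).Model J ↔ ∀ g ∈ G, Assertion.Holds J g := by
  constructor
  · rintro h (⟨A, x⟩ | ⟨P, x, y⟩) hg
    · exact h.concept (mem_conceptSeeds_atom.2 hg)
    · exact h.role (mem_roleSeeds_atom.2 hg)
  · intro h
    have hrole : ∀ {R x y}, (R, x, y) ∈ roleSeeds G → (x, y) ∈ J.basicRole R := by
      intro R x y hR
      cases R with
      | atom P => exact h _ (mem_roleSeeds_atom.1 hR)
      | inv P => exact h _ (mem_roleSeeds_inv.1 hR)
    refine ⟨fun {D x} hD => ?_, hrole⟩
    cases D with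
    | atom A => exact h _ (mem_conceptSeeds_atom.1 hD)
    | ex R =>
      obtain ⟨y, hy⟩ := mem_conceptSeeds_ex.1 hD
      exact ⟨y, hrole hy⟩

/-- The assertion `D(c)` follows from the TBox and the assertions in the list. -/
def Entailed (T : TBox) (G : List (Assertion Const)) (D : BasicConcept) (c : Const) : Prop :=
  (∃ s ∈ conceptSeeds G, s.2 = c ∧ TBox.ConceptReach T s.1 D) ∨
  (∃ s ∈ conceptSeeds G, TBox.Unsat T s.1) ∨
  (∃ s ∈ conceptSeeds G, ∃ s' ∈ conceptSeeds G, s.2 = s'.2 ∧ TBox.ConceptClash T s.1 s'.1) ∨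
  ∃ s ∈ roleSeeds G, ∃ s' ∈ roleSeeds G, s.2 = s'.2 ∧ TBox.RoleClash T s.1 s'.1

/-- `Entailed` is the criterion of `entailed_iff` with all quantifiers bounded by the lists of
seeds, which is the form that a program can check. -/
theorem entailed_closure_iff [Infinite Const] {T : TBox} {G : List (Assertion Const)}
    {D : BasicConcept} {c : Const} :
    Entailed T G D c ↔
      ∀ J : Interpretation Const, (closure G).Model J → J.SatTBox T → c ∈ J.basicConcept D := by
  classical
  rw [Assertions.entailed_iff (F := ((conceptSeeds G).map Prod.snd).toFinset) fun D x h =>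
    List.mem_toFinset.2 (List.mem_map.2 ⟨_, h, rfl⟩)]
  simp only [Entailed, closure, Assertions.Inconsistent]
  constructor
  · rintro (⟨s, hs, rfl, h⟩ | ⟨s, hs, h⟩ | ⟨s, hs, s', hs', h₁, h₂⟩ | ⟨s, hs, s', hs', h₁, h₂⟩)
    · exact .inl ⟨s.1, hs, h⟩
    · exact .inr (.inl ⟨s.1, s.2, hs, h⟩)
    · exact .inr (.inr (.inl ⟨s.2, s.1, s'.1, hs, by rw [h₁]; exact hs', h₂⟩))
    · exact .inr (.inr (.inr ⟨s.2.1, s.2.2, s.1, s'.1, hs, by rw [h₁]; exact hs', h₂⟩))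
  · rintro (⟨B, h, h'⟩ | ⟨B, x, h, h'⟩ | ⟨x, B, E, h₁, h₂, h₃⟩ | ⟨x, y, R, S, h₁, h₂, h₃⟩)
    · exact .inl ⟨_, h, rfl, h'⟩
    · exact .inr (.inl ⟨_, h, h'⟩)
    · exact .inr (.inr (.inl ⟨_, h₁, _, h₂, rfl, h₃⟩))
    · exact .inr (.inr (.inr ⟨_, h₁, _, h₂, rfl, h₃⟩))

/-- The mapping part of being a solution says that the interpretation is a model of the derived
assertions, so certain answers are entailed assertions. -/
theorem mem_certain_iff [LinearOrder Const] [Infinite Const] {B : Spec Const}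
    {I : Instance B.schema} {l : List (Fact Const)} (hl : ∀ f, f ∈ l ↔ f ∈ I.facts)
    {C : BasicConcept} {c : Const} :
    c ∈ certain B C I ↔ Entailed B.tbox
      (derived B.mappings l (assignments (bodyVars B.mappings) (factConsts l))) C c := by
  rw [entailed_closure_iff]
  simp only [closure_model_iff]
  refine forall_congr' fun J => ?_
  rw [IsSolution, and_imp, sat_iff_derived B.wf (F := (I.facts : Set (Fact Const))) (by simpa using hl)]

end Evaluation

/-! ## Certain answers in polynomial time -/

section PolyTime

variable {Const α : Type} [Enc Const] [Enc α]

@[fun_prop] theorem PT.lookup {σ : α → List (Name × Const)} {x : α → Name} (hσ : PT σ) (hx : PT x) :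
    PT fun a => lookup (σ a) (x a) :=
  PT.sumElim (f := fun a => OBDA.uncons ((σ a).filter fun p : Name × Const => p.1 = x a))
    (g := fun _ _ => (.inl () : Unit ⊕ Const))
    (h := fun _ p => .inr p.1.2)
    (PT.filter (c := fun a (p : Name × Const) => p.1 = x a) hσ (PTPred.eq (by fun_prop) (by fun_prop))).uncons
    (by fun_prop) (by fun_prop)

@[fun_prop] theorem PT.termLookup {σ : α → List (Name × Const)} {t : α → Term Const} (hσ : PT σ)
    (ht : PT t) : PT fun a => (t a).lookup (σ a) :=
  PT.sumElim (g := fun a => OBDA.lookup (σ a)) (h := fun _ => .inr) ht.termToSum (by fun_prop)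
    (by fun_prop)

@[fun_prop] theorem PT.atomVars {f : α → Atom Const} (hf : PT f) : PT fun a => (f a).vars :=
  PT.flatMap (g := fun _ t => Sum.elim (fun x => [x]) (fun _ => []) (Term.toSum t)) hf.atomArgs
    (PT.sumElim (f := fun p : α × Term Const => p.2.toSum) (g := fun _ x => [x])
      (h := fun _ _ => []) (by fun_prop) (by fun_prop) (by fun_prop))

@[fun_prop] theorem PT.bodyVars {M : α → List (Mapping Const)} (hM : PT M) :
    PT fun a => OBDA.bodyVars (M a) :=
  PT.flatMap (g := fun _ (m : Mapping Const) => m.body.flatMap fun x : Atom Const => x.vars) hM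
    (PT.flatMap (f := fun p : α × Mapping Const => p.2.body) (g := fun _ x => x.vars)
      (by fun_prop) (by fun_prop))

@[fun_prop] theorem PT.factConsts {l : α → List (Fact Const)} (hl : PT l) :
    PT fun a => factConsts (l a) :=
  PT.flatMap (g := fun _ f => Fact.args f) hl (by fun_prop)

theorem PTPred.matches {m : α → Mapping Const} {l : α → List (Fact Const)}
    {σ : α → List (Name × Const)} (hm : PT m) (hl : PT l) (hσ : PT σ) :
    PTPred fun a => (m a).Matches (l a) (σ a) := by
  refine PTPred.forall_mem (f := fun a => (m a).body)
    (c := fun a x => (x.rel, x.args.map (Term.lookup (σ a))) ∈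
      (l a).map fun f => (f.rel, f.args.map Sum.inr)) (by fun_prop) (PTPred.mem (PT.pair ?_ ?_) ?_)
  · fun_prop
  · exact PT.map (f := fun p : α × Atom Const => p.2.args) (g := fun p t => t.lookup (σ p.1))
      (by fun_prop) (by fun_prop)
  · refine PT.map (f := fun p : α × Atom Const => l p.1)
      (g := fun _ f => (f.rel, f.args.map Sum.inr)) (by fun_prop) (PT.pair (by fun_prop) ?_)
    exact PT.map (f := fun p : (α × Atom Const) × Fact Const => p.2.args) (g := fun _ => Sum.inr)
      (by fun_prop) (by fun_prop)

@[fun_prop] theorem PT.headAssertions {h : α → Head} {σ : α → List (Name × Const)} (hh : PT h)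
    (hσ : PT σ) : PT fun a => (h a).assertions (σ a) := by
  refine PT.sumElim (f := fun a => (h a).toSum)
    (g := fun a p => Sum.elim (fun _ => []) (fun c => [(.inl (p.1, c) : Assertion Const)]) (OBDA.lookup (σ a) p.2))
    (h := fun a p => Sum.elim (fun _ => []) (fun c => Sum.elim (fun _ => [])
      (fun d => [(.inr (p.1, c, d) : Assertion Const)]) (OBDA.lookup (σ a) p.2.2)) (OBDA.lookup (σ a) p.2.1))
    (by fun_prop) ?_ ?_
  · exact PT.sumElim (f := fun p : α × Name × Name => OBDA.lookup (σ p.1) p.2.2)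
      (g := fun _ _ => []) (h := fun p c => [(.inl (p.2.1, c) : Assertion Const)])
      (by fun_prop) (by fun_prop) (by fun_prop)
  · refine PT.sumElim (f := fun p : α × Name × Name × Name => OBDA.lookup (σ p.1) p.2.2.1)
      (g := fun _ _ => []) (h := fun p c => Sum.elim (fun _ => [])
      (fun d => [(.inr (p.2.1, c, d) : Assertion Const)]) (OBDA.lookup (σ p.1) p.2.2.2))
      (by fun_prop) (by fun_prop) ?_
    exact PT.sumElim
      (f := fun p : (α × Name × Name × Name) × Const => OBDA.lookup (σ p.1.1) p.1.2.2.2)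
      (g := fun _ _ => []) (h := fun p d => [(.inr (p.1.2.1, p.2, d) : Assertion Const)])
      (by fun_prop) (by fun_prop) (by fun_prop)

theorem PT.derived {M : α → List (Mapping Const)} {l : α → List (Fact Const)}
    {as : α → List (List (Name × Const))} (hM : PT M) (hl : PT l) (has : PT as) :
    PT fun a => derived (M a) (l a) (as a) := by
  classical
  refine PT.flatMap (g := fun a m => ((as a).filter fun σ => m.Matches (l a) σ).flatMap
    fun σ => m.head.assertions σ) hM ?_
  refine PT.flatMap (f := fun p : α × Mapping Const => (as p.1).filter fun σ => p.2.Matches (l p.1) σ)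
    (g := fun p σ => p.2.head.assertions σ) ?_ (by fun_prop)
  exact PT.filter (f := fun p : α × Mapping Const => as p.1)
    (c := fun p σ => p.2.Matches (l p.1) σ) (by fun_prop)
    (PTPred.matches (by fun_prop) (by fun_prop) (by fun_prop))

@[fun_prop] theorem PT.conceptSeeds {G : α → List (Assertion Const)} (hG : PT G) :
    PT fun a => conceptSeeds (G a) :=
  PT.flatMap (g := fun _ => Sum.elim (fun p : Name × Const => [(BasicConcept.atom p.1, p.2)])
    fun p : Name × Const × Const => [(.ex (.atom p.1), p.2.1), (.ex (.inv p.1), p.2.2)]) hG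
    (PT.sumElim (f := fun p : α × Assertion Const => p.2) (g := fun _ p => [(BasicConcept.atom p.1, p.2)])
      (h := fun _ p => [(.ex (.atom p.1), p.2.1), (.ex (.inv p.1), p.2.2)])
      (by fun_prop) (by fun_prop) (by fun_prop))

@[fun_prop] theorem PT.roleSeeds {G : α → List (Assertion Const)} (hG : PT G) :
    PT fun a => roleSeeds (G a) :=
  PT.flatMap (g := fun _ => Sum.elim (fun _ : Name × Const => [])
    fun p : Name × Const × Const => [(BasicRole.atom p.1, p.2), (.inv p.1, p.2.2, p.2.1)]) hG
    (PT.sumElim (f := fun p : α × Assertion Const => p.2) (g := fun _ _ => [])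
      (h := fun _ p => [(BasicRole.atom p.1, p.2), (.inv p.1, p.2.2, p.2.1)])
      (by fun_prop) (by fun_prop) (by fun_prop))

theorem PTPred.entailed {T : α → TBox} {G : α → List (Assertion Const)} {D : α → BasicConcept}
    {c : α → Const} (hT : PT T) (hG : PT G) (hD : PT D) (hc : PT c) :
    PTPred fun a => Entailed (T a) (G a) (D a) (c a) := by
  refine PTPred.or ?_ (PTPred.or ?_ (PTPred.or ?_ ?_))
  · exact PTPred.exists_mem (c := fun a s => s.2 = c a ∧ TBox.ConceptReach (T a) s.1 (D a))
      hG.conceptSeeds (PTPred.and (PTPred.eq (by fun_prop) (by fun_prop))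
        (PTPred.reach (by fun_prop) (by fun_prop) (by fun_prop)))
  · exact PTPred.exists_mem (c := fun a s => TBox.Unsat (T a) s.1) hG.conceptSeeds
      (PTPred.unsat (by fun_prop) (by fun_prop))
  · refine PTPred.exists_mem (c := fun a s => ∃ s' ∈ OBDA.conceptSeeds (G a),
      s.2 = s'.2 ∧ TBox.ConceptClash (T a) s.1 s'.1) hG.conceptSeeds ?_
    exact PTPred.exists_mem (f := fun p : α × BasicConcept × Const => OBDA.conceptSeeds (G p.1))
      (c := fun p s' => p.2.2 = s'.2 ∧ TBox.ConceptClash (T p.1) p.2.1 s'.1) (by fun_prop)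
      (PTPred.and (PTPred.eq (by fun_prop) (by fun_prop))
        (PTPred.conceptClash (by fun_prop) (by fun_prop) (by fun_prop)))
  · refine PTPred.exists_mem (c := fun a s => ∃ s' ∈ OBDA.roleSeeds (G a),
      s.2 = s'.2 ∧ TBox.RoleClash (T a) s.1 s'.1) hG.roleSeeds ?_
    exact PTPred.exists_mem (f := fun p : α × BasicRole × Const × Const => OBDA.roleSeeds (G p.1))
      (c := fun p s' => p.2.2 = s'.2 ∧ TBox.RoleClash (T p.1) p.2.1 s'.1) (by fun_prop)
      (PTPred.and (PTPred.eq (by fun_prop) (by fun_prop))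
        (PTPred.roleClash (by fun_prop) (by fun_prop) (by fun_prop)))

/-- The list of the assignments has polynomial length if the number of variables is fixed. -/
theorem sz_assignments {xs : List Name} {cs : List Const} {N : ℕ} (hx : sz xs ≤ N)
    (hc : sz cs ≤ N) : sz (assignments xs cs) ≤ 4 * (2 * N ^ 2 + N + 1) ^ xs.length := by
  induction xs using List.reverseRecOn with
  | nil => simp [assignments, sz_cons, sz_nil]
  | append_singleton xs x ih =>
    have ih := ih ((sz_sublist (by simp)).trans hx)
    have hx : sz x ≤ N := (sz_mem (by simp)).trans hx
    rw [assignments, List.foldl_append, ← assignments, List.length_append, List.length_singleton,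
      pow_succ, ← mul_assoc]
    refine le_trans ?_ (Nat.mul_le_mul_right _ ih)
    generalize assignments xs cs = as
    have h₁ : ∀ σ ∈ as, sz (cs.map fun c => (x, c) :: σ) ≤ 2 + (2 * N ^ 2 + N) * sz σ := by
      intro σ _
      refine (sz_le_of_forall (n := N + N + sz σ) fun τ hτ => ?_).trans ?_
      · obtain ⟨c, hc', rfl⟩ := List.mem_map.1 hτ
        have := (sz_mem hc').trans hc
        rw [sz_cons, sz_prod]
        dsimp only
        omega
      · rw [List.length_map]
        have h₁ := (length_le_sz cs).trans hc
        have h₂ := sz_pos σ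
        -- Sizes are positive, so the additive cost of a new binding can be absorbed into a factor.
        have h₃ : N + N + sz σ ≤ (2 * N + 1) * sz σ := by nlinarith
        calc _ ≤ 2 + N * ((2 * N + 1) * sz σ) := by gcongr
          _ = _ := by ring
    -- Without its two brackets the size of a list is additive over its entries, hence the term `sz
    -- as - 2`.
    have h₂ : sz (as.flatMap fun σ => cs.map fun c => (x, c) :: σ) ≤
        2 + (2 * N ^ 2 + N) * (sz as - 2) := by
      induction as with
      | nil => simp [sz_nil]
      | cons σ as ih =>
        have h₃ := ih fun τ hτ => h₁ τ (by simp [hτ])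
        have h₄ := h₁ σ (by simp)
        have h₅ := sz_append (cs.map fun c => (x, c) :: σ)
          (as.flatMap fun σ => cs.map fun c => (x, c) :: σ)
        have h₆ := sz_sublist as.nil_sublist
        rw [sz_nil] at h₆
        rw [List.flatMap_cons, sz_cons, Nat.add_sub_assoc h₆, mul_add]
        omega
    have h₃ := sz_sublist as.nil_sublist
    rw [sz_nil] at h₃
    have h₄ := Nat.mul_le_mul_left (2 * N ^ 2 + N) (Nat.sub_le (sz as) 2)
    simp only [List.foldl_cons, List.foldl_nil]
    linarith

end PolyTime

/-- The data of a specification that the algorithm uses: the TBox, the relation names with their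
arities, and the mapping assertions. -/
abbrev SpecData (Const : Type) : Type := TBox × List (Name × ℕ) × List (Mapping Const)

/-- An input of the algorithm for certain answers, with the facts of an instance in a list. -/
abbrev Query (Const : Type) : Type := BasicConcept × List (Fact Const) × Const

/-- The answer to a query is positive. -/
def SpecData.Answers {Const : Type} (B : SpecData Const) (q : Query Const) : Prop :=
  Entailed B.1 (derived B.2.2 q.2.1 (assignments (bodyVars B.2.2) (factConsts q.2.1))) q.1 q.2.2

/-- A program for certain answers, which takes polynomial time if the specification is fixed. -/
theorem exists_answering_program (Const : Type) [Enc Const] :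
    ∃ c : Cmd, ∀ B : SpecData Const, ∃ p : Polynomial ℕ, ∀ q : Query Const, ∃ b : Bool,
      (b = true ↔ B.Answers q) ∧
        Runs c (single (enc B ++ enc q)) (single [Sym.ofBool b]) (p.eval (sz q)) := by
  have hv : PT fun a : SpecData Const × Query Const => bodyVars a.1.2.2 := by fun_prop
  have hc : PT fun a : SpecData Const × Query Const => factConsts a.2.2.1 := by fun_prop
  -- The list of assignments is not polynomial in specification and query together, so `PT.foldl`
  -- does not apply. Here the program comes first and the exponential size bound is supplied
  -- afterwards.
  obtain ⟨P, Q, hP⟩ := PT.foldl_bound (i := fun _ => [([] : List (Name × Const))])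
    (step := fun a acc x => acc.flatMap fun σ => (factConsts a.2.2.1).map fun c => (x, c) :: σ)
    hv (by fun_prop) (PT.flatMap
      (f := fun p : (SpecData Const × Query Const) × List (List (Name × Const)) × Name => p.2.1)
      (g := fun p σ => (factConsts p.1.2.2.1).map fun c => (p.2.2, c) :: σ) (by fun_prop)
      (PT.map (f := fun p : ((SpecData Const × Query Const) × List (List (Name × Const)) × Name) ×
        List (Name × Const) => factConsts p.1.1.2.2.1) (g := fun p c => (p.1.2.2, c) :: p.2)
        (by fun_prop) (by fun_prop)))
  have hd : PTPred fun p : List (List (Name × Const)) × SpecData Const × Query Const =>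
      Entailed p.2.1.1 (derived p.2.1.2.2 p.2.2.2.1 p.1) p.2.2.1 p.2.2.2.2 :=
    PTPred.entailed (by fun_prop) (PT.derived (by fun_prop) (by fun_prop) (by fun_prop))
      (by fun_prop) (by fun_prop)
  obtain ⟨r₁, h₁⟩ := hv.sz_le
  obtain ⟨r₂, h₂⟩ := hc.sz_le
  obtain ⟨I, pI, hI⟩ := PT.id (α := SpecData Const × Query Const)
  obtain ⟨D, pD, hD⟩ := hd
  have hP := hP (fun a => 4 * (2 * (r₁ + r₂).eval (sz a) ^ 2 + (r₁ + r₂).eval (sz a) + 1) ^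
    (bodyVars a.1.2.2).length) (by
    intro a l₁ l₂ h
    rw [h]
    refine (sz_assignments (N := (r₁ + r₂).eval (sz a)) ?_ ?_).trans ?_
    · have := h₁ a
      have h₃ : sz l₁ ≤ sz (bodyVars a.1.2.2) := by
        rw [h]
        exact sz_sublist (by simp)
      simp only [Polynomial.eval_add]
      omega
    · have := h₂ a
      simp only [Polynomial.eval_add]
      omega
    · refine Nat.mul_le_mul_left _ (Nat.pow_le_pow_right (by omega) (by simp)))
  obtain ⟨E, hE⟩ : ∃ E, Computes E _ _ := ⟨_, hD.comp (hP.pair hI)⟩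
  refine ⟨E 0, fun B => ?_⟩
  -- With `B` fixed the exponent is a constant, so the bound on the assignments is a polynomial; the
  -- size of `B` itself enters the time bound as the constant `sz B`.
  let V : Polynomial ℕ := .C 4 * (.C 2 * (r₁ + r₂) ^ 2 + (r₁ + r₂) + 1) ^ (bodyVars B.2.2).length
  refine ⟨(.C 60 * .X + .C 20 * Q.comp (.X + V) + .C 20 * pI + .C 20 +
    pD.comp (.X + .X + Q.comp (.X + V))).comp (.X + .C (sz B)), fun q => ?_⟩
  have h := hE 0 (single (enc B ++ enc q)) (B, q) (by simp [single, enc_prod])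
    fun k hk => by simp [single, hk.ne']
  refine ⟨@decide (B.Answers q) (Classical.propDecidable _), by simp, h.congr ?_ ?_⟩
  · rw [single, update_idem, single]
    rfl
  · have hV : V.eval (sz (B, q)) = 4 * (2 * (r₁ + r₂).eval (sz (B, q)) ^ 2 +
        (r₁ + r₂).eval (sz (B, q)) + 1) ^ (bodyVars B.2.2).length := by
      simp [V]
    have h₃ := hP.sz_le (B, q)
    dsimp only at h₃ ⊢
    rw [← hV] at h₃ ⊢
    have h₄ : sz q + sz B = sz (B, q) := by
      rw [sz_prod (B, q)]
      exact Nat.add_comm _ _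
    simp only [Polynomial.eval_comp, Polynomial.eval_add, Polynomial.eval_mul, Polynomial.eval_C,
      Polynomial.eval_X, h₄]
    refine Nat.add_le_add_left (eval_mono pD ?_) _
    rw [sz_prod]
    dsimp only
    omega

/-! ## The encoding of the answering machine -/

/-- The last letter is pushed first, hence the reversal. Each push is an opcode, the number of stack
0, and a table with one entry for each of the two states, both equal to the letter. -/
theorem encStmt_pushWord (k : ℕ) {l : ℕ} (w : List Sym) (q : Cmd.Code k l) :
    encStmt (w.foldl (fun q a => (.push 0 (fun _ => a) q : Cmd.Code k l)) q) =
      (w.reverse.flatMap fun a => [.zero, .zero, .zero] ++ encNat 0 ++ [a, a]) ++ encStmt q := by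
  induction w generalizing q with
  | nil => rfl
  | cons a w ih =>
    rw [List.foldl_cons, ih, List.reverse_cons, List.flatMap_append, List.append_assoc]
    simp [encStmt]

theorem ofFn_machineProg (w : List Sym) (c : Cmd) :
    List.ofFn (machineProg w c) = pushWord c.width (c.size + 1) w ::
      (c.compile c.width (c.size + 1) 1 (c.size + 1) ++ [.load (fun _ => 0) .halt]) := by
  refine List.ext_getElem (by simp [Cmd.length_compile]) fun i h₁ h₂ => ?_
  rw [List.getElem_ofFn]
  rfl

/-- The identity serves as the bijection of alphabets; `key` transports along the resulting
`List.map_id` equalities. -/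
theorem MachineCode.computableInPolyTime {α β : Type} {ea : α → List Sym} {eb : β → List Sym}
    {f : α → β} (M : MachineCode) (p : Polynomial ℕ)
    (h : ∀ a, M.OutputsWithin (ea a) (eb (f a)) (p.eval (ea a).length)) :
    Nonempty (Turing.TM2ComputableInPolyTime ea eb f) := by
  have key : ∀ {x x' y y' : List Sym} {t}, x' = x → y' = y → M.OutputsWithin x y t →
      Nonempty (Turing.TM2OutputsInTime M.toTM x' (some y') t) := by
    rintro x _ y _ t rfl rfl h
    exact h
  exact ⟨⟨⟨M.toTM, Equiv.refl Sym, Equiv.refl Sym⟩, p, fun a =>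
    Classical.choice (key (List.map_id _) (List.map_id _) (h a))⟩⟩

/-- The machine that puts `w` in front of its input depends on `w` in a simple way. -/
theorem exists_encMachine (c : Cmd) : ∃ u v : List Sym, ∀ w, encMachine (machine w c) =
    u ++ ((w.reverse.flatMap fun a => [.zero, .zero, .zero] ++ encNat 0 ++ [a, a]) ++ v) := by
  refine ⟨encNat (c.width + 1) ++ encNat (c.size + 1 + 1) ++ encNat 2 ++ encNat 0 ++ encNat 0 ++
    encNat 0 ++ encNat 0, encStmt (.goto fun _ => Fin.ofNat _ 1 : Cmd.Code c.width (c.size + 1)) ++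
    (c.compile c.width (c.size + 1) 1 (c.size + 1) ++
      [(.load (fun _ => 0) .halt : Cmd.Code c.width (c.size + 1))]).flatMap encStmt, fun w => ?_⟩
  refine congrArg (_ ++ ·) (?_ : (List.ofFn (machineProg w c)).flatMap encStmt = _)
  rw [ofFn_machineProg, List.flatMap_cons, pushWord, encStmt_pushWord, List.append_assoc]

/-- Replace the symbols on stack `i` by words, in reverse order, on stack `j`. -/
def Cmd.emit (i j : ℕ) (f : Sym → List Sym) : Cmd :=
  .while i Option.isSome (sel i fun a => .seq (.pop i) (pushes j (f a)))

/-- Per symbol: one loop test, at most three tests for the letter, one pop, and at most `L + 1`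
steps for the pushes. -/
theorem Cmd.runs_emit {i j : ℕ} (hij : i ≠ j) {f : Sym → List Sym} {L : ℕ}
    (hf : ∀ a, (f a).length ≤ L) (s : Store) :
    Runs (emit i j f) s (update (update s i []) j ((s i).reverse.flatMap f ++ s j))
      ((L + 6) * (s i).length + 1) := by
  generalize hw : s i = w
  induction w generalizing s with
  | nil =>
    refine (Runs.while_false (by simp [hw])).congr ?_ (by omega)
    rw [← hw, update_eq_self]
    simp [hw]
  | cons a w ih =>
    have h₁ : Runs (.seq (.pop i) (pushes j (f a))) s (update (update s i w) j (f a ++ s j))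
        (L + 2) :=
      ((Runs.pop s i).seq (runs_pushes j (f a) _)).congr
        (by simp [hw, update_of_ne hij.symm]) (by have := hf a; omega)
    have h₂ : Runs (emit i j f) _ _ _ :=
      ih (update (update s i w) j (f a ++ s j)) (by simp [update_of_ne hij])
    refine (Runs.while_true (by simp [hw])
      (runs_sel (f := fun a => .seq (.pop i) (pushes j (f a))) hw h₁) h₂).congr ?_
      (by simp only [List.length_cons, mul_add]; omega)
    funext k
    simp only [update_apply]
    split_ifs <;> simp_all

/-- A word computed from the input, followed by the input with its symbols replaced by words, in
reverse order, between two fixed words. -/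
theorem exists_description_program {α β : Type} [Enc α] [Enc β] {g : α → β} (hg : PT g)
    (u v : List Sym) (f : Sym → List Sym) :
    ∃ c : Cmd, ∃ p : Polynomial ℕ, ∀ a, Runs c (single (enc a))
      (single (enc (g a) ++ (u ++ ((enc a).reverse.flatMap f ++ v)))) (p.eval (sz a)) := by
  obtain ⟨P, p, hP⟩ := hg
  obtain ⟨L, hL⟩ : ∃ L, ∀ a, (f a).length ≤ L :=
    ⟨Finset.univ.sup fun a => (f a).length, fun a =>
      Finset.le_sup (f := fun a => (f a).length) (Finset.mem_univ a)⟩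
  -- Stack 1 is for the value of `g`, and stack 2 collects the output from back to front. Reading
  -- the input on stack 0 from the front therefore leaves its translation reversed, which is the
  -- order in which a machine lists its pushes.
  refine ⟨.seq (Cmd.copy 0 1 2) <| .seq (P 1) <| .seq (Cmd.pushes 2 v) <|
    .seq (Cmd.emit 0 2 f) <| .seq (Cmd.pushes 2 u) <| .seq (Cmd.move 1 2 3) (Cmd.move 2 0 3),
    .C 1000 * (.X + p) + .C (L + 6) * .X + .C 12 * (.X + p + .C u.length + .C L * .X + .C v.length) +
      .C u.length + .C v.length + .C 1000, fun a => ?_⟩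
  set x := enc a with hx
  set y := enc (g a) with hy
  have h₁ := Cmd.runs_copy (i := 0) (j := 1) (t := 2) (by omega) (by omega) (by omega)
    (s := single x) (by simp [single])
  have h₂ := hP 1 (update (single x) 1 x) a (by simp [hx]) fun k hk => by
    simp [single, show k ≠ 1 by omega, show k ≠ 0 by omega]
  have h₃ := Cmd.runs_pushes 2 v (update (single x) 1 y)
  have h₄ := Cmd.runs_emit (i := 0) (j := 2) (by omega) hL
    (update (update (single x) 1 y) 2 v)
  have h₅ := Cmd.runs_pushes 2 u (update (update (single []) 1 y) 2 (x.reverse.flatMap f ++ v))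
  have h₆ := Cmd.runs_move (i := 1) (j := 2) (t := 3) (by omega) (by omega) (by omega)
    (s := update (update (single []) 1 y) 2 (u ++ (x.reverse.flatMap f ++ v))) (by simp [single])
  have h₇ := Cmd.runs_move (i := 2) (j := 0) (t := 3) (by omega) (by omega) (by omega)
    (s := update (single []) 2 (y ++ (u ++ (x.reverse.flatMap f ++ v)))) (by simp [single])
  have hlen : y.length ≤ x.length + p.eval x.length := by
    have := h₂.length_le 1
    simpa [sz, ← hx, ← hy] using this
  have hflat : (x.reverse.flatMap f).length ≤ L * x.length := by
    rw [List.length_flatMap, mul_comm, ← x.length_reverse]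
    refine (List.sum_le_card_nsmul _ L fun n hn => ?_).trans (by simp)
    obtain ⟨b, -, rfl⟩ := List.mem_map.1 hn
    exact hL b
  refine ((h₁.congr ?_ le_rfl).seq <| (h₂.congr ?_ le_rfl).seq <| (h₃.congr ?_ le_rfl).seq <|
    (h₄.congr ?_ le_rfl).seq <| (h₅.congr ?_ le_rfl).seq <| (h₆.congr ?_ le_rfl).seq h₇).congr ?_ ?_
  all_goals try
    funext k
    simp only [single, update_apply]
    split_ifs <;> simp_all
  simp only [single, update_apply, Polynomial.eval_add, Polynomial.eval_mul, Polynomial.eval_C,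
    Polynomial.eval_X, sz, ← hx, List.length_append, OfNat.ofNat_ne_zero, one_ne_zero, if_true,
    if_false, OfNat.zero_ne_ofNat, zero_ne_one, OfNat.one_ne_ofNat]
  generalize eq₁ : (L + 6) * x.length = m₁
  generalize eq₂ : L * x.length = m₂ at hflat ⊢
  omega

/-! ## The encodings of the problem -/

theorem enc_nat (n : ℕ) : enc n = encNat n := enc_name n.bits

theorem enc_basicRole (R : BasicRole) : enc R = encBasicRole R := by
  cases R <;> exact congrArg _ (enc_name _)

theorem enc_basicConcept (B : BasicConcept) : enc B = encBasicConcept B := by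
  cases B
  · exact congrArg _ (enc_name _)
  · exact congrArg _ (enc_basicRole _)

theorem enc_conceptExpr (C : ConceptExpr) : enc C = encConceptExpr C := by
  cases C <;> exact congrArg _ (enc_basicConcept _)

theorem enc_roleExpr (E : RoleExpr) : enc E = encRoleExpr E := by
  cases E <;> exact congrArg _ (enc_basicRole _)

theorem enc_axiom (α : TBoxAxiom) : enc α = encAxiom α := by
  cases α with
  | concept B C => rw [encAxiom, ← enc_basicConcept, ← enc_conceptExpr]; rfl
  | role R E => rw [encAxiom, ← enc_basicRole, ← enc_roleExpr]; rfl

theorem enc_head (h : Head) : enc h = encHead h := by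
  cases h with
  | concept A x => rw [encHead, ← enc_name, ← enc_name]; rfl
  | role P x y => rw [encHead, ← enc_name, ← enc_name, ← enc_name, List.append_assoc]; rfl

section

variable {Const : Type} (e : Const → List Bool) (he : Injective e)

theorem enc_const (c : Const) : (Enc.ofInjective e he).enc c = encWord (e c) := enc_name (e c)

theorem enc_term (t : Term Const) : letI := Enc.ofInjective e he; enc t = encTerm e t := by
  cases t
  · exact congrArg _ (enc_name _)
  · exact congrArg _ (enc_const e he _)

theorem enc_atom (a : Atom Const) : letI := Enc.ofInjective e he; enc a = encAtom e a := by
  let := Enc.ofInjective e he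
  rw [encAtom, ← funext (enc_term e he), ← enc_name]
  rfl

theorem enc_mapping (m : Mapping Const) :
    letI := Enc.ofInjective e he; enc m = encMapping e m := by
  let := Enc.ofInjective e he
  rw [encMapping, ← funext (enc_atom e he), ← enc_head]
  rfl

theorem enc_fact (f : Fact Const) : letI := Enc.ofInjective e he; enc f = encFact e f := by
  let := Enc.ofInjective e he
  rw [encFact, ← enc_name]
  simp only [← enc_const e he]
  rfl

/-- The part of the specification that is encoded. -/
def Spec.data (B : Spec Const) : SpecData Const := (B.tbox, B.schema.rels, B.mappings)

theorem enc_data (B : Spec Const) :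
    letI := Enc.ofInjective e he; enc B.data = encSpec e B := by
  let := Enc.ofInjective e he
  have h : (fun r : Name × ℕ => encWord r.1 ++ encNat r.2) = enc :=
    funext fun r => by rw [← enc_name, ← enc_nat]; rfl
  rw [encSpec, h, ← funext enc_axiom, ← funext (enc_mapping e he), List.append_assoc]
  rfl

theorem enc_query (C : BasicConcept) (l : List (Fact Const)) (c : Const) :
    letI := Enc.ofInjective e he; enc ((C, l, c) : Query Const) = encQuery e C l c := by
  let := Enc.ofInjective e he
  rw [encQuery, ← enc_basicConcept, ← funext (enc_fact e he), ← enc_const e he, List.append_assoc]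
  rfl

end

theorem enc_lists (D : Description) :
    encDescription D = enc (D.concepts, D.sub) ++ encMachine D.machine := by
  have h : (fun p : BasicConcept × BasicConcept => encBasicConcept p.1 ++ encBasicConcept p.2) = enc :=
    funext fun p => by rw [← enc_basicConcept, ← enc_basicConcept]; rfl
  rw [encDescription, h, ← funext enc_basicConcept]
  rfl

end OBDA

/-! ### The polynomial-time construction of the induced ontology -/

theorem mainTheorem7 {Const : Type} [LinearOrder Const] [DenselyOrdered Const] [Infinite Const]
    (e : Const → List Bool) (he : Function.Injective e) :
    ∃ f : OBDA.Spec Const → OBDA.Description,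
      Nonempty (Turing.TM2ComputableInPolyTime (OBDA.encSpec e) OBDA.encDescription f) ∧
      ∀ B : OBDA.Spec Const, (f B).Describes e (OBDA.inducedOntology B) := by
  open OBDA in
  let : Enc Const := Enc.ofInjective e he
  obtain ⟨c, hc⟩ := exists_answering_program Const
  -- The program `c` is the same for all specifications; only the hard-wired word depends on `B`.
  refine ⟨fun B => ⟨TBox.concepts B.tbox, TBox.subsumptions B.tbox, machine (encSpec e B) c⟩,
    ?_, fun B => ⟨fun C => mem_concepts, fun C C' => ?_, ?_⟩⟩
  · obtain ⟨u, v, huv⟩ := exists_encMachine c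
    obtain ⟨d, p, hd⟩ := exists_description_program
      (g := fun B : SpecData Const => (TBox.concepts B.1, TBox.subsumptions B.1))
      (PT.pair (PT.concepts (by fun_prop)) (PT.subsumptions (by fun_prop))) u v
      fun a => [.zero, .zero, .zero] ++ encNat 0 ++ [a, a]
    -- The translating machine has nothing hard-wired. The constant 2 accounts for the first and
    -- last steps that `machine` adds to its program.
    refine (machine [] d).computableInPolyTime (p + .C 2) fun B => ?_
    obtain ⟨t, ht, h⟩ := hd B.data
    rw [enc_data e he, ← huv] at h
    rw [sz, enc_data e he] at ht
    rw [enc_lists]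
    exact machine_outputsWithin (w := []) h (by simpa using ht)
  · simp only [TBox.subsumptions, List.mem_filter, List.pair_mem_product, decide_eq_true_eq,
      ← subsumes_iff (Const := Const), mem_concepts]
    exact ⟨fun h => ⟨h.1.1, h.1.2, h.2⟩, fun ⟨h₁, h₂, h⟩ => ⟨⟨h₁, h₂⟩, h⟩⟩
  · obtain ⟨p, hp⟩ := hc B.data
    refine ⟨p + .C 2, fun C I x l hl => ?_⟩
    obtain ⟨b, hb, t, ht, h⟩ := hp (C.1, l, x)
    refine ⟨b, hb.trans (mem_certain_iff hl).symm, ?_⟩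
    rw [enc_data e he, enc_query e he] at h
    rw [sz, enc_query e he] at ht
    exact machine_outputsWithin h (by simpa using ht)
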